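/- **Setting.** Let $\mathbb T^3=\mathbb R^3/\mathbb Z^3$. For $F\in\mathbb M^{3\times3}$ let $\Phi(F)=(F,\operatorname{cof}F,\det F)\in\mathbb R^{19}$. Let $\hat\psi=\hat\psi(\xi,\theta)$, $\xi=(F,\zeta,w)\in\mathbb M^{3\times 3}\times\mathbb M^{3\times 3}\times\mathbb R\simeq\mathbb R^{19}$, be of class $C^3$ on $\mathbb R^{19}\times(0,\infty)$, and put $$\hat\eta=-\partial_\theta\hat\psi,\qquad \hat e=\hat\psi-\theta\,\partial_\theta\hat\psi,\qquad \Sigma_{i\alpha}=\frac{\partial\hat\psi}{\partial\xi^B}(\xi,\theta)\,\frac{\partial\Phi^B}{\partial F_{i\alpha}}(F).$$ Assume that, for all $\xi$ and all $\theta>0$, $\nabla^2_\xi\hat\psi(\xi,\theta)$ is positive definite and $\hat\eta_\theta(\xi,\theta)>0$. Let $p\ge4$ and $q,r,\ell>1$, write $N(\xi,\theta)=|F|^p+|\zeta|^q+|w|^r+\theta^\ell$, and assume the growth conditions $$cN-C_0\le\hat e\le C_0N+C_0\quad\text{for some } c,C_0>0,$$ $$\lim_{N\to\infty}\frac{|\partial_F\hat\psi|+|\partial_\zeta\hat\psi|^{\frac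 p{p-1}}+|\partial_w\hat\psi|^{\frac p{p-2}}}{N}=0,\qquad \lim_{N\to\infty}\frac{|\partial_\theta\hat\psi|}{N}=0 .$$ *Strong solutions.* Let $\mu=\mu(F,\theta)>0$ and $k=k(F,\theta)>0$ be continuous for $\theta>0$. A strong solution of augmented thermoviscoelasticity on $\mathbb T^3\times[0,T]$ is a Lipschitz function $U=(\xi,v,\theta)$ of $(x,t)\in\mathbb T^3\times[0,T]$, with $\theta>0$, such that $$\begin{aligned} &\partial_t\xi^B-\partial_\alpha\Big(\frac{\partial\Phi^B}{\partial F_{i\alpha}}(F)v_i\Big)=0,\qquad \partial_\alpha F_{i\beta}=\partial_\beta F_{i\alpha},\\ &\partial_tv_i-\partial_\alpha\Sigma_{i\alpha}=\partial_\alpha(\mu\,\partial_\alpha v_i),\\ &\partial_t\big(\tfrac12|v|^2+\hat e\big)-\partial_\alpha(\Sigma_{i\alpha}v_i)=\partial_\alpha(\mu v_i\partial_\alpha v_i)+\partial_\alpha(k\,\partial_\alpha\theta),\\ &\partial_t\hat\eta-\partial_\alpha\Big(k\frac{\partial_\alpha\theta}{\theta}\Big)=k\frac{|\nabla\theta|^2}{\theta^2}+\mu\frac{|\nabla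 v|^2}{\theta}, \end{aligned}$$ where the first line holds almost everywhere and, in the other three, for almost every $t$, the divergences on $\mathbb T^3$ of the diffusive fluxes $\mu\nabla v$, $\mu v_i\nabla v_i+k\nabla\theta$ and $k\nabla\theta/\theta$ are weak derivatives. (Every classical solution that is $C^1$ on $\mathbb T^3\times[0,T]$, with these fluxes $C^1$ in $x$, is of this kind.) *Adiabatic solution.* Let $T>0$ and let $\bar U=(\bar\xi,\bar v,\bar\theta)$, $\bar\theta>0$, be a smooth ($C^1$ suffices) solution on $\mathbb T^3\times[0,T]$ of augmented adiabatic thermoelasticity, that is, of the system above with $\mu=k=0$. Assume that for some $M,\delta>0$ it takes its values in the compact set $$\Gamma_{M,\delta}=\{|\bar F|\le M,\ |\bar\zeta|\le M,\ |\bar w|\le M,\ |\bar v|\le M,\ \delta\le\bar\theta\le M\}.$$ *Relative entropy.* Writing $\hat\psi(\xi,\theta|\bar\xi,\bar\theta)=\hat\psi(\xi,\theta)-\hat\psi(\bar\xi,\bar\theta)-\frac{\partial\hat\psi}{\partial\xi^B}(\bar\xi,\bar\theta)(\xi^B-\bar\xi^B)+\hat\eta(\bar\xi,\bar\theta)(\theta-\bar\theta)$,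 set $$I(U|\bar U)=\hat\psi(\xi,\theta|\bar\xi,\bar\theta)+\tfrac12|v-\bar v|^2+\big(\hat\eta(\xi,\theta)-\hat\eta(\bar\xi,\bar\theta)\big)(\theta-\bar\theta).$$ **Theorem.** (i) There is a constant $C>0$, depending on $\hat\psi$, the exponents, $T$ and $\bar U$ (and $M,\delta$) but not on $\mu$, $k$ or $U$, such that for all coefficients $\mu,k$ as above, every strong solution $U=U_{\mu,k}$ on $\mathbb T^3\times[0,T]$ and every $t\in[0,T]$, $$\int_{\mathbb T^3} I(U(t)|\bar U(t))\,dx\le C\left(\int_{\mathbb T^3} I(U(0)|\bar U(0))\,dx+\int_0^T\!\!\int_{\mathbb T^3}\Big(\mu\,\theta\,\frac{|\nabla\bar v|^2}{\bar\theta}+k\,\frac{|\nabla\bar\theta|^2}{\bar\theta}\Big)dx\,ds\right),$$ where $\mu$ and $k$ are evaluated at $(F,\theta)$ along $U$. (ii) Let $a>0$ and let $\mu=\mu(F,\theta;\mu_0)$, $k=k(F,\theta;k_0)$, $\mu_0,k_0\in(0,a)$, be families of such coefficients with $$|\mu(F,\theta;\mu_0)\,\theta|\le C'\mu_0|\hat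 e(\xi,\theta)|,\qquad |k(F,\theta;k_0)|\le C'k_0|\hat e(\xi,\theta)|\qquad\text{for all }\xi=(F,\zeta,w)\text{ and }\theta>0,$$ with $C'$ independent of $\mu_0,k_0$, and for all $\mu_0,k_0\in(0,a)$ let $U_{\mu,k}$ be a strong solution on $\mathbb T^3\times[0,T]$ with these coefficients. If $\int_{\mathbb T^3} I(U_{\mu,k}(0)|\bar U(0))\,dx\to0$ as $(\mu_0,k_0)\to(0^+,0^+)$, then the following supremum is finite for all $\mu_0,k_0\in(0,a)$ and $$\sup_{t\in[0,T)}\int_{\mathbb T^3} I(U_{\mu,k}(t)|\bar U(t))\,dx\to0\qquad\text{as }(\mu_0,k_0)\to(0^+,0^+).$$ -/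

import Mathlib

open Set Filter Topology MeasureTheory

noncomputable section

namespace Thermo

/-- Points of space, vectors. The torus is `ℝ³ / ℤ³`: fields on it are `1`-periodic fields on `ℝ³`,
and integrals over it are integrals over the unit cube. -/
abbrev Vec3 := Fin 3 → ℝ

/-- `3 × 3` matrices. -/
abbrev Mat3 := Fin 3 → Fin 3 → ℝ

/-- Extended deformation variables `ξ = (F, ζ, w)`, a copy of `ℝ¹⁹`. -/
abbrev Xi := Mat3 × Mat3 × ℝ

/-- Euclidean length of a vector. -/
def vnorm (v : Vec3) : ℝ := Real.sqrt (∑ i, v i ^ 2)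

/-- Euclidean (Frobenius) length of a matrix. -/
def mnorm (A : Mat3) : ℝ := Real.sqrt (∑ i, ∑ a, A i a ^ 2)

/-- The elementary matrix with entry `1` at `(i, a)`. -/
def unitMat (i a : Fin 3) : Mat3 := Pi.single i (Pi.single a 1)

/-- The cofactor matrix of `F`, the transpose of the adjugate. -/
def cof (F : Mat3) : Mat3 := fun i a => (Matrix.adjugate (Matrix.of F)) a i

/-- The null Lagrangians `Φ(F) = (F, cof F, det F)`. -/
def Phi (F : Mat3) : Xi := (F, cof F, (Matrix.of F).det)

/-- `∂Φ/∂F_{ia}(F)`, a vector of `ℝ¹⁹`. -/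
def dPhi (F : Mat3) (i a : Fin 3) : Xi := fderiv ℝ Phi F (unitMat i a)

/-! ### Constitutive functions generated by the extended free energy `psi` -/

/-- `D_ξ ψ̂(ξ, θ)`, as a linear form on `ℝ¹⁹`. -/
def dxi (psi : Xi → ℝ → ℝ) (xi : Xi) (th : ℝ) : Xi →L[ℝ] ℝ :=
  fderiv ℝ (fun y => psi y th) xi

/-- The extended entropy `η̂ = -∂ψ̂/∂θ`. -/
def eta (psi : Xi → ℝ → ℝ) (xi : Xi) (th : ℝ) : ℝ := - deriv (psi xi) th

/-- The extended internal energy `ê = ψ̂ - θ ∂ψ̂/∂θ`. -/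
def ener (psi : Xi → ℝ → ℝ) (xi : Xi) (th : ℝ) : ℝ := psi xi th - th * deriv (psi xi) th

/-- The elastic stress `Σ_{ia} = ∑_B ∂ψ̂/∂ξ^B(ξ, θ) ∂Φ^B/∂F_{ia}(F)`. -/
def stress (psi : Xi → ℝ → ℝ) (xi : Xi) (th : ℝ) (i a : Fin 3) : ℝ :=
  dxi psi xi th (dPhi xi.1 i a)

/-- `|ξ|_{p,q,r} + θ^ℓ = |F|^p + |ζ|^q + |w|^r + θ^ℓ`. -/
def growthSize (p q r l : ℝ) (xi : Xi) (th : ℝ) : ℝ :=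
  mnorm xi.1 ^ p + mnorm xi.2.1 ^ q + |xi.2.2| ^ r + th ^ l

/-- `∂ψ̂/∂F`. -/
def dF (psi : Xi → ℝ → ℝ) (xi : Xi) (th : ℝ) : Mat3 :=
  fun i a => dxi psi xi th (unitMat i a, 0, 0)

/-- `∂ψ̂/∂ζ`. -/
def dZeta (psi : Xi → ℝ → ℝ) (xi : Xi) (th : ℝ) : Mat3 :=
  fun i a => dxi psi xi th (0, unitMat i a, 0)

/-- `∂ψ̂/∂w`. -/
def dW (psi : Xi → ℝ → ℝ) (xi : Xi) (th : ℝ) : ℝ := dxi psi xi th (0, 0, 1)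

/-- The filter `|ξ|_{p,q,r} + θ^ℓ → ∞` within `ℝ¹⁹ × (0, ∞)`. -/
def growthFilter (p q r l : ℝ) : Filter (Xi × ℝ) :=
  comap (fun z : Xi × ℝ => growthSize p q r l z.1 z.2) atTop ⊓ 𝓟 {z | 0 < z.2}

/-- The three growth conditions, on the internal energy, on `∂ψ̂/∂ξ` and on `∂ψ̂/∂θ`. -/
structure GrowthConditions (psi : Xi → ℝ → ℝ) (p q r l : ℝ) : Prop where
  energy : ∃ c C : ℝ, 0 < c ∧ 0 < C ∧ ∀ (xi : Xi) (th : ℝ), 0 < th →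
    c * growthSize p q r l xi th - C ≤ ener psi xi th ∧
      ener psi xi th ≤ C * growthSize p q r l xi th + C
  stress : Tendsto (fun z : Xi × ℝ =>
      (mnorm (dF psi z.1 z.2) + mnorm (dZeta psi z.1 z.2) ^ (p / (p - 1))
        + |dW psi z.1 z.2| ^ (p / (p - 2))) / growthSize p q r l z.1 z.2)
    (growthFilter p q r l) (𝓝 0)
  entropy : Tendsto (fun z : Xi × ℝ =>
      |deriv (psi z.1) z.2| / growthSize p q r l z.1 z.2) (growthFilter p q r l) (𝓝 0)

/-- Thermodynamic stability: `ψ̂_{ξξ}` is positive definite and `η̂_θ > 0`, for `θ > 0`. -/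
structure Stable (psi : Xi → ℝ → ℝ) : Prop where
  hess_pos : ∀ (xi : Xi) (th : ℝ), 0 < th → ∀ h : Xi, h ≠ 0 →
    0 < fderiv ℝ (fun y => dxi psi y th) xi h h
  eta_pos : ∀ (xi : Xi) (th : ℝ), 0 < th → 0 < deriv (eta psi xi) th

/-- A viscosity or heat conductivity coefficient: a continuous positive function of
`F` and `θ > 0`. -/
structure Coefficient (m : Mat3 → ℝ → ℝ) : Prop where
  cont : ContinuousOn (fun z : Mat3 × ℝ => m z.1 z.2) (univ ×ˢ Ioi 0)
  pos : ∀ (F : Mat3) (th : ℝ), 0 < th → 0 < m F th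

/-! ### Fields on the torus -/

/-- `1`-periodicity in each coordinate. -/
def Periodic3 {E : Type*} (f : Vec3 → E) : Prop :=
  ∀ (x : Vec3) (a : Fin 3), f (x + Pi.single a 1) = f x

/-- The unit cube, a period cell. -/
def cube : Set Vec3 := Icc 0 1

/-- The spatial partial derivative `∂_a f (x)`. -/
def pd {E : Type*} [NormedAddCommGroup E] [NormedSpace ℝ E] (a : Fin 3) (f : Vec3 → E)
    (x : Vec3) : E := fderiv ℝ f x (Pi.single a 1)

/-- `∑_a ∂_a q_a = g` on the torus in the sense of weak derivatives. -/
def IsWeakDiv (q : Vec3 → Fin 3 → ℝ) (g : Vec3 → ℝ) : Prop :=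
  ∀ phi : Vec3 → ℝ, ContDiff ℝ 1 phi → Periodic3 phi →
    ∫ x in cube, g x * phi x = - ∫ x in cube, ∑ a, q x a * pd a phi x

/-- A thermomechanical field `U = (ξ, v, θ)`, as a function of `t` and `x`. -/
structure ThermoField where
  xi : ℝ → Vec3 → Xi
  v : ℝ → Vec3 → Vec3
  th : ℝ → Vec3 → ℝ

namespace ThermoField

variable (U : ThermoField)

/-- The deformation gradient, the first component of `ξ`. -/
def F (t : ℝ) (x : Vec3) : Mat3 := (U.xi t x).1

/-- `|∇v|²`. -/
def gradVSq (t : ℝ) (x : Vec3) : ℝ := ∑ i, ∑ a, pd a (fun y => U.v t y i) x ^ 2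

/-- `|∇θ|²`. -/
def gradThSq (t : ℝ) (x : Vec3) : ℝ := ∑ a, pd a (U.th t) x ^ 2

/-- Spatial periodicity of all components, and positivity of the temperature, on `[0, T]`. -/
structure Admissible (T : ℝ) : Prop where
  xi_per : ∀ t ∈ Icc 0 T, Periodic3 (U.xi t)
  v_per : ∀ t ∈ Icc 0 T, Periodic3 (U.v t)
  th_per : ∀ t ∈ Icc 0 T, Periodic3 (U.th t)
  th_pos : ∀ t ∈ Icc 0 T, ∀ x, 0 < U.th t x

end ThermoField

/-- Total energy density `|v|²/2 + ê(ξ, θ)`. -/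
def totalEnergy (psi : Xi → ℝ → ℝ) (U : ThermoField) (t : ℝ) (x : Vec3) : ℝ :=
  (1 / 2) * vnorm (U.v t x) ^ 2 + ener psi (U.xi t x) (U.th t x)

/-- `∑_a ∂_a (∑_i ∂Φ/∂F_{ia}(F) v_i)`, with values in `ℝ¹⁹`. -/
def kinematicDiv (U : ThermoField) (t : ℝ) (x : Vec3) : Xi :=
  ∑ a, pd a (fun y => ∑ i, U.v t y i • dPhi (U.F t y) i a) x

/-- `∑_a ∂_a Σ_{ia}`. -/
def stressDiv (psi : Xi → ℝ → ℝ) (U : ThermoField) (t : ℝ) (x : Vec3) (i : Fin 3) : ℝ :=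
  ∑ a, pd a (fun y => stress psi (U.xi t y) (U.th t y) i a) x

/-- `∑_a ∂_a (∑_i Σ_{ia} v_i)`. -/
def powerDiv (psi : Xi → ℝ → ℝ) (U : ThermoField) (t : ℝ) (x : Vec3) : ℝ :=
  ∑ a, pd a (fun y => ∑ i, stress psi (U.xi t y) (U.th t y) i a * U.v t y i) x

/-- `F` is curl free at `(t, x)`: `∂_a F_{ib} = ∂_b F_{ia}`. -/
def CurlFree (U : ThermoField) (t : ℝ) (x : Vec3) : Prop :=
  ∀ i a b : Fin 3, pd a (fun y => U.F t y i b) x = pd b (fun y => U.F t y i a) x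

/-- Strong solutions on `𝕋³ × [0, T]` of augmented thermoviscoelasticity with Newtonian viscosity
`Z = μ ∇v`, Fourier heat flux `Q = k ∇θ`, and no radiative heat supply. They are Lipschitz
(`W^{1,∞}`) functions of `(t, x)`; the first-order equations hold almost everywhere, and the
divergences of the diffusive fluxes are taken in the sense of weak derivatives on the torus,
for almost every time. -/
structure IsStrongSolution (psi : Xi → ℝ → ℝ) (mu k : Mat3 → ℝ → ℝ) (T : ℝ) (U : ThermoField) :
    Prop where
  adm : U.Admissible T
  lip_xi : ∃ L, LipschitzOnWith L (fun z : ℝ × Vec3 => U.xi z.1 z.2) (Icc 0 T ×ˢ univ)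
  lip_v : ∃ L, LipschitzOnWith L (fun z : ℝ × Vec3 => U.v z.1 z.2) (Icc 0 T ×ˢ univ)
  lip_th : ∃ L, LipschitzOnWith L (fun z : ℝ × Vec3 => U.th z.1 z.2) (Icc 0 T ×ˢ univ)
  curl_free : ∀ᵐ t, t ∈ Ioo 0 T → ∀ᵐ x, CurlFree U t x
  kinematic : ∀ᵐ t, t ∈ Ioo 0 T → ∀ᵐ x,
    deriv (fun s => U.xi s x) t - kinematicDiv U t x = 0
  momentum : ∀ᵐ t, t ∈ Ioo 0 T → ∀ i,
    IsWeakDiv (fun x a => mu (U.F t x) (U.th t x) * pd a (fun y => U.v t y i) x)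
      (fun x => deriv (fun s => U.v s x i) t - stressDiv psi U t x i)
  energy : ∀ᵐ t, t ∈ Ioo 0 T →
    IsWeakDiv
      (fun x a => mu (U.F t x) (U.th t x) * ∑ i, U.v t x i * pd a (fun y => U.v t y i) x
        + k (U.F t x) (U.th t x) * pd a (U.th t) x)
      (fun x => deriv (fun s => totalEnergy psi U s x) t - powerDiv psi U t x)
  entropy : ∀ᵐ t, t ∈ Ioo 0 T →
    IsWeakDiv
      (fun x a => k (U.F t x) (U.th t x) * pd a (U.th t) x / U.th t x)
      (fun x => deriv (fun s => eta psi (U.xi s x) (U.th s x)) t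
        - k (U.F t x) (U.th t x) * U.gradThSq t x / U.th t x ^ 2
        - mu (U.F t x) (U.th t x) * U.gradVSq t x / U.th t x)

/-- Smooth (it is enough that they be continuously differentiable up to the boundary of the time
interval) solutions on `𝕋³ × [0, T]` of augmented adiabatic thermoelasticity without radiative
heat supply. -/
structure IsAdiabaticSolution (psi : Xi → ℝ → ℝ) (T : ℝ) (U : ThermoField) : Prop where
  adm : U.Admissible T
  smooth_xi : ContDiffOn ℝ 1 (fun z : ℝ × Vec3 => U.xi z.1 z.2) (Icc 0 T ×ˢ univ)
  smooth_v : ContDiffOn ℝ 1 (fun z : ℝ × Vec3 => U.v z.1 z.2) (Icc 0 T ×ˢ univ)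
  smooth_th : ContDiffOn ℝ 1 (fun z : ℝ × Vec3 => U.th z.1 z.2) (Icc 0 T ×ˢ univ)
  curl_free : ∀ t ∈ Ioo 0 T, ∀ x, CurlFree U t x
  kinematic : ∀ t ∈ Ioo 0 T, ∀ x, deriv (fun s => U.xi s x) t - kinematicDiv U t x = 0
  momentum : ∀ t ∈ Ioo 0 T, ∀ x, ∀ i,
    deriv (fun s => U.v s x i) t - stressDiv psi U t x i = 0
  energy : ∀ t ∈ Ioo 0 T, ∀ x,
    deriv (fun s => totalEnergy psi U s x) t - powerDiv psi U t x = 0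
  entropy : ∀ t ∈ Ioo 0 T, ∀ x, deriv (fun s => eta psi (U.xi s x) (U.th s x)) t = 0

/-- All values of the field on `𝕋³ × [0, T]` lie in the compact set `Γ_{M,δ}`. -/
def InGamma (M d T : ℝ) (U : ThermoField) : Prop :=
  ∀ t ∈ Icc 0 T, ∀ x,
    mnorm (U.xi t x).1 ≤ M ∧ mnorm (U.xi t x).2.1 ≤ M ∧ |(U.xi t x).2.2| ≤ M ∧
      vnorm (U.v t x) ≤ M ∧ d ≤ U.th t x ∧ U.th t x ≤ M

/-! ### The relative entropy -/

/-- `ψ̂(ξ, θ | ξ̄, θ̄)`. -/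
def psiRel (psi : Xi → ℝ → ℝ) (xi : Xi) (th : ℝ) (xib : Xi) (thb : ℝ) : ℝ :=
  psi xi th - psi xib thb - dxi psi xib thb (xi - xib) + eta psi xib thb * (th - thb)

/-- `I(ξ, v, θ | ξ̄, v̄, θ̄)`. -/
def relEntropy (psi : Xi → ℝ → ℝ) (xi : Xi) (v : Vec3) (th : ℝ) (xib : Xi) (vb : Vec3)
    (thb : ℝ) : ℝ :=
  psiRel psi xi th xib thb + (1 / 2) * vnorm (v - vb) ^ 2
    + (eta psi xi th - eta psi xib thb) * (th - thb)

/-- `∫ I(U(t) | Ū(t)) dx` over the torus. -/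
def totalRelEntropy (psi : Xi → ℝ → ℝ) (U Ub : ThermoField) (t : ℝ) : ℝ :=
  ∫ x in cube, relEntropy psi (U.xi t x) (U.v t x) (U.th t x) (Ub.xi t x) (Ub.v t x) (Ub.th t x)

/-- `∫₀ᵀ ∫ (μ θ |∇v̄|² / θ̄ + k |∇θ̄|² / θ̄) dx ds`, with `μ` and `k` evaluated along `U`. -/
def diffusionError (mu k : Mat3 → ℝ → ℝ) (T : ℝ) (U Ub : ThermoField) : ℝ :=
  ∫ s in (0 : ℝ)..T, ∫ x in cube,
    (mu (U.F s x) (U.th s x) * U.th s x * (Ub.gradVSq s x / Ub.th s x)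
      + k (U.F s x) (U.th s x) * (Ub.gradThSq s x / Ub.th s x))

end Thermo

end

open Thermo

set_option linter.unusedSectionVars false

namespace Thermo

/-! ### Lipschitz fields on the torus -/

/-! The relative entropy measures the distance between the two solutions and obeys a Grönwall
inequality. Two ways of writing it carry the proof. By `relEntropy_eq` it is the total energy minus
θ̄ η̂(ξ,θ) minus ψ̂_ξ(ξ̄,θ̄)·ξ minus v·v̄, plus terms in Ū alone: an affine combination of the
quantities that obey balance laws, with coefficients taken from the smooth solution. By `relI_split`
its thermoelastic part is the convexity gap of ψ̂(·,θ̄) between ξ and ξ̄ plus the concavity gap of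
ψ̂(ξ,·) between θ and θ̄. Hence it is nonnegative, and on compact sets of positive temperatures it
is bounded below by a multiple of the squared distance.

Testing the energy equation with 1, the entropy equation with θ̄ and the momentum equation with v̄
gives the time derivative of ∫I. In the nondiffusive part, the Piola identities (∂Φ/∂F is divergence
free when F is curl free) and the equations for Ū leave a spatial divergence plus terms quadratic in
U − Ū (`deriv_relEntropy_eq`). In the diffusive part, the entropy production enters with the factor
−θ̄; Young's inequality lets it absorb the products of ∇θ with ∇θ̄ and of ∇v with ∇v̄, and only the
diffusion error of the theorem survives (`diffusion_le`).

The analytic core is `exists_errorBounds`: the quadratic errors are at most C·I, although U ranges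
over an unbounded set and θ may approach 0. Where the growth size N is large, I ≥ cN and the growth
conditions bound the errors by N. Where N is bounded and θ is small, I stays above a positive
constant, and ψ̂_ξ stays bounded because ψ̂ is convex in ξ, concave in θ and has energy bounded
below; the entropy, possibly unbounded, is controlled by I itself. On the remaining compact set
Taylor's formula and the quadratic lower bound suffice.

Grönwall's inequality for Lipschitz functions then gives (i). For (ii), the diffusion error is at
most a constant times (μ₀+k₀)|ê|, and |ê| ≤ C(I+1), so for small amplitudes it is absorbed into the
maximum in time of ∫I (`le_of_le_integral_add`). -/

theorem Periodic3.add_int {E : Type*} {f : Vec3 → E} (hf : Periodic3 f) (n : Fin 3 → ℤ)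
    (x : Vec3) : f (x + fun i => (n i : ℝ)) = f x := by
  have h : ∀ (a : Fin 3) (k : ℤ) (y : Vec3), f (y + k • (Pi.single a 1 : Vec3)) = f y :=
    fun a k y => (show Function.Periodic f (Pi.single a 1) from fun y => hf y a).zsmul k y
  have e : (x + fun i => (n i : ℝ)) = x + n 0 • (Pi.single 0 1 : Vec3)
      + n 1 • (Pi.single 1 1 : Vec3) + n 2 • (Pi.single 2 1 : Vec3) := by
    funext i
    fin_cases i <;> simp
  rw [e, h, h, h]

theorem exists_int_shift (x : Vec3) : ∃ n : Fin 3 → ℤ, (x + fun i => (n i : ℝ)) ∈ cube := by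
  refine ⟨fun i => -⌊x i⌋, fun i => ?_, fun i => ?_⟩
  · simpa using Int.floor_le (x i)
  · have := (Int.lt_floor_add_one (x i)).le
    simp only [Pi.add_apply, Pi.one_apply]
    push_cast
    linarith

theorem isCompact_cube : IsCompact cube := isCompact_Icc

theorem measurableSet_cube : MeasurableSet cube := measurableSet_Icc

theorem volume_cube : volume cube = 1 := by
  simp [cube, Real.volume_Icc_pi]

instance : IsProbabilityMeasure (volume.restrict cube) := ⟨by simp [volume_cube]⟩

variable {E : Type*} [NormedAddCommGroup E] [NormedSpace ℝ E]
  {E' : Type*} [NormedAddCommGroup E'] [NormedSpace ℝ E']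

/-- Fields that are Lipschitz on `[0, T] × ℝ³` and periodic in space. -/
structure PerLip (T : ℝ) (f : ℝ → Vec3 → E) : Prop where
  per : ∀ t ∈ Icc 0 T, Periodic3 (f t)
  lip : ∃ L, LipschitzOnWith L (fun z : ℝ × Vec3 => f z.1 z.2) (Icc 0 T ×ˢ univ)

theorem image_slab_eq {T : ℝ} {f : ℝ → Vec3 → E} (hf : ∀ t ∈ Icc 0 T, Periodic3 (f t)) :
    (fun z : ℝ × Vec3 => f z.1 z.2) '' (Icc 0 T ×ˢ univ)
      = (fun z : ℝ × Vec3 => f z.1 z.2) '' (Icc 0 T ×ˢ cube) := by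
  apply Subset.antisymm
  · rintro _ ⟨⟨t, x⟩, ⟨ht, -⟩, rfl⟩
    obtain ⟨n, hn⟩ := exists_int_shift x
    exact ⟨(t, x + fun i => (n i : ℝ)), ⟨ht, hn⟩, (hf t ht).add_int n x⟩
  · exact image_mono (prod_mono_right (subset_univ _))

namespace PerLip

variable {T : ℝ} {f : ℝ → Vec3 → E} {g : ℝ → Vec3 → E'}

theorem continuousOn (hf : PerLip T f) :
    ContinuousOn (fun z : ℝ × Vec3 => f z.1 z.2) (Icc 0 T ×ˢ univ) :=
  hf.lip.choose_spec.continuousOn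

theorem isCompact_image (hf : PerLip T f) :
    IsCompact ((fun z : ℝ × Vec3 => f z.1 z.2) '' (Icc 0 T ×ˢ univ)) := by
  rw [image_slab_eq hf.per]
  exact (isCompact_Icc.prod isCompact_cube).image_of_continuousOn
    (hf.continuousOn.mono (prod_mono_right (subset_univ _)))

theorem prodMk (hf : PerLip T f) (hg : PerLip T g) : PerLip T (fun t x => (f t x, g t x)) where
  per t ht x a := by simp only [hf.per t ht x a, hg.per t ht x a]
  lip := ⟨_, hf.lip.choose_spec.prodMk hg.lip.choose_spec⟩

/-- By periodicity the values of the field form a compact subset of D. A map that is only C¹ on D,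
such as a constitutive function singular at θ = 0, is therefore Lipschitz on them. -/
theorem comp (hf : PerLip T f) {G : E → E'} {D : Set E} (hG : ContDiffOn ℝ 1 G D)
    (hD : Convex ℝ D) (hfD : ∀ t ∈ Icc 0 T, ∀ x, f t x ∈ D) :
    PerLip T (fun t x => G (f t x)) where
  per t ht x a := by simp only [hf.per t ht x a]
  lip := by
    have hsub : (fun z : ℝ × Vec3 => f z.1 z.2) '' (Icc 0 T ×ˢ univ) ⊆ D := by
      rintro _ ⟨⟨t, x⟩, ⟨ht, -⟩, rfl⟩
      exact hfD t ht x
    obtain ⟨K, hK⟩ := LocallyLipschitzOn.exists_lipschitzOnWith_of_compact hf.isCompact_image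
      ((hG.locallyLipschitzOn hD).mono hsub)
    exact ⟨_, hK.comp hf.lip.choose_spec (mapsTo_image _ _)⟩

theorem lip_space (hf : PerLip T f) :
    ∃ L : NNReal, ∀ t ∈ Icc 0 T, LipschitzWith L (f t) := by
  obtain ⟨L, hL⟩ := hf.lip
  refine ⟨L, fun t ht x y => ?_⟩
  simpa [Prod.edist_eq] using hL (x := (t, x)) ⟨ht, mem_univ _⟩ (y := (t, y)) ⟨ht, mem_univ _⟩

theorem lip_time (hf : PerLip T f) :
    ∃ L : NNReal, ∀ x, LipschitzOnWith L (fun s => f s x) (Icc 0 T) := by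
  obtain ⟨L, hL⟩ := hf.lip
  refine ⟨L, fun x s hs t ht => ?_⟩
  simpa [Prod.edist_eq] using hL (x := (s, x)) ⟨hs, mem_univ _⟩ (y := (t, x)) ⟨ht, mem_univ _⟩

/-- Rademacher's theorem, on time slices. -/
theorem ae_differentiableAt [FiniteDimensional ℝ E] (hf : PerLip T f) :
    ∀ᵐ t, t ∈ Ioo 0 T → ∀ᵐ x, DifferentiableAt ℝ (fun z : ℝ × Vec3 => f z.1 z.2) (t, x) := by
  obtain ⟨L, hL⟩ := hf.lip
  have h := hL.ae_differentiableWithinAt_of_mem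
    (μ := (volume : Measure ℝ).prod (volume : Measure Vec3))
  have h2 := Measure.ae_ae_of_ae_prod (μ := (volume : Measure ℝ)) (ν := (volume : Measure Vec3)) h
  filter_upwards [h2] with t ht hmem
  filter_upwards [ht] with x hx
  refine (hx ⟨Ioo_subset_Icc_self hmem, mem_univ _⟩).differentiableAt ?_
  exact prod_mem_nhds (Icc_mem_nhds hmem.1 hmem.2) univ_mem

theorem of_contDiffOn (hper : ∀ t ∈ Icc 0 T, Periodic3 (f t))
    (hf : ContDiffOn ℝ 1 (fun z : ℝ × Vec3 => f z.1 z.2) (Icc 0 T ×ˢ univ)) : PerLip T f where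
  per := hper
  lip := by
    have hconv : Convex ℝ (Icc 0 T ×ˢ (univ : Set Vec3)) := (convex_Icc _ _).prod convex_univ
    obtain ⟨L, hL⟩ := LocallyLipschitzOn.exists_lipschitzOnWith_of_compact
      ((isCompact_Icc (a := (0 : ℝ)) (b := T)).prod
        (isCompact_Icc (a := (-1 : Vec3)) (b := (2 : Vec3))))
      ((hf.locallyLipschitzOn hconv).mono (prod_mono_right (subset_univ _)))
    have hc : IsCompact ((fun z : ℝ × Vec3 => f z.1 z.2) '' (Icc 0 T ×ˢ univ)) := by
      rw [image_slab_eq hper]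
      exact (isCompact_Icc.prod isCompact_cube).image_of_continuousOn
        (hf.continuousOn.mono (prod_mono_right (subset_univ _)))
    obtain ⟨C, hC0, hC⟩ := hc.isBounded.exists_pos_norm_le
    refine ⟨L + (2 * C).toNNReal, LipschitzOnWith.of_dist_le_mul ?_⟩
    rintro ⟨t, x⟩ ⟨ht, -⟩ ⟨s, y⟩ ⟨hs, -⟩
    have hLn : (0 : ℝ) ≤ L := L.2
    have hd0 : 0 ≤ dist (t, x) (s, y) := dist_nonneg
    rw [NNReal.coe_add, Real.coe_toNNReal _ (by positivity)]
    -- Nearby points are moved by a common integer vector into the compact box [-1, 2]³, where a C¹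
    -- function is Lipschitz. For points at distance more than 1 the sup bound C suffices, which
    -- accounts for the summand 2C.
    rcases le_or_gt (dist (t, x) (s, y)) 1 with h | h
    · obtain ⟨n, hn⟩ := exists_int_shift x
      have hxy : dist x y ≤ 1 := (le_max_right _ _).trans h
      have h1 : (x + fun i => (n i : ℝ)) ∈ Icc (-1 : Vec3) 2 := by
        refine ⟨fun i => ?_, fun i => ?_⟩
        · have := hn.1 i
          simp only [Pi.zero_apply, Pi.neg_apply, Pi.one_apply] at *
          linarith
        · have := hn.2 i
          simp only [Pi.ofNat_apply] at *
          linarith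
      have h2 : (y + fun i => (n i : ℝ)) ∈ Icc (-1 : Vec3) 2 := by
        have hi : ∀ i, |x i - y i| ≤ 1 := fun i => by
          rw [← Real.dist_eq]; exact (dist_le_pi_dist x y i).trans hxy
        refine ⟨fun i => ?_, fun i => ?_⟩
        · have := hn.1 i
          have := abs_le.1 (hi i)
          simp only [Pi.zero_apply, Pi.neg_apply, Pi.one_apply, Pi.add_apply] at *
          linarith
        · have := hn.2 i
          have := abs_le.1 (hi i)
          simp only [Pi.ofNat_apply, Pi.add_apply] at *
          linarith
      have := hL.dist_le_mul (t, x + fun i => (n i : ℝ)) ⟨ht, h1⟩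
        (s, y + fun i => (n i : ℝ)) ⟨hs, h2⟩
      simp only [(hper t ht).add_int, (hper s hs).add_int, Prod.dist_eq, dist_add_right] at this
      simp only [Prod.dist_eq] at hd0 ⊢
      nlinarith
    · have h1 := hC _ ⟨(t, x), ⟨ht, mem_univ _⟩, rfl⟩
      have h2 := hC _ ⟨(s, y), ⟨hs, mem_univ _⟩, rfl⟩
      have h3 := dist_le_norm_add_norm (f t x) (f s y)
      simp only at h1 h2
      have h4 : 2 * C ≤ 2 * C * dist (t, x) (s, y) := by nlinarith
      have h5 : 0 ≤ L * dist (t, x) (s, y) := by positivity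
      linarith [add_mul (L : ℝ) (2 * C) (dist (t, x) (s, y))]

end PerLip

/-! ### Bounded measurable functions on the cube -/

/-- Essentially bounded, almost everywhere strongly measurable functions on the unit cube. -/
def BddMeas (g : Vec3 → E) : Prop :=
  AEStronglyMeasurable g (volume.restrict cube) ∧ ∃ C, ∀ᵐ x ∂volume.restrict cube, ‖g x‖ ≤ C

namespace BddMeas

variable {f g : Vec3 → E} {a b : Vec3 → ℝ}

theorem integrable (hg : BddMeas g) : IntegrableOn g cube :=
  Integrable.of_bound hg.1 _ hg.2.choose_spec

theorem of_continuous (hg : Continuous g) : BddMeas g := by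
  refine ⟨hg.aestronglyMeasurable, ?_⟩
  obtain ⟨C, hC⟩ := (isCompact_cube.image hg).isBounded.exists_norm_le
  exact ⟨C, (ae_restrict_iff' measurableSet_cube).2 (.of_forall fun x hx => hC _ ⟨x, hx, rfl⟩)⟩

theorem add (hf : BddMeas f) (hg : BddMeas g) : BddMeas (fun x => f x + g x) := by
  obtain ⟨hf, C, hC⟩ := hf
  obtain ⟨hg, C', hC'⟩ := hg
  refine ⟨hf.add hg, C + C', ?_⟩
  filter_upwards [hC, hC'] with x h1 h2
  exact (norm_add_le _ _).trans (add_le_add h1 h2)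

theorem neg (hf : BddMeas f) : BddMeas (fun x => - f x) := by
  obtain ⟨hf, C, hC⟩ := hf
  exact ⟨hf.neg, C, by simpa using hC⟩

theorem sub (hf : BddMeas f) (hg : BddMeas g) : BddMeas (fun x => f x - g x) := by
  simpa [sub_eq_add_neg] using hf.add hg.neg

theorem mul (ha : BddMeas a) (hb : BddMeas b) : BddMeas (fun x => a x * b x) := by
  obtain ⟨hf, C, hC⟩ := ha
  obtain ⟨hg, C', hC'⟩ := hb
  refine ⟨hf.mul hg, C * C', ?_⟩
  filter_upwards [hC, hC'] with x h1 h2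
  rw [norm_mul]
  exact mul_le_mul h1 h2 (norm_nonneg _) ((norm_nonneg _).trans h1)

theorem sum {ι : Type*} (s : Finset ι) {f : ι → Vec3 → E} (hf : ∀ i ∈ s, BddMeas (f i)) :
    BddMeas (fun x => ∑ i ∈ s, f i x) := by
  classical
  induction s using Finset.induction_on with
  | empty => simpa using of_continuous (continuous_const (y := (0 : E)))
  | insert i s hi ih =>
    simp only [Finset.sum_insert hi]
    exact (hf i (by simp)).add (ih fun j hj => hf j (by simp [hj]))

theorem pow (ha : BddMeas a) (n : ℕ) : BddMeas (fun x => a x ^ n) := by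
  induction n with
  | zero => simpa using of_continuous (continuous_const (y := (1 : ℝ)))
  | succ n ih => simpa only [pow_succ] using ih.mul ha

end BddMeas

/-! ### Spatial derivatives and translation invariance on the torus. -/

theorem pd_norm_le {f : Vec3 → E} {L : NNReal} (hf : LipschitzWith L f) (a : Fin 3) (x : Vec3) :
    ‖pd a f x‖ ≤ L := by
  refine ((fderiv ℝ f x).le_opNorm _).trans ?_
  have h1 : ‖(Pi.single a 1 : Vec3)‖ = 1 := by rw [Pi.norm_single, norm_one]
  rw [h1, mul_one]
  exact norm_fderiv_le_of_lipschitz ℝ hf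

theorem BddMeas.pd [FiniteDimensional ℝ E] {f : Vec3 → E} {L : NNReal} (hf : LipschitzWith L f)
    (a : Fin 3) : BddMeas (pd a f) := by
  let : MeasurableSpace E := borel E
  have : BorelSpace E := ⟨rfl⟩
  exact ⟨(measurable_fderiv_apply_const ℝ f _).aestronglyMeasurable, L,
    .of_forall (pd_norm_le hf a)⟩

open scoped Pointwise in
-- Up to a null set the cube is a fundamental domain of the lattice ℤ³, and so is each of its
-- translates; an invariant function has the same integral over both.
theorem setIntegral_cube_add {f : Vec3 → ℝ} (hf : Periodic3 f) (y : Vec3) :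
    ∫ x in cube, f (x + y) = ∫ x in cube, f x := by
  let b := Pi.basisFun ℝ (Fin 3)
  let Q : Set Vec3 := ZSpan.fundamentalDomain b
  have hQ : Q =ᵐ[volume] cube := by
    have : Q = Set.pi univ fun _ => Ico 0 1 := by
      ext x; simp [Q, b, ZSpan.mem_fundamentalDomain]
    rw [this]
    exact Measure.univ_pi_Ico_ae_eq_Icc
  have hfd : IsAddFundamentalDomain (Submodule.span ℤ (Set.range b)).toAddSubgroup Q volume :=
    ZSpan.isAddFundamentalDomain' b volume
  have hinv : ∀ (g : (Submodule.span ℤ (Set.range b)).toAddSubgroup) (x : Vec3),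
      f (g +ᵥ x) = f x := by
    rintro ⟨g, hg⟩ x
    rw [Submodule.mem_toAddSubgroup, b.mem_span_iff_repr_mem ℤ] at hg
    choose n hn using hg
    have : g = fun i => (n i : ℝ) := by
      funext i
      simpa [b] using (hn i).symm
    rw [AddSubgroup.vadd_def, vadd_eq_add, add_comm]
    simp only [this, hf.add_int]
  have : Countable (Submodule.span ℤ (Set.range b)).toAddSubgroup :=
    inferInstanceAs (Countable (Submodule.span ℤ (Set.range b)))
  have h2 : ∫ x in (y +ᵥ Q), f x = ∫ x in Q, f x :=
    (hfd.vadd_of_comm y).setIntegral_eq hfd hinv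
  rw [setIntegral_congr_set hQ.symm, setIntegral_congr_set hQ.symm, ← h2]
  have h3 : (y +ᵥ Q) = (fun x => x + y) '' Q := by
    ext x; simp only [Set.mem_vadd_set, vadd_eq_add, mem_image, add_comm y]
  rw [h3, (measurePreserving_add_right volume y).setIntegral_image_emb
    (measurableEmbedding_addRight y)]

/-- The integral of f(x + h e_a) over a period does not depend on h. Rademacher's theorem and
domination by the Lipschitz constant allow differentiation under the integral at h = 0. -/
theorem integral_pd_eq_zero {f : Vec3 → ℝ} (hper : Periodic3 f) {L : NNReal}
    (hf : LipschitzWith L f) (a : Fin 3) : ∫ x in cube, pd a f x = 0 := by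
  have hae := ae_restrict_of_ae (s := cube) (hf.ae_differentiableAt (μ := volume))
  have key := hasDerivAt_integral_of_dominated_loc_of_lip (μ := volume.restrict cube)
    (x₀ := (0 : ℝ))
    (F := fun h x => f (x + h • (Pi.single a 1 : Vec3))) (F' := fun x => pd a f x)
    (bound := fun _ => L) (s := univ) univ_mem
    (.of_forall fun h => (hf.continuous.comp (by fun_prop)).aestronglyMeasurable)
    (BddMeas.of_continuous (hf.continuous.comp (by fun_prop))).integrable
    (BddMeas.pd hf a).1 (.of_forall fun x => ?_) (integrable_const _) ?_
  · have h0 : (fun h : ℝ => ∫ x in cube, f (x + h • (Pi.single a 1 : Vec3)))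
        = fun _ => ∫ x in cube, f x := by
      funext h
      exact setIntegral_cube_add hper _
    have h1 := key.2
    rw [h0] at h1
    exact h1.unique (hasDerivAt_const _ _)
  · rw [lipschitzOnWith_univ]
    refine LipschitzWith.of_dist_le_mul fun s t => ?_
    refine (hf.dist_le_mul _ _).trans ?_
    simp [dist_eq_norm, ← sub_smul, norm_smul, Pi.norm_single]
  · filter_upwards [hae] with x hx
    have h1 : HasDerivAt (fun h : ℝ => x + h • (Pi.single a 1 : Vec3)) (Pi.single a 1) 0 := by
      simpa using ((hasDerivAt_id (0 : ℝ)).smul_const (Pi.single a 1 : Vec3)).const_add x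
    have h2 : HasFDerivAt f (fderiv ℝ f x) (x + (0 : ℝ) • (Pi.single a 1 : Vec3)) := by
      simpa using hx.hasFDerivAt
    exact h2.comp_hasDerivAt 0 h1

/-! ### Differentiation in time of integrals over the torus. -/

namespace PerLip

variable {T : ℝ} {f : ℝ → Vec3 → ℝ}

theorem continuous_slice {f : ℝ → Vec3 → E} (hf : PerLip T f) {t : ℝ} (ht : t ∈ Icc 0 T) :
    Continuous (f t) := by
  obtain ⟨L, hL⟩ := hf.lip_space
  exact (hL t ht).continuous

theorem bddMeas {f : ℝ → Vec3 → E} (hf : PerLip T f) {t : ℝ} (ht : t ∈ Icc 0 T) :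
    BddMeas (f t) := .of_continuous (hf.continuous_slice ht)

theorem bddMeas_pd [FiniteDimensional ℝ E] {f : ℝ → Vec3 → E} (hf : PerLip T f) {t : ℝ}
    (ht : t ∈ Icc 0 T) (a : Fin 3) : BddMeas (pd a (f t)) :=
  .pd (hf.lip_space.choose_spec t ht) a

theorem integral_pd (hf : PerLip T f) {t : ℝ} (ht : t ∈ Icc 0 T) (a : Fin 3) :
    ∫ x in cube, pd a (f t) x = 0 :=
  integral_pd_eq_zero (hf.per t ht) (hf.lip_space.choose_spec t ht) a

theorem norm_deriv_le {f : ℝ → Vec3 → E} {L : NNReal}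
    (hL : ∀ x, LipschitzOnWith L (fun s => f s x) (Icc 0 T)) {t : ℝ} (ht : t ∈ Ioo 0 T) (x : Vec3) :
    ‖deriv (fun s => f s x) t‖ ≤ L :=
  norm_deriv_le_of_lipschitzOn (Icc_mem_nhds ht.1 ht.2) (hL x)

theorem bddMeas_deriv {f : ℝ → Vec3 → E} (hf : PerLip T f) {t : ℝ} (ht : t ∈ Ioo 0 T)
    (hd : ∀ᵐ x, DifferentiableAt ℝ (fun s => f s x) t) :
    BddMeas (fun x => deriv (fun s => f s x) t) := by
  obtain ⟨L, hL⟩ := hf.lip_time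
  refine ⟨?_, L, .of_forall (norm_deriv_le hL ht)⟩
  -- Measurability in x of the time derivative comes from difference quotients along a sequence.
  -- These steps keep t + u n inside [0, T], where the slices are continuous.
  set u : ℕ → ℝ := fun n => (T - t) / (n + 1)
  have hu0 : Tendsto u atTop (𝓝 0) := by
    simpa [u, div_eq_mul_inv] using
      (tendsto_one_div_add_atTop_nhds_zero_nat (𝕜 := ℝ)).const_mul (T - t)
  have hTt : 0 < T - t := sub_pos.2 ht.2
  have hupos : ∀ n, 0 < u n := fun n => by positivity
  have hule : ∀ n, u n ≤ T - t := fun n => div_le_self hTt.le (by linarith [n.cast_nonneg (α := ℝ)])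
  refine aestronglyMeasurable_of_tendsto_ae (u := atTop)
    (f := fun (n : ℕ) x => (u n)⁻¹ • (f (t + u n) x - f t x)) (fun n => ?_) ?_
  · have h1 := hf.continuous_slice (t := t + u n)
      ⟨by linarith [hupos n, ht.1], by linarith [hule n]⟩
    have h2 := hf.continuous_slice (Ioo_subset_Icc_self ht)
    exact ((h1.sub h2).const_smul _).aestronglyMeasurable
  · filter_upwards [ae_restrict_of_ae hd] with x hx
    have := hx.hasDerivAt.tendsto_slope_zero
    exact this.comp (tendsto_nhdsWithin_iff.2 ⟨hu0, .of_forall fun n => (hupos n).ne'⟩)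

theorem hasDerivAt_integral (hf : PerLip T f) {t : ℝ} (ht : t ∈ Ioo 0 T)
    (hd : ∀ᵐ x, DifferentiableAt ℝ (fun s => f s x) t) :
    HasDerivAt (fun s => ∫ x in cube, f s x) (∫ x in cube, deriv (fun s => f s x) t) t := by
  obtain ⟨L, hL⟩ := hf.lip_time
  have hnhds : Icc 0 T ∈ 𝓝 t := Icc_mem_nhds ht.1 ht.2
  refine (hasDerivAt_integral_of_dominated_loc_of_lip (μ := volume.restrict cube)
    (bound := fun _ => L) hnhds ?_ (hf.bddMeas (Ioo_subset_Icc_self ht)).integrable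
    (hf.bddMeas_deriv ht hd).1 ?_ (integrable_const _) ?_).2
  · filter_upwards [hnhds] with s hs
    exact (hf.continuous_slice hs).aestronglyMeasurable
  · refine .of_forall fun x => ?_
    simpa using hL x
  · filter_upwards [ae_restrict_of_ae hd] with x hx
    exact hx.hasDerivAt

theorem lipschitzOn_integral (hf : PerLip T f) :
    ∃ L, LipschitzOnWith L (fun s => ∫ x in cube, f s x) (Icc 0 T) := by
  obtain ⟨L, hL⟩ := hf.lip_time
  refine ⟨L, LipschitzOnWith.of_dist_le_mul fun s hs t ht => ?_⟩
  rw [dist_eq_norm, ← integral_sub (hf.bddMeas hs).integrable (hf.bddMeas ht).integrable]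
  have := norm_integral_le_of_norm_le_const (μ := volume.restrict cube)
    (f := fun x => f s x - f t x) (C := L * dist s t)
    (.of_forall fun x => by rw [← dist_eq_norm]; exact (hL x).dist_le_mul s hs t ht)
  simpa using this

end PerLip

/-- Grönwall's inequality for Lipschitz functions satisfying the differential inequality almost
everywhere. -/
theorem gronwall_of_lipschitzOn {T K : ℝ} (hK : 0 ≤ K) {φ D : ℝ → ℝ} {L : NNReal}
    (hφ : LipschitzOnWith L φ (Icc 0 T)) (hD : IntervalIntegrable D volume 0 T)
    (hD0 : ∀ t ∈ Icc 0 T, 0 ≤ D t)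
    (h : ∀ᵐ t, t ∈ Ioo 0 T → ∃ φ', HasDerivAt φ φ' t ∧ φ' ≤ K * φ t + D t)
    {t : ℝ} (ht : t ∈ Icc 0 T) (hφ0 : 0 ≤ φ 0) :
    φ t ≤ Real.exp (K * T) * (φ 0 + ∫ s in (0 : ℝ)..T, D s) := by
  have hTnn : 0 ≤ T := ht.1.trans ht.2
  have hexp : ContDiff ℝ 1 (fun s : ℝ => Real.exp (-K * s)) := by fun_prop
  have hsub : Icc 0 t ⊆ Icc 0 T := Icc_subset_Icc_right ht.2
  have hac1 := (hφ.mono hsub)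
  rw [← uIcc_of_le ht.1] at hac1
  have hac1 := hac1.absolutelyContinuousOnInterval
  obtain ⟨L2, hL2⟩ := hexp.contDiffOn.exists_lipschitzOnWith (s := uIcc 0 t) one_ne_zero
    (convex_uIcc _ _) isCompact_uIcc
  have hac2 := hL2.absolutelyContinuousOnInterval
  -- Both factors are Lipschitz, hence absolutely continuous, so the fundamental theorem of calculus
  -- holds for exp(-Kt) φ(t) although φ is differentiable only almost everywhere.
  have hint := AbsolutelyContinuousOnInterval.integral_deriv_mul_eq_sub hac2 hac1
  have hDt : IntervalIntegrable D volume 0 t := hD.mono_set (by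
    rw [uIcc_of_le ht.1, uIcc_of_le hTnn]; exact hsub)
  have hmono : (∫ x in (0 : ℝ)..t, deriv (fun s : ℝ => Real.exp (-K * s)) x * φ x
      + Real.exp (-K * x) * deriv φ x) ≤ ∫ s in (0 : ℝ)..t, D s := by
    apply intervalIntegral.integral_mono_ae_restrict ht.1 _ hDt
    · have h1 : ∀ᵐ x, x ≠ t := by simp [ae_iff, measure_singleton]
      have h2 : ∀ᵐ x : ℝ, x ≠ 0 := by simp [ae_iff, measure_singleton]
      rw [EventuallyLE, ae_restrict_iff' measurableSet_Icc]
      filter_upwards [h, h1, h2] with x hx hxt hx0 hxm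
      have hx' : x ∈ Ioo 0 T :=
        ⟨lt_of_le_of_ne hxm.1 (Ne.symm hx0), (lt_of_le_of_ne hxm.2 hxt).trans_le ht.2⟩
      obtain ⟨φ', hd, hle⟩ := hx hx'
      have hde : deriv (fun s : ℝ => Real.exp (-K * s)) x = Real.exp (-K * x) * (-K) := by
        have := ((hasDerivAt_id x).const_mul (-K)).exp
        simpa using this.deriv
      rw [hd.deriv, hde]
      have he : Real.exp (-K * x) ≤ 1 := Real.exp_le_one_iff.2 (by nlinarith [hx'.1])
      have he0 := (Real.exp_pos (-K * x)).le
      have hDx := hD0 x (Ioo_subset_Icc_self hx')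
      nlinarith [mul_le_mul_of_nonneg_left hle he0, mul_le_mul_of_nonneg_right he hDx]
    · have hi1 : IntervalIntegrable (fun x => deriv (fun s : ℝ => Real.exp (-K * s)) x * φ x)
          volume 0 t := hac2.intervalIntegrable_deriv.mul_continuousOn hac1.continuousOn
      have hi2 : IntervalIntegrable (fun x => Real.exp (-K * x) * deriv φ x) volume 0 t :=
        hac1.intervalIntegrable_deriv.continuousOn_mul hac2.continuousOn
      exact hi1.add hi2
  have hle : ∫ s in (0 : ℝ)..t, D s ≤ ∫ s in (0 : ℝ)..T, D s := by
    apply intervalIntegral.integral_mono_interval le_rfl ht.1 ht.2 _ hD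
    rw [EventuallyLE, ae_restrict_iff' measurableSet_Ioc]
    exact .of_forall fun x hx => hD0 x (Ioc_subset_Icc_self hx)
  have hI0 : 0 ≤ ∫ s in (0 : ℝ)..T, D s := intervalIntegral.integral_nonneg hTnn hD0
  have hkey : Real.exp (-K * t) * φ t ≤ φ 0 + ∫ s in (0 : ℝ)..T, D s := by
    have : Real.exp (-K * t) * φ t - Real.exp (-K * 0) * φ 0 ≤ _ := hint ▸ hmono
    simp only [mul_zero, Real.exp_zero, one_mul] at this
    linarith
  calc φ t = Real.exp (K * t) * (Real.exp (-K * t) * φ t) := by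
        rw [← mul_assoc, ← Real.exp_add]; simp
    _ ≤ Real.exp (K * t) * (φ 0 + ∫ s in (0 : ℝ)..T, D s) := by gcongr
    _ ≤ _ := by
        apply mul_le_mul_of_nonneg_right _ (by linarith)
        exact Real.exp_le_exp.2 (mul_le_mul_of_nonneg_left ht.2 hK)

end Thermo

namespace Thermo

/-! ### Null Lagrangians -/

/-- The polarization of the cofactor map, `cofBil F H = D cof (F) H`. -/
def cofBil (F H : Mat3) : Mat3 := fun i a =>
  F (i + 1) (a + 1) * H (i + 2) (a + 2) + H (i + 1) (a + 1) * F (i + 2) (a + 2)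
    - F (i + 1) (a + 2) * H (i + 2) (a + 1) - H (i + 1) (a + 2) * F (i + 2) (a + 1)

/-- Indices are added in `Fin 3`, that is, cyclically. This ordering of the minors builds in the
checkerboard signs and gives all nine cofactors one formula. -/
theorem cof_apply (F : Mat3) (i a : Fin 3) :
    cof F i a = F (i + 1) (a + 1) * F (i + 2) (a + 2) - F (i + 1) (a + 2) * F (i + 2) (a + 1) := by
  unfold cof
  rw [Matrix.adjugate_fin_three]
  fin_cases i <;> fin_cases a <;> simp <;> ring

theorem cof_add_smul (F H : Mat3) (s : ℝ) :
    cof (F + s • H) = cof F + s • cofBil F H + s ^ 2 • cof H := by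
  funext i a
  simp only [Pi.add_apply, Pi.smul_apply, smul_eq_mul, cof_apply, cofBil]
  ring

theorem det_add_smul_unitMat (F : Mat3) (i a : Fin 3) (s : ℝ) :
    (Matrix.of (F + s • unitMat i a)).det = (Matrix.of F).det + s * cof F i a := by
  rw [Matrix.det_fin_three, Matrix.det_fin_three, cof_apply]
  fin_cases i <;> fin_cases a <;> simp [unitMat] <;> ring

theorem contDiff_entry {n : WithTop ℕ∞} (i a : Fin 3) : ContDiff ℝ n (fun F : Mat3 => F i a) :=
  contDiff_apply_apply ℝ ℝ i a

theorem contDiff_cof {n : WithTop ℕ∞} : ContDiff ℝ n cof := by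
  refine contDiff_pi.2 fun i => contDiff_pi.2 fun a => ?_
  simp only [cof_apply]
  exact ((contDiff_entry _ _).mul (contDiff_entry _ _)).sub
    ((contDiff_entry _ _).mul (contDiff_entry _ _))

theorem contDiff_Phi {n : WithTop ℕ∞} : ContDiff ℝ n Phi := by
  refine contDiff_id.prodMk (contDiff_cof.prodMk ?_)
  simp only [Matrix.det_fin_three, Matrix.of_apply]
  have h := fun i a => contDiff_entry (n := n) i a
  exact (((((((h _ _).mul (h _ _)).mul (h _ _)).sub (((h _ _).mul (h _ _)).mul (h _ _))).sub
    (((h _ _).mul (h _ _)).mul (h _ _))).add (((h _ _).mul (h _ _)).mul (h _ _))).add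
    (((h _ _).mul (h _ _)).mul (h _ _))).sub (((h _ _).mul (h _ _)).mul (h _ _))

theorem contDiff_dPhi {n : WithTop ℕ∞} (i a : Fin 3) : ContDiff ℝ n (fun F => dPhi F i a) := by
  have h : ContDiff ℝ n (fderiv ℝ Phi) :=
    (contDiff_Phi (n := n + 1)).fderiv_right le_rfl
  exact h.clm_apply contDiff_const

/-- Reads a directional derivative off an exact quadratic expansion along a line. It suffices for
`Phi` and its derivatives, since along `unitMat i a` the cofactor is quadratic and the determinant
affine. -/
theorem fderiv_apply_of_quadratic {E E' : Type*} [NormedAddCommGroup E] [NormedSpace ℝ E]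
    [NormedAddCommGroup E'] [NormedSpace ℝ E'] {G : E → E'} {F H : E} {A C : E'}
    (hG : DifferentiableAt ℝ G F)
    (h : ∀ s : ℝ, G (F + s • H) = G F + s • A + s ^ 2 • C) : fderiv ℝ G F H = A := by
  rw [← hG.lineDeriv_eq_fderiv]
  refine HasLineDerivAt.lineDeriv ?_
  unfold HasLineDerivAt
  simp only [h]
  have h1 : HasDerivAt (fun s : ℝ => s • A) A 0 := by
    simpa using (hasDerivAt_id (0 : ℝ)).smul_const A
  have h2 : HasDerivAt (fun s : ℝ => s ^ 2 • C) 0 0 := by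
    simpa using (hasDerivAt_pow 2 (0 : ℝ)).smul_const C
  simpa only [add_zero] using! (h1.const_add (G F)).add h2

theorem dPhi_eq (F : Mat3) (i a : Fin 3) :
    dPhi F i a = (unitMat i a, cofBil F (unitMat i a), cof F i a) := by
  refine fderiv_apply_of_quadratic (C := (0, cof (unitMat i a), 0))
    ((contDiff_Phi (n := 1)).differentiable one_ne_zero F) fun s => ?_
  simp only [Phi, cof_add_smul, det_add_smul_unitMat, Prod.smul_mk, Prod.mk_add_mk, smul_zero,
    add_zero, smul_eq_mul, mul_zero]

theorem fderiv_dPhi (F H : Mat3) (i a : Fin 3) :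
    fderiv ℝ (fun F => dPhi F i a) F H = (0, cofBil H (unitMat i a), cofBil F H i a) := by
  refine fderiv_apply_of_quadratic (C := (0, 0, cof H i a))
    ((contDiff_dPhi (n := 1) i a).differentiable one_ne_zero F) fun s => ?_
  simp only [dPhi_eq, cof_add_smul]
  ext1
  · simp
  ext1
  · funext j b
    simp [cofBil]
    ring
  · simp

/-- The Piola identities, in algebraic form. -/
theorem sum_fderiv_dPhi_eq_zero (F : Mat3) (D : Fin 3 → Mat3) (hD : ∀ j a b, D a j b = D b j a)
    (i : Fin 3) : ∑ a, fderiv ℝ (fun F => dPhi F i a) F (D a) = 0 := by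
  simp only [fderiv_dPhi, Fin.sum_univ_three]
  have h01 := fun j => hD j 0 1
  have h02 := fun j => hD j 0 2
  have h12 := fun j => hD j 1 2
  ext1
  · simp
  ext1
  · funext j b
    fin_cases i <;> fin_cases j <;> fin_cases b <;> simp [cofBil, unitMat, h01, h02, h12]
  · fin_cases i <;> simp [cofBil, h01, h02, h12] <;> ring

end Thermo

noncomputable section

namespace Thermo

/-! ### Calculus of the free energy -/

/-- The domain `ℝ¹⁹ × (0, ∞)` of the free energy. -/
def dom : Set (Xi × ℝ) := univ ×ˢ Ioi 0

theorem isOpen_dom : IsOpen dom := isOpen_univ.prod isOpen_Ioi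

theorem convex_dom : Convex ℝ dom := convex_univ.prod (convex_Ioi 0)

theorem mem_dom {xi : Xi} {th : ℝ} (h : 0 < th) : (xi, th) ∈ dom := ⟨mem_univ _, h⟩

/-- The total derivative of the free energy with respect to `(ξ, θ)`. -/
def dpsi (psi : Xi → ℝ → ℝ) : Xi × ℝ → (Xi × ℝ →L[ℝ] ℝ) :=
  fderiv ℝ (fun z : Xi × ℝ => psi z.1 z.2)

/-- The free energy is of class `C³`. -/
abbrev SmoothEnergy (psi : Xi → ℝ → ℝ) : Prop :=
  ContDiffOn ℝ 3 (fun z : Xi × ℝ => psi z.1 z.2) dom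

/-- The part of the relative entropy that does not contain the velocity. -/
def relI (psi : Xi → ℝ → ℝ) (xi : Xi) (th : ℝ) (xib : Xi) (thb : ℝ) : ℝ :=
  psiRel psi xi th xib thb + (eta psi xi th - eta psi xib thb) * (th - thb)

theorem hasFDerivAt_psi {psi : Xi → ℝ → ℝ} (hpsi : SmoothEnergy psi)
    {xi : Xi} {th : ℝ} (hth : 0 < th) :
    HasFDerivAt (fun z : Xi × ℝ => psi z.1 z.2) (dpsi psi (xi, th)) (xi, th) :=
  ((hpsi.contDiffAt (isOpen_dom.mem_nhds (mem_dom hth))).differentiableAt (by norm_num)).hasFDerivAt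

theorem contDiffOn_dpsi {psi : Xi → ℝ → ℝ} (hpsi : SmoothEnergy psi) :
    ContDiffOn ℝ 2 (dpsi psi) dom :=
  hpsi.fderiv_of_isOpen isOpen_dom (by norm_num)

theorem hasFDerivAt_dpsi {psi : Xi → ℝ → ℝ} (hpsi : SmoothEnergy psi)
    {xi : Xi} {th : ℝ} (hth : 0 < th) :
    HasFDerivAt (dpsi psi) (fderiv ℝ (dpsi psi) (xi, th)) (xi, th) :=
  (((contDiffOn_dpsi hpsi).contDiffAt (isOpen_dom.mem_nhds (mem_dom hth))).differentiableAt
    (by norm_num)).hasFDerivAt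

theorem dxi_eq {psi : Xi → ℝ → ℝ} (hpsi : SmoothEnergy psi)
    {xi : Xi} {th : ℝ} (hth : 0 < th) :
    dxi psi xi th = (dpsi psi (xi, th)).comp (ContinuousLinearMap.inl ℝ Xi ℝ) := by
  have h : HasFDerivAt (fun y : Xi => (y, th)) (ContinuousLinearMap.inl ℝ Xi ℝ) xi :=
    hasFDerivAt_prodMk_left xi th
  exact ((hasFDerivAt_psi hpsi hth).comp xi h).fderiv

theorem dxi_apply {psi : Xi → ℝ → ℝ} (hpsi : SmoothEnergy psi)
    {xi : Xi} {th : ℝ} (hth : 0 < th) (h : Xi) :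
    dxi psi xi th h = dpsi psi (xi, th) (h, 0) := by
  rw [dxi_eq hpsi hth]; rfl

theorem eta_eq {psi : Xi → ℝ → ℝ} (hpsi : SmoothEnergy psi)
    {xi : Xi} {th : ℝ} (hth : 0 < th) :
    eta psi xi th = - dpsi psi (xi, th) (0, 1) := by
  have h : HasDerivAt (fun s : ℝ => (xi, s)) ((0 : Xi), (1 : ℝ)) th :=
    (hasDerivAt_const th xi).prodMk (hasDerivAt_id th)
  exact congrArg Neg.neg ((hasFDerivAt_psi hpsi hth).comp_hasDerivAt th h).deriv

theorem dpsi_apply {psi : Xi → ℝ → ℝ} (hpsi : SmoothEnergy psi)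
    {xi : Xi} {th : ℝ} (hth : 0 < th) (h : Xi) (s : ℝ) :
    dpsi psi (xi, th) (h, s) = dxi psi xi th h - s * eta psi xi th := by
  rw [dxi_apply hpsi hth, eta_eq hpsi hth]
  have : ((h, s) : Xi × ℝ) = (h, 0) + s • (0, 1) := by simp
  rw [this, map_add, map_smul, smul_eq_mul]
  ring

theorem ener_eq (psi : Xi → ℝ → ℝ) (xi : Xi) (th : ℝ) :
    ener psi xi th = psi xi th + th * eta psi xi th := by
  simp [ener, eta, sub_eq_add_neg]

theorem relI_eq (psi : Xi → ℝ → ℝ) (xi : Xi) (th : ℝ) (xib : Xi) (thb : ℝ) :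
    relI psi xi th xib thb
      = psi xi th - psi xib thb - dxi psi xib thb (xi - xib) + eta psi xi th * (th - thb) := by
  unfold relI psiRel; ring

/-- In this form the state (ξ, θ) enters only through ê, η̂ and ξ. It serves to integrate the
balance laws, to read coercivity off the energy growth, and to recover η̂ from the relative entropy.
-/
theorem relI_eq' (psi : Xi → ℝ → ℝ) (xi : Xi) (th : ℝ) (xib : Xi) (thb : ℝ) :
    relI psi xi th xib thb
      = ener psi xi th - thb * eta psi xi th - psi xib thb - dxi psi xib thb (xi - xib) := by
  rw [relI_eq, ener_eq]; ring

theorem contDiffOn_eta {psi : Xi → ℝ → ℝ} (hpsi : SmoothEnergy psi) :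
    ContDiffOn ℝ 2 (fun z : Xi × ℝ => eta psi z.1 z.2) dom := by
  have h : ContDiffOn ℝ 2 (fun z : Xi × ℝ => - dpsi psi z (0, 1)) dom :=
    ((contDiffOn_dpsi hpsi).clm_apply contDiffOn_const).neg
  exact h.congr fun z hz => eta_eq hpsi hz.2

theorem contDiffOn_ener {psi : Xi → ℝ → ℝ} (hpsi : SmoothEnergy psi) :
    ContDiffOn ℝ 2 (fun z : Xi × ℝ => ener psi z.1 z.2) dom := by
  simp only [ener_eq]
  exact (hpsi.of_le (by norm_num)).add (contDiff_snd.contDiffOn.mul (contDiffOn_eta hpsi))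

theorem contDiffOn_dxi {psi : Xi → ℝ → ℝ} (hpsi : SmoothEnergy psi) :
    ContDiffOn ℝ 2 (fun z : Xi × ℝ => dxi psi z.1 z.2) dom := by
  have h : ContDiffOn ℝ 2
      (fun z : Xi × ℝ => (dpsi psi z).comp (ContinuousLinearMap.inl ℝ Xi ℝ)) dom :=
    (contDiffOn_dpsi hpsi).clm_comp contDiffOn_const
  exact h.congr fun z hz => dxi_eq hpsi hz.2

/-- Expresses the stability hypothesis through the second derivative in (ξ, θ) jointly, which is
continuous on the domain and so can be minimized over compact sets. -/
theorem hess_eq {psi : Xi → ℝ → ℝ} (hpsi : SmoothEnergy psi)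
    {xi : Xi} {th : ℝ} (hth : 0 < th) (h : Xi) :
    fderiv ℝ (fun y => dxi psi y th) xi h h = fderiv ℝ (dpsi psi) (xi, th) (h, 0) (h, 0) := by
  have e : (fun y => dxi psi y th)
      = fun y => (dpsi psi (y, th)).comp (ContinuousLinearMap.inl ℝ Xi ℝ) := by
    funext y; exact dxi_eq hpsi hth
  have h1 : HasFDerivAt (fun y : Xi => (y, th)) (ContinuousLinearMap.inl ℝ Xi ℝ) xi :=
    hasFDerivAt_prodMk_left xi th
  have h2 := ((hasFDerivAt_dpsi hpsi hth).comp xi h1).clm_comp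
    (hasFDerivAt_const (ContinuousLinearMap.inl ℝ Xi ℝ) xi)
  rw [e]
  have := h2.fderiv
  simp only [Function.comp_apply] at this
  rw [this]
  simp

theorem hasDerivAt_eta {psi : Xi → ℝ → ℝ} (hpsi : SmoothEnergy psi)
    {xi : Xi} {th : ℝ} (hth : 0 < th) :
    HasDerivAt (eta psi xi) (- fderiv ℝ (dpsi psi) (xi, th) (0, 1) (0, 1)) th := by
  have h : HasDerivAt (fun s : ℝ => (xi, s)) ((0 : Xi), (1 : ℝ)) th :=
    (hasDerivAt_const th xi).prodMk (hasDerivAt_id th)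
  have h1 := ((hasFDerivAt_dpsi hpsi hth).comp_hasDerivAt th h).clm_apply
    (hasDerivAt_const th ((0 : Xi), (1 : ℝ)))
  simp only [map_zero, add_zero] at h1
  refine h1.neg.congr_of_eventuallyEq ?_
  filter_upwards [Ioi_mem_nhds hth] with s hs
  exact eta_eq hpsi hs

/-! ### Taylor estimates and uniform second-order bounds on compact slabs. -/

theorem taylor_lower {h h' h'' : ℝ → ℝ} {m : ℝ} (h1 : ∀ s ∈ Icc (0 : ℝ) 1, HasDerivAt h (h' s) s)
    (h2 : ∀ s ∈ Icc (0 : ℝ) 1, HasDerivAt h' (h'' s) s) (hm : ∀ s ∈ Icc (0 : ℝ) 1, m ≤ h'' s) :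
    h 0 + h' 0 + m / 2 ≤ h 1 := by
  have a1 : ∀ s ∈ Icc (0 : ℝ) 1, h' 0 + m * s ≤ h' s := by
    have hmono : MonotoneOn (fun s => h' s - m * s) (Icc 0 1) := by
      have hd : ∀ s ∈ Icc (0 : ℝ) 1, HasDerivAt (fun s => h' s - m * s) (h'' s - m) s :=
        fun s hs => by simpa using! (h2 s hs).sub ((hasDerivAt_id s).const_mul m)
      refine monotoneOn_of_deriv_nonneg (convex_Icc _ _)
        (fun s hs => (hd s hs).continuousAt.continuousWithinAt)
        (fun s hs => (hd s (interior_subset hs)).differentiableAt.differentiableWithinAt)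
        fun s hs => ?_
      rw [(hd s (interior_subset hs)).deriv]
      linarith [hm s (interior_subset hs)]
    intro s hs
    have := hmono (left_mem_Icc.2 zero_le_one) hs hs.1
    simp only [mul_zero, sub_zero] at this
    linarith
  have hmono : MonotoneOn (fun s => h s - h' 0 * s - m / 2 * s ^ 2) (Icc 0 1) := by
    have hd : ∀ s ∈ Icc (0 : ℝ) 1, HasDerivAt (fun s => h s - h' 0 * s - m / 2 * s ^ 2)
        (h' s - h' 0 - m * s) s := fun s hs => by
      have := ((h1 s hs).sub ((hasDerivAt_id s).const_mul (h' 0))).sub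
        ((hasDerivAt_pow 2 s).const_mul (m / 2))
      convert! this using 1
      simp; ring
    refine monotoneOn_of_deriv_nonneg (convex_Icc _ _)
      (fun s hs => (hd s hs).continuousAt.continuousWithinAt)
      (fun s hs => (hd s (interior_subset hs)).differentiableAt.differentiableWithinAt)
      fun s hs => ?_
    rw [(hd s (interior_subset hs)).deriv]
    linarith [a1 s (interior_subset hs)]
  have := hmono (left_mem_Icc.2 zero_le_one) (right_mem_Icc.2 zero_le_one) zero_le_one
  simp only [mul_zero, sub_zero, mul_one, one_pow] at this
  norm_num at this
  linarith

/-- On a compact convex set the derivative is Lipschitz, and the mean value inequality along the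
segment gives the quadratic remainder. Its application to `dpsi` is where three derivatives of ψ̂
are needed. -/
theorem taylor_upper {E E' : Type*} [NormedAddCommGroup E] [NormedSpace ℝ E]
    [NormedAddCommGroup E'] [NormedSpace ℝ E'] {f : E → E'} {D K : Set E} (hD : IsOpen D)
    (hf : ContDiffOn ℝ 2 f D) (hK : IsCompact K) (hconv : Convex ℝ K) (hKD : K ⊆ D) :
    ∃ C, 0 ≤ C ∧ ∀ z ∈ K, ∀ w ∈ K, ‖f z - f w - fderiv ℝ f w (z - w)‖ ≤ C * ‖z - w‖ ^ 2 := by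
  have h1 : ContDiffOn ℝ 1 (fderiv ℝ f) D := hf.fderiv_of_isOpen hD (by norm_num)
  obtain ⟨L, hL⟩ := (h1.mono hKD).exists_lipschitzOnWith one_ne_zero hconv hK
  refine ⟨L, L.2, fun z hz w hw => ?_⟩
  have hseg : segment ℝ w z ⊆ K := hconv.segment_subset hw hz
  have hdiff : ∀ x ∈ segment ℝ w z, HasFDerivWithinAt f (fderiv ℝ f x) (segment ℝ w z) x :=
    fun x hx => ((hf.contDiffAt (hD.mem_nhds (hKD (hseg hx)))).differentiableAt
      (by norm_num)).hasFDerivAt.hasFDerivWithinAt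
  have := (convex_segment w z).norm_image_sub_le_of_norm_hasFDerivWithin_le'
    (φ := fderiv ℝ f w) (C := L * ‖z - w‖) hdiff (fun x hx => ?_)
    (left_mem_segment ℝ w z) (right_mem_segment ℝ w z)
  · rwa [mul_assoc, ← sq] at this
  · refine (hL.norm_sub_le (hseg hx) hw).trans ?_
    gcongr
    obtain ⟨s, hs, rfl⟩ := (segment_eq_image' ℝ w z) ▸ hx
    rw [add_sub_cancel_left, norm_smul, Real.norm_of_nonneg hs.1]
    exact mul_le_of_le_one_left (norm_nonneg _) hs.2

theorem continuousOn_hess {psi : Xi → ℝ → ℝ} (hpsi : SmoothEnergy psi) :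
    ContinuousOn (fun z : (Xi × ℝ) × (Xi × ℝ) => fderiv ℝ (dpsi psi) z.1 z.2 z.2)
      (dom ×ˢ univ) := by
  have h1 : ContDiffOn ℝ 1 (fderiv ℝ (dpsi psi)) dom :=
    (contDiffOn_dpsi hpsi).fderiv_of_isOpen isOpen_dom (by norm_num)
  have h2 : ContinuousOn (fun z : (Xi × ℝ) × (Xi × ℝ) => fderiv ℝ (dpsi psi) z.1) (dom ×ˢ univ) :=
    h1.continuousOn.comp continuousOn_fst fun z hz => hz.1
  exact (h2.clm_apply continuousOn_snd).clm_apply continuousOn_snd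

/-- The slab `{|ξ| ≤ R} × [a, R]`. -/
def slab (a R : ℝ) : Set (Xi × ℝ) := Metric.closedBall 0 R ×ˢ Icc a R

theorem isCompact_slab (a R : ℝ) : IsCompact (slab a R) :=
  (isCompact_closedBall 0 R).prod isCompact_Icc

theorem convex_slab (a R : ℝ) : Convex ℝ (slab a R) := (convex_closedBall 0 R).prod (convex_Icc a R)

theorem slab_subset_dom {a R : ℝ} (ha : 0 < a) : slab a R ⊆ dom :=
  fun _ hz => ⟨mem_univ _, ha.trans_le hz.2.1⟩

theorem mem_slab {a R : ℝ} {xi : Xi} {th : ℝ} :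
    (xi, th) ∈ slab a R ↔ ‖xi‖ ≤ R ∧ a ≤ th ∧ th ≤ R := by
  simp [slab]

/-- The Hessian form has a positive minimum over the slab times the unit sphere; homogeneity extends
the bound to every h. -/
theorem exists_hess_lower {psi : Xi → ℝ → ℝ} (hpsi : SmoothEnergy psi) (hst : Stable psi)
    {a R : ℝ} (ha : 0 < a) :
    ∃ c, 0 < c ∧ ∀ z ∈ slab a R, ∀ h : Xi, c * ‖h‖ ^ 2 ≤ fderiv ℝ (dpsi psi) z (h, 0) (h, 0) := by
  have hcont : ContinuousOn (fun z : (Xi × ℝ) × Xi => fderiv ℝ (dpsi psi) z.1 (z.2, 0) (z.2, 0))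
      (slab a R ×ˢ Metric.sphere (0 : Xi) 1) :=
    (continuousOn_hess hpsi).comp (f := fun z : (Xi × ℝ) × Xi => (z.1, (z.2, (0 : ℝ))))
      (by fun_prop) fun z hz => ⟨slab_subset_dom ha hz.1, mem_univ _⟩
  obtain ⟨c, hc, hle⟩ := ((isCompact_slab a R).prod (isCompact_sphere (0 : Xi) 1)).exists_forall_le'
    hcont (a := 0) fun z hz => by
      have hpos : 0 < z.1.2 := ha.trans_le hz.1.2.1
      have := hst.hess_pos z.1.1 z.1.2 hpos z.2 (by
        rintro h0
        have := hz.2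
        simp [h0] at this)
      rwa [hess_eq hpsi hpos] at this
  refine ⟨c, hc, fun z hz h => ?_⟩
  rcases eq_or_ne h 0 with rfl | hne
  · have e : ((0, 0) : Xi × ℝ) = 0 := rfl
    simp [e]
  have hn : 0 < ‖h‖ := norm_pos_iff.2 hne
  have := hle (z, ‖h‖⁻¹ • h) ⟨hz, by simp [norm_smul, hn.ne']⟩
  have e : ((‖h‖⁻¹ • h, 0) : Xi × ℝ) = ‖h‖⁻¹ • (h, 0) := by simp
  simp only [e, map_smul, _root_.smul_apply, smul_eq_mul] at this
  rw [← mul_assoc, ← sq, inv_pow, inv_mul_eq_div, le_div_iff₀ (by positivity)] at this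
  exact this

theorem exists_eta_lower {psi : Xi → ℝ → ℝ} (hpsi : SmoothEnergy psi) (hst : Stable psi)
    {a R : ℝ} (ha : 0 < a) :
    ∃ c, 0 < c ∧ ∀ z ∈ slab a R, c ≤ - fderiv ℝ (dpsi psi) z (0, 1) (0, 1) := by
  have hcont : ContinuousOn (fun z : Xi × ℝ => - fderiv ℝ (dpsi psi) z (0, 1) (0, 1))
      (slab a R) :=
    ((continuousOn_hess hpsi).comp (f := fun z : Xi × ℝ => (z, ((0 : Xi), (1 : ℝ))))
      (by fun_prop) fun z hz => ⟨slab_subset_dom ha hz, mem_univ _⟩).neg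
  refine (isCompact_slab a R).exists_forall_le' hcont fun z hz => ?_
  have hpos : 0 < z.2 := ha.trans_le hz.2.1
  have := hst.eta_pos z.1 z.2 hpos
  rwa [(hasDerivAt_eta hpsi hpos).deriv] at this

/-! ### Convexity in ξ, concavity in θ, and positivity of the relative entropy. -/

theorem hasDerivAt_line {E E' : Type*} [NormedAddCommGroup E] [NormedSpace ℝ E]
    [NormedAddCommGroup E'] [NormedSpace ℝ E'] {f : E → E'} {f' : E →L[ℝ] E'} {z w : E} {s : ℝ}
    (hf : HasFDerivAt f f' (z + s • w)) : HasDerivAt (fun s : ℝ => f (z + s • w)) (f' w) s := by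
  have : HasDerivAt (fun s : ℝ => z + s • w) w s := by
    simpa using ((hasDerivAt_id s).smul_const w).const_add z
  exact hf.comp_hasDerivAt s this

theorem hasDerivAt_psi_line {psi : Xi → ℝ → ℝ} (hpsi : SmoothEnergy psi) {z w : Xi × ℝ} {s : ℝ}
    (h : 0 < (z + s • w).2) : HasDerivAt (fun s : ℝ => psi (z + s • w).1 (z + s • w).2)
      (dpsi psi (z + s • w) w) s :=
  hasDerivAt_line (f := fun z : Xi × ℝ => psi z.1 z.2)
    (hasFDerivAt_psi hpsi (xi := (z + s • w).1) h)

theorem hasDerivAt_dpsi_line {psi : Xi → ℝ → ℝ} (hpsi : SmoothEnergy psi) {z w : Xi × ℝ} {s : ℝ}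
    (h : 0 < (z + s • w).2) : HasDerivAt (fun s : ℝ => dpsi psi (z + s • w) w)
      (fderiv ℝ (dpsi psi) (z + s • w) w w) s := by
  have h0 : HasFDerivAt (dpsi psi) (fderiv ℝ (dpsi psi) (z + s • w)) (z + s • w) :=
    hasFDerivAt_dpsi hpsi (xi := (z + s • w).1) h
  have h1 := hasDerivAt_line h0
  simpa only [map_zero, add_zero] using! h1.clm_apply (hasDerivAt_const s w)

theorem psi_convex_quant {psi : Xi → ℝ → ℝ} (hpsi : SmoothEnergy psi) (hst : Stable psi)
    {a R : ℝ} (ha : 0 < a) :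
    ∃ c, 0 < c ∧ ∀ xi xib th, ‖xi‖ ≤ R → ‖xib‖ ≤ R → a ≤ th → th ≤ R →
      c * ‖xi - xib‖ ^ 2 ≤ psi xi th - psi xib th - dxi psi xib th (xi - xib) := by
  obtain ⟨c, hc, hle⟩ := exists_hess_lower hpsi hst (R := R) ha
  refine ⟨c / 2, by positivity, fun xi xib th h1 h2 h3 h4 => ?_⟩
  set z : Xi × ℝ := (xib, th)
  set w : Xi × ℝ := (xi - xib, 0)
  have hzw : z + w = (xi, th) := by simp [z, w]
  have hmem : ∀ s ∈ Icc (0 : ℝ) 1, z + s • w ∈ slab a R := fun s hs =>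
    (convex_slab a R).add_smul_mem (mem_slab.2 ⟨h2, h3, h4⟩) (hzw ▸ mem_slab.2 ⟨h1, h3, h4⟩) hs
  have hpos : ∀ s ∈ Icc (0 : ℝ) 1, 0 < (z + s • w).2 := fun s hs => ha.trans_le (hmem s hs).2.1
  have key := taylor_lower
    (fun s hs => hasDerivAt_psi_line hpsi (hpos s hs))
    (fun s hs => hasDerivAt_dpsi_line hpsi (hpos s hs))
    (fun s hs => hle _ (hmem s hs) (xi - xib))
  rw [zero_smul, one_smul, add_zero, hzw] at key
  rw [dxi_apply hpsi (ha.trans_le h3)]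
  change psi xib th + dpsi psi (xib, th) (xi - xib, 0) + _ ≤ psi xi th at key
  linarith

/-- Since η̂ = -ψ̂_θ increases with θ, -ψ̂ is uniformly convex in θ on the slab. The expansion is
made at θ and evaluated at θ̄, which is why the entropy appears at the state (ξ, θ). -/
theorem psi_concave_quant {psi : Xi → ℝ → ℝ} (hpsi : SmoothEnergy psi) (hst : Stable psi)
    {a R : ℝ} (ha : 0 < a) :
    ∃ c, 0 < c ∧ ∀ xi th thb, ‖xi‖ ≤ R → a ≤ th → th ≤ R → a ≤ thb → thb ≤ R →
      c * (th - thb) ^ 2 ≤ psi xi th - psi xi thb + eta psi xi th * (th - thb) := by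
  obtain ⟨c, hc, hle⟩ := exists_eta_lower hpsi hst (R := R) ha
  refine ⟨c / 2, by positivity, fun xi th thb h1 h2 h3 h4 h5 => ?_⟩
  set z : Xi × ℝ := (xi, th)
  set w : Xi × ℝ := (0, thb - th)
  have hzw : z + w = (xi, thb) := by simp [z, w]
  have hmem : ∀ s ∈ Icc (0 : ℝ) 1, z + s • w ∈ slab a R := fun s hs =>
    (convex_slab a R).add_smul_mem (mem_slab.2 ⟨h1, h2, h3⟩) (hzw ▸ mem_slab.2 ⟨h1, h4, h5⟩) hs
  have hpos : ∀ s ∈ Icc (0 : ℝ) 1, 0 < (z + s • w).2 := fun s hs => ha.trans_le (hmem s hs).2.1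
  have hw : w = (thb - th) • ((0 : Xi), (1 : ℝ)) := by simp [w]
  have key := taylor_lower (m := c * (th - thb) ^ 2)
    (fun s hs => (hasDerivAt_psi_line hpsi (hpos s hs)).neg)
    (fun s hs => (hasDerivAt_dpsi_line hpsi (hpos s hs)).neg)
    (fun s hs => ?_)
  · simp only [Pi.neg_apply] at key
    rw [zero_smul, one_smul, add_zero, hzw] at key
    have e : dpsi psi z w = dxi psi xi th 0 - (thb - th) * eta psi xi th :=
      dpsi_apply hpsi (ha.trans_le h2) 0 (thb - th)
    rw [map_zero] at e
    change - psi xi th + - dpsi psi z w + _ ≤ - psi xi thb at key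
    rw [e] at key
    linarith
  · have := hle _ (hmem s hs)
    generalize z + s • w = y at this
    rw [hw]
    simp only [map_smul, _root_.smul_apply, smul_eq_mul]
    nlinarith [mul_le_mul_of_nonneg_right this (sq_nonneg (th - thb))]

theorem psi_convex {psi : Xi → ℝ → ℝ} (hpsi : SmoothEnergy psi) (hst : Stable psi)
    (xi xib : Xi) {th : ℝ} (hth : 0 < th) :
    psi xib th + dxi psi xib th (xi - xib) ≤ psi xi th := by
  obtain ⟨c, hc, h⟩ := psi_convex_quant hpsi hst (R := max th (max ‖xi‖ ‖xib‖)) hth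
  have := h xi xib th (by simp) (by simp) le_rfl (by simp)
  nlinarith [sq_nonneg ‖xi - xib‖]

theorem psi_concave {psi : Xi → ℝ → ℝ} (hpsi : SmoothEnergy psi) (hst : Stable psi)
    (xi : Xi) {th thb : ℝ} (hth : 0 < th) (hthb : 0 < thb) :
    0 ≤ psi xi th - psi xi thb + eta psi xi th * (th - thb) := by
  obtain ⟨c, hc, h⟩ := psi_concave_quant hpsi hst (R := max ‖xi‖ (max th thb)) (lt_min hth hthb)
  have := h xi th thb (by simp) (by simp) (by simp) (by simp) (by simp)
  nlinarith [sq_nonneg (th - thb)]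

/-- Adding the concavity inequalities with base points θ and θ' leaves (η̂(θ') − η̂(θ))(θ' − θ) ≥ 0.
-/
theorem eta_mono {psi : Xi → ℝ → ℝ} (hpsi : SmoothEnergy psi) (hst : Stable psi)
    (xi : Xi) {th th' : ℝ} (hth : 0 < th) (h : th ≤ th') :
    eta psi xi th ≤ eta psi xi th' := by
  have h1 := psi_concave hpsi hst xi hth (hth.trans_le h)
  have h2 := psi_concave hpsi hst xi (hth.trans_le h) hth
  rcases h.eq_or_lt with rfl | hlt
  · exact le_rfl
  · nlinarith

/-- Passing from (ξ̄, θ̄) to (ξ, θ̄) and then to (ξ, θ) separates the variables: the two brackets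
use only ψ̂_ξξ > 0 and η̂_θ > 0, with no condition on the mixed derivative. -/
theorem relI_split (psi : Xi → ℝ → ℝ) (xi : Xi) (th : ℝ) (xib : Xi) (thb : ℝ) :
    relI psi xi th xib thb = (psi xi thb - psi xib thb - dxi psi xib thb (xi - xib))
      + (psi xi th - psi xi thb + eta psi xi th * (th - thb)) := by
  rw [relI_eq]; ring

theorem relI_nonneg {psi : Xi → ℝ → ℝ} (hpsi : SmoothEnergy psi) (hst : Stable psi)
    (xi xib : Xi) {th thb : ℝ} (hth : 0 < th) (hthb : 0 < thb) :
    0 ≤ relI psi xi th xib thb := by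
  rw [relI_split]
  linarith [psi_convex hpsi hst xi xib hthb, psi_concave hpsi hst xi hth hthb]

/-- The difference of the two sides is the concavity gap between θ and θ' plus (η̂(θ') − η̂(θ))(θ̄ −
θ'). It transfers lower bounds at a fixed positive temperature to all smaller ones, where no
compactness is available. -/
theorem relI_antitone {psi : Xi → ℝ → ℝ} (hpsi : SmoothEnergy psi) (hst : Stable psi)
    (xi xib : Xi) {th th' thb : ℝ} (hth : 0 < th) (h : th ≤ th')
    (h' : th' ≤ thb) : relI psi xi th' xib thb ≤ relI psi xi th xib thb := by
  rw [relI_eq, relI_eq]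
  nlinarith [psi_concave hpsi hst xi hth (hth.trans_le h), eta_mono hpsi hst xi hth h]

theorem relI_quadratic {psi : Xi → ℝ → ℝ} (hpsi : SmoothEnergy psi) (hst : Stable psi)
    {a R : ℝ} (ha : 0 < a) :
    ∃ c, 0 < c ∧ ∀ z ∈ slab a R, ∀ zb ∈ slab a R,
      c * ‖z - zb‖ ^ 2 ≤ relI psi z.1 z.2 zb.1 zb.2 := by
  obtain ⟨c, hc, h⟩ := psi_convex_quant hpsi hst (R := R) ha
  obtain ⟨c', hc', h'⟩ := psi_concave_quant hpsi hst (R := R) ha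
  refine ⟨min c c', lt_min hc hc', fun z hz zb hzb => ?_⟩
  obtain ⟨hz1, hz2, hz3⟩ := mem_slab.1 hz
  obtain ⟨hb1, hb2, hb3⟩ := mem_slab.1 hzb
  have e1 := h z.1 zb.1 zb.2 hz1 hb1 hb2 hb3
  have e2 := h' z.1 z.2 zb.2 hz1 hz2 hz3 hb2 hb3
  rw [relI_split]
  have m1 := mul_le_mul_of_nonneg_right (min_le_left c c') (sq_nonneg ‖z.1 - zb.1‖)
  have m2 := mul_le_mul_of_nonneg_right (min_le_right c c') (sq_nonneg (z.2 - zb.2))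
  have p1 : 0 ≤ c * ‖z.1 - zb.1‖ ^ 2 := by positivity
  have p2 : 0 ≤ c' * (z.2 - zb.2) ^ 2 := by positivity
  have hn : ‖z - zb‖ = max ‖z.1 - zb.1‖ |z.2 - zb.2| := rfl
  rcases max_choice ‖z.1 - zb.1‖ |z.2 - zb.2| with hm | hm
  · rw [hn, hm]; linarith
  · rw [hn, hm, sq_abs]; linarith

end Thermo

end

noncomputable section

namespace Thermo

/-! ### Growth bounds -/

theorem norm_le_mnorm (A : Mat3) : ‖A‖ ≤ mnorm A := by
  have h0 : 0 ≤ mnorm A := Real.sqrt_nonneg _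
  refine (pi_norm_le_iff_of_nonneg h0).2 fun i => (pi_norm_le_iff_of_nonneg h0).2 fun a => ?_
  refine Real.abs_le_sqrt ?_
  calc A i a ^ 2 ≤ ∑ b, A i b ^ 2 :=
        Finset.single_le_sum (f := fun b => A i b ^ 2) (fun _ _ => sq_nonneg _) (Finset.mem_univ a)
    _ ≤ ∑ j, ∑ b, A j b ^ 2 :=
        Finset.single_le_sum (f := fun j => ∑ b, A j b ^ 2)
          (fun _ _ => Finset.sum_nonneg fun _ _ => sq_nonneg _) (Finset.mem_univ i)

theorem mnorm_nonneg (A : Mat3) : 0 ≤ mnorm A := Real.sqrt_nonneg _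

theorem abs_entry_le_mnorm (A : Mat3) (i a : Fin 3) : |A i a| ≤ mnorm A :=
  (norm_le_pi_norm (A i) a).trans ((norm_le_pi_norm A i).trans (norm_le_mnorm A))

theorem growthSize_nonneg (p q r l : ℝ) (xi : Xi) {th : ℝ} (hth : 0 < th) :
    0 ≤ growthSize p q r l xi th := by
  have := mnorm_nonneg xi.1
  have := mnorm_nonneg xi.2.1
  unfold growthSize
  positivity

theorem le_one_add_rpow {x s : ℝ} (hx : 0 ≤ x) (hs : 1 ≤ s) : x ≤ 1 + x ^ s := by
  rcases le_total x 1 with h | h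
  · linarith [Real.rpow_nonneg hx s]
  · linarith [Real.self_le_rpow_of_one_le h hs]

/-- Powers above 1 absorb linear terms with an arbitrarily small coefficient; the linear part of the
relative entropy is dominated by the energy in this way. -/
theorem exists_le_mul_rpow_add {s e : ℝ} (hs : 1 < s) (he : 0 < e) :
    ∃ C, 0 ≤ C ∧ ∀ x : ℝ, 0 ≤ x → x ≤ e * x ^ s + C := by
  have h := tendsto_rpow_atTop (sub_pos.2 hs)
  obtain ⟨X, hX⟩ := (h.eventually_ge_atTop (1 / e)).exists_forall_of_atTop
  refine ⟨max X 1, by positivity, fun x hx => ?_⟩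
  have hp := Real.rpow_nonneg hx s
  rcases le_total x (max X 1) with h1 | h1
  · nlinarith [mul_nonneg he.le hp]
  · have hx1 : 0 < x := one_pos.trans_le ((le_max_right _ _).trans h1)
    have h2 := hX x ((le_max_left _ _).trans h1)
    rw [Real.rpow_sub_one hx1.ne', div_le_div_iff₀ he hx1] at h2
    have : 0 ≤ max X 1 := by positivity
    linarith

theorem add_rpow_le {s M : ℝ} (hs : 1 ≤ s) (hM : 0 ≤ M) :
    ∃ C, 0 ≤ C ∧ ∀ x : ℝ, 0 ≤ x → (x + M) ^ s ≤ C * (1 + x ^ s) := by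
  refine ⟨2 ^ s * (1 + M) ^ s, by positivity, fun x hx => ?_⟩
  have hx' := Real.rpow_nonneg hx s
  have h1 : x + M ≤ 2 * (1 + M) * max 1 x := by
    have := le_max_left 1 x
    have := le_max_right 1 x
    nlinarith
  have hs0 : 0 ≤ s := zero_le_one.trans hs
  calc (x + M) ^ s ≤ (2 * (1 + M) * max 1 x) ^ s := Real.rpow_le_rpow (by positivity) h1 hs0
    _ = 2 ^ s * (1 + M) ^ s * (max 1 x) ^ s := by
        rw [Real.mul_rpow (by positivity) (by positivity),
          Real.mul_rpow (by positivity) (by positivity)]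
    _ ≤ _ := by
        gcongr
        rcases le_total 1 x with h | h
        · rw [max_eq_right h]; linarith
        · rw [max_eq_left h, Real.one_rpow]; linarith

theorem mul_le_rpow_add_rpow {a b s t : ℝ} (ha : 0 ≤ a) (hb : 0 ≤ b) (h : s.HolderConjugate t) :
    a * b ≤ a ^ s + b ^ t := by
  refine (Real.young_inequality_of_nonneg ha hb h).trans ?_
  exact add_le_add (div_le_self (Real.rpow_nonneg ha s) h.lt.le)
    (div_le_self (Real.rpow_nonneg hb t) h.symm.lt.le)

theorem abs_cofBil_le (F H : Mat3) (i a : Fin 3) : |cofBil F H i a| ≤ 4 * ‖F‖ * ‖H‖ := by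
  have hF : ∀ j b, |F j b| ≤ ‖F‖ := fun j b => (norm_le_pi_norm (F j) b).trans (norm_le_pi_norm F j)
  have hH : ∀ j b, |H j b| ≤ ‖H‖ := fun j b => (norm_le_pi_norm (H j) b).trans (norm_le_pi_norm H j)
  have h : ∀ j b k c, |F j b * H k c| ≤ ‖F‖ * ‖H‖ := fun j b k c => by
    rw [abs_mul]; exact mul_le_mul (hF j b) (hH k c) (abs_nonneg _) (norm_nonneg _)
  have h1 := abs_le.1 (h (i + 1) (a + 1) (i + 2) (a + 2))
  have h2 := abs_le.1 (h (i + 2) (a + 2) (i + 1) (a + 1))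
  have h3 := abs_le.1 (h (i + 1) (a + 2) (i + 2) (a + 1))
  have h4 := abs_le.1 (h (i + 2) (a + 1) (i + 1) (a + 2))
  unfold cofBil
  rw [abs_le]
  constructor <;> linarith

theorem norm_unitMat (i a : Fin 3) : ‖unitMat i a‖ = 1 := by
  rw [unitMat, Pi.norm_single, Pi.norm_single, norm_one]

/-- The F-slot of ∂Φ/∂F is constant, its ζ-slot linear and its w-slot quadratic. In the difference
ψ̂_F therefore drops out, while ψ̂_ζ is multiplied by a first power of |F| and ψ̂_w by a second: the
source of the exponents p/(p-1) and p/(p-2). -/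
theorem dPhi_sub (F G : Mat3) (i a : Fin 3) : dPhi F i a - dPhi G i a
    = (0, cofBil (F - G) (unitMat i a), 1 / 2 * cofBil (F - G) (F + G) i a) := by
  rw [dPhi_eq, dPhi_eq, Prod.mk_sub_mk, Prod.mk_sub_mk, sub_self, cof_apply, cof_apply]
  ext1
  · rfl
  ext1
  · funext j b
    simp only [cofBil, Pi.sub_apply]
    ring
  · simp only [cofBil, Pi.sub_apply, Pi.add_apply]
    ring

theorem norm_cofBil_unitMat_le (F : Mat3) (i a : Fin 3) : ‖cofBil F (unitMat i a)‖ ≤ 4 * ‖F‖ := by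
  have h0 : 0 ≤ 4 * ‖F‖ := by positivity
  refine (pi_norm_le_iff_of_nonneg h0).2 fun j => (pi_norm_le_iff_of_nonneg h0).2 fun b => ?_
  have := abs_cofBil_le F (unitMat i a) j b
  rwa [norm_unitMat, mul_one] at this

theorem abs_half_cofBil_le (F G : Mat3) (i a : Fin 3) :
    |1 / 2 * cofBil (F - G) (F + G) i a| ≤ 2 * ‖F - G‖ * ‖F + G‖ := by
  rw [abs_mul, abs_of_pos (by norm_num : (0 : ℝ) < 1 / 2)]
  linarith [abs_cofBil_le (F - G) (F + G) i a]

theorem norm_dPhi_sub_le (F G : Mat3) (i a : Fin 3) :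
    ‖dPhi F i a - dPhi G i a‖ ≤ ‖F - G‖ * (4 + 2 * ‖F + G‖) := by
  rw [dPhi_sub]
  have h1 := norm_cofBil_unitMat_le (F - G) i a
  have h2 := abs_half_cofBil_le F G i a
  have h3 : 0 ≤ ‖F - G‖ * ‖F + G‖ := by positivity
  have h4 := norm_nonneg (F - G)
  refine max_le (by rw [norm_zero]; positivity) (max_le ?_ ?_)
  · exact h1.trans (by linarith)
  · exact h2.trans (by linarith)

theorem mat_eq_sum (H : Mat3) : H = ∑ i, ∑ a, H i a • unitMat i a := by
  funext j b
  simp only [Fin.sum_univ_three, unitMat, Pi.add_apply, Pi.smul_apply]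
  fin_cases j <;> fin_cases b <;> simp

theorem abs_dxi_le (psi : Xi → ℝ → ℝ) (xi : Xi) (th : ℝ) (h : Xi) :
    |dxi psi xi th h| ≤ 9 * mnorm (dF psi xi th) * ‖h.1‖ + 9 * mnorm (dZeta psi xi th) * ‖h.2.1‖
      + |dW psi xi th| * |h.2.2| := by
  obtain ⟨H, Z, w⟩ := h
  have hH : ((H, 0, 0) : Xi) = ∑ i, ∑ a, H i a • ((unitMat i a, 0, 0) : Xi) := by
    conv_lhs => rw [mat_eq_sum H]
    simp [Fin.sum_univ_three]
  have hZ : ((0, Z, 0) : Xi) = ∑ i, ∑ a, Z i a • ((0, unitMat i a, 0) : Xi) := by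
    conv_lhs => rw [mat_eq_sum Z]
    simp [Fin.sum_univ_three]
  have hw : ((0, 0, w) : Xi) = w • ((0, 0, 1) : Xi) := by simp
  have hsum : ((H, Z, w) : Xi) = (H, 0, 0) + (0, Z, 0) + (0, 0, w) := by simp
  have e : dxi psi xi th (H, Z, w) = (∑ i, ∑ a, H i a * dF psi xi th i a)
      + (∑ i, ∑ a, Z i a * dZeta psi xi th i a) + w * dW psi xi th := by
    rw [hsum, map_add, map_add, hH, hZ, hw]
    simp only [map_sum, map_smul, smul_eq_mul, dF, dZeta, dW]
  have hb : ∀ (A B : Mat3), |∑ i, ∑ a, A i a * B i a| ≤ 9 * mnorm B * ‖A‖ := fun A B => by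
    have h1 : ∀ i a, |A i a * B i a| ≤ mnorm B * ‖A‖ := fun i a => by
      rw [abs_mul, mul_comm]
      exact mul_le_mul (abs_entry_le_mnorm B i a)
        ((norm_le_pi_norm (A i) a).trans (norm_le_pi_norm A i)) (abs_nonneg _) (mnorm_nonneg _)
    calc |∑ i, ∑ a, A i a * B i a| ≤ ∑ i : Fin 3, ∑ a : Fin 3, mnorm B * ‖A‖ :=
          (Finset.abs_sum_le_sum_abs _ _).trans (Finset.sum_le_sum fun i _ =>
            (Finset.abs_sum_le_sum_abs _ _).trans (Finset.sum_le_sum fun a _ => h1 i a))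
      _ = 9 * mnorm B * ‖A‖ := by simp; ring
  rw [e]
  have h1 := abs_add_le ((∑ i, ∑ a, H i a * dF psi xi th i a)
      + (∑ i, ∑ a, Z i a * dZeta psi xi th i a)) (w * dW psi xi th)
  have h2 := abs_add_le (∑ i, ∑ a, H i a * dF psi xi th i a)
    (∑ i, ∑ a, Z i a * dZeta psi xi th i a)
  have h3 := hb H (dF psi xi th)
  have h4 := hb Z (dZeta psi xi th)
  rw [abs_mul w, mul_comm |w|] at h1
  simp only
  linarith

theorem exists_abs_le_of_growth {p q r l : ℝ} {f : Xi × ℝ → ℝ}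
    (hf : Tendsto (fun z => f z / growthSize p q r l z.1 z.2) (growthFilter p q r l) (𝓝 0))
    {e : ℝ} (he : 0 < e) : ∃ R, ∀ (xi : Xi) (th : ℝ), 0 < th → R ≤ growthSize p q r l xi th →
      |f (xi, th)| ≤ e * growthSize p q r l xi th := by
  have h := hf.eventually (Metric.closedBall_mem_nhds (0 : ℝ) he)
  rw [growthFilter, eventually_inf_principal, eventually_comap] at h
  obtain ⟨R, hR⟩ := h.exists_forall_of_atTop
  refine ⟨max R 1, fun xi th hth hle => ?_⟩
  have h1 := hR _ ((le_max_left _ _).trans hle) (xi, th) rfl hth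
  have hpos : 0 < growthSize p q r l xi th := one_pos.trans_le ((le_max_right _ _).trans hle)
  simp only [dist_zero_right, Real.norm_eq_abs, abs_div, abs_of_pos hpos]
    at h1
  exact (div_le_iff₀ hpos).1 h1

section Size

variable {p q r l : ℝ}

theorem mnorm_rpow_le_growthSize (q r l : ℝ) (xi : Xi) {th : ℝ} (hth : 0 < th) :
    mnorm xi.1 ^ p ≤ growthSize p q r l xi th := by
  have := mnorm_nonneg xi.2.1
  have h : 0 ≤ mnorm xi.2.1 ^ q + |xi.2.2| ^ r + th ^ l := by positivity
  unfold growthSize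
  linarith

theorem norm_xi_le_growthSize (hp : 1 ≤ p) (hq : 1 ≤ q) (hr : 1 ≤ r) (xi : Xi) {th : ℝ}
    (hth : 0 < th) : ‖xi‖ ≤ 1 + growthSize p q r l xi th := by
  have h1 := le_one_add_rpow (mnorm_nonneg xi.1) hp
  have h2 := le_one_add_rpow (mnorm_nonneg xi.2.1) hq
  have h3 := le_one_add_rpow (abs_nonneg xi.2.2) hr
  have n1 := Real.rpow_nonneg (mnorm_nonneg xi.1) p
  have n2 := Real.rpow_nonneg (mnorm_nonneg xi.2.1) q
  have n3 := Real.rpow_nonneg (abs_nonneg xi.2.2) r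
  have n4 := Real.rpow_nonneg hth.le l
  unfold growthSize
  refine max_le ?_ (max_le ?_ ?_)
  · linarith [norm_le_mnorm xi.1]
  · linarith [norm_le_mnorm xi.2.1]
  · rw [Real.norm_eq_abs]; linarith

theorem th_le_growthSize (hl : 1 ≤ l) (xi : Xi) {th : ℝ} (hth : 0 < th) :
    th ≤ 1 + growthSize p q r l xi th := by
  have h1 := le_one_add_rpow hth.le hl
  have n1 := Real.rpow_nonneg (mnorm_nonneg xi.1) p
  have n2 := Real.rpow_nonneg (mnorm_nonneg xi.2.1) q
  have n3 := Real.rpow_nonneg (abs_nonneg xi.2.2) r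
  unfold growthSize
  linarith

theorem exists_norm_xi_le (hp : 1 < p) (hq : 1 < q) (hr : 1 < r) {e : ℝ} (he : 0 < e) :
    ∃ C, 0 ≤ C ∧ ∀ (xi : Xi) (th : ℝ), 0 < th → ‖xi‖ ≤ e * growthSize p q r l xi th + C := by
  obtain ⟨C1, h1, k1⟩ := exists_le_mul_rpow_add hp he
  obtain ⟨C2, h2, k2⟩ := exists_le_mul_rpow_add hq he
  obtain ⟨C3, h3, k3⟩ := exists_le_mul_rpow_add hr he
  refine ⟨C1 + C2 + C3, by positivity, fun xi th hth => ?_⟩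
  have m1 := k1 _ (mnorm_nonneg xi.1)
  have m2 := k2 _ (mnorm_nonneg xi.2.1)
  have m3 := k3 _ (abs_nonneg xi.2.2)
  have n1 := mul_nonneg he.le (Real.rpow_nonneg (mnorm_nonneg xi.1) p)
  have n2 := mul_nonneg he.le (Real.rpow_nonneg (mnorm_nonneg xi.2.1) q)
  have n3 := mul_nonneg he.le (Real.rpow_nonneg (abs_nonneg xi.2.2) r)
  have n4 := mul_nonneg he.le (Real.rpow_nonneg hth.le l)
  unfold growthSize
  refine max_le ?_ (max_le ?_ ?_)
  · linarith [norm_le_mnorm xi.1]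
  · linarith [norm_le_mnorm xi.2.1]
  · rw [Real.norm_eq_abs]; linarith

/-- The difference grows like |F|², so its square grows like |F|⁴. The assumption p ≥ 4 puts this
below |F|^p. -/
theorem norm_dPhi_sub_sq_le (hp : 4 ≤ p) {M : ℝ} (hM : 0 ≤ M) :
    ∃ C, 0 ≤ C ∧ ∀ (xi xib : Xi) (th : ℝ), 0 < th → ‖xib‖ ≤ M → ∀ i a,
      ‖dPhi xi.1 i a - dPhi xib.1 i a‖ ^ 2 ≤ C * (1 + growthSize p q r l xi th) := by
  obtain ⟨C, hC, h⟩ := add_rpow_le (s := p) (M := M + 1) (by linarith) (by linarith)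
  refine ⟨36 * C, by positivity, fun xi xib th hth hb i a => ?_⟩
  set Y := mnorm xi.1 + (M + 1)
  have hx := mnorm_nonneg xi.1
  have hY1 : 1 ≤ Y := by simp only [Y]; linarith
  have hb1 : ‖xib.1‖ ≤ M := (norm_fst_le xib).trans hb
  have h1 : ‖xi.1 - xib.1‖ ≤ Y := (norm_sub_le _ _).trans (by
    simp only [Y]; linarith [norm_le_mnorm xi.1])
  have h2 : ‖xi.1 + xib.1‖ ≤ Y := (norm_add_le _ _).trans (by
    simp only [Y]; linarith [norm_le_mnorm xi.1])
  have h3 : ‖dPhi xi.1 i a - dPhi xib.1 i a‖ ≤ 6 * Y ^ 2 := by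
    refine (norm_dPhi_sub_le _ _ i a).trans ?_
    have : ‖xi.1 - xib.1‖ * (4 + 2 * ‖xi.1 + xib.1‖) ≤ Y * (4 + 2 * Y) := by gcongr
    nlinarith
  have h4 : Y ^ 4 ≤ Y ^ p := by
    rw [← Real.rpow_natCast Y 4]
    exact Real.rpow_le_rpow_of_exponent_le hY1 (by exact_mod_cast hp)
  have h5 := h _ hx
  have h6 := mnorm_rpow_le_growthSize (p := p) q r l xi hth
  calc ‖dPhi xi.1 i a - dPhi xib.1 i a‖ ^ 2 ≤ (6 * Y ^ 2) ^ 2 := by gcongr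
    _ = 36 * Y ^ 4 := by ring
    _ ≤ 36 * (C * (1 + mnorm xi.1 ^ p)) := by linarith
    _ ≤ 36 * C * (1 + growthSize p q r l xi th) := by
        rw [mul_assoc]; gcongr

end Size

/-- Bounds on `D_ξ ψ̂` in the regime of large arguments. -/
theorem exists_dxi_le_of_large {psi : Xi → ℝ → ℝ} {p q r l : ℝ} (hp : 4 ≤ p)
    (hg : GrowthConditions psi p q r l) {M : ℝ} (hM : 0 ≤ M) :
    ∃ R C, 0 ≤ C ∧ ∀ (xi : Xi) (th : ℝ), 0 < th → R ≤ growthSize p q r l xi th →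
      ‖dxi psi xi th‖ ≤ C * (1 + growthSize p q r l xi th) ∧
      ∀ xib : Xi, ‖xib‖ ≤ M → ∀ i a, |dxi psi xi th (dPhi xi.1 i a - dPhi xib.1 i a)|
        ≤ C * (1 + growthSize p q r l xi th) := by
  obtain ⟨R, hR⟩ := exists_abs_le_of_growth (f := fun z => mnorm (dF psi z.1 z.2)
    + mnorm (dZeta psi z.1 z.2) ^ (p / (p - 1)) + |dW psi z.1 z.2| ^ (p / (p - 2)))
    hg.stress one_pos
  obtain ⟨C, hC, h⟩ := add_rpow_le (s := p) (M := M) (by linarith) hM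
  -- The ζ- and w-terms of `abs_dxi_le` carry the factors 9·4 and 2, together 38; C converts (|F| +
  -- M)^p into 1 + N. The 20 leaves room for the plain bound 9A + 9B + D.
  refine ⟨R, 20 + 38 + 38 * C, by positivity, fun xi th hth hle => ?_⟩
  have h0 := hR xi th hth hle
  simp only [one_mul] at h0
  set N := growthSize p q r l xi th
  have hN : 0 ≤ N := growthSize_nonneg p q r l xi hth
  set A := mnorm (dF psi xi th) with hA
  set B := mnorm (dZeta psi xi th) with hB
  set D := |dW psi xi th| with hD
  have hA0 : 0 ≤ A := mnorm_nonneg _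
  have hB0 : 0 ≤ B := mnorm_nonneg _
  have hD0 : 0 ≤ D := abs_nonneg _
  have hBp := Real.rpow_nonneg hB0 (p / (p - 1))
  have hDp := Real.rpow_nonneg hD0 (p / (p - 2))
  rw [abs_of_nonneg (by positivity)] at h0
  have e1 : 1 ≤ p / (p - 1) := by rw [le_div_iff₀ (by linarith)]; linarith
  have e2 : 1 ≤ p / (p - 2) := by rw [le_div_iff₀ (by linarith)]; linarith
  have hB1 := le_one_add_rpow hB0 e1
  have hD1 := le_one_add_rpow hD0 e2
  constructor
  · refine ContinuousLinearMap.opNorm_le_bound _ (by positivity) fun v => ?_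
    have k1 : ‖v.1‖ ≤ ‖v‖ := norm_fst_le v
    have k2 : ‖v.2.1‖ ≤ ‖v‖ := (norm_fst_le v.2).trans (norm_snd_le v)
    have k3 : |v.2.2| ≤ ‖v‖ := (norm_snd_le v.2).trans (norm_snd_le v)
    calc ‖dxi psi xi th v‖ ≤ 9 * A * ‖v.1‖ + 9 * B * ‖v.2.1‖ + D * |v.2.2| :=
          abs_dxi_le psi xi th v
      _ ≤ 9 * A * ‖v‖ + 9 * B * ‖v‖ + D * ‖v‖ := by gcongr
      _ = (9 * A + 9 * B + D) * ‖v‖ := by ring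
      _ ≤ (20 + 38 + 38 * C) * (1 + N) * ‖v‖ := by
          gcongr
          nlinarith [mul_nonneg hC hN]
  · intro xib hb i a
    have hx := mnorm_nonneg xi.1
    set Y := mnorm xi.1 + M
    have hY0 : 0 ≤ Y := by positivity
    have hb1 : ‖xib.1‖ ≤ M := (norm_fst_le xib).trans hb
    have h1 : ‖xi.1 - xib.1‖ ≤ Y := (norm_sub_le _ _).trans (by
      simp only [Y]; linarith [norm_le_mnorm xi.1])
    have h2 : ‖xi.1 + xib.1‖ ≤ Y := (norm_add_le _ _).trans (by
      simp only [Y]; linarith [norm_le_mnorm xi.1])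
    have k := abs_dxi_le psi xi th (dPhi xi.1 i a - dPhi xib.1 i a)
    rw [dPhi_sub] at k ⊢
    simp only [norm_zero, mul_zero, zero_add] at k
    have k2 : ‖cofBil (xi.1 - xib.1) (unitMat i a)‖ ≤ 4 * Y :=
      (norm_cofBil_unitMat_le _ i a).trans (by linarith)
    have k3 : |1 / 2 * cofBil (xi.1 - xib.1) (xi.1 + xib.1) i a| ≤ 2 * (Y * Y) := by
      refine (abs_half_cofBil_le _ _ i a).trans ?_
      have : ‖xi.1 - xib.1‖ * ‖xi.1 + xib.1‖ ≤ Y * Y := by gcongr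
      linarith
    have y1 : B * Y ≤ B ^ (p / (p - 1)) + Y ^ p := by
      refine mul_le_rpow_add_rpow hB0 hY0 ?_
      rw [Real.holderConjugate_iff]
      refine ⟨by rw [lt_div_iff₀ (by linarith)]; linarith, ?_⟩
      have : p ≠ 0 := by linarith
      have : p - 1 ≠ 0 := by linarith
      field_simp
      ring
    -- Young's inequality with the conjugate exponents p/(p-2) and p/2, as the determinant part is
    -- quadratic in F; the cofactor part above uses p/(p-1) and p.
    have y2 : D * (Y * Y) ≤ D ^ (p / (p - 2)) + Y ^ p := by
      have h3 : (Y * Y) ^ (p / 2) = Y ^ p := by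
        rw [← sq, ← Real.rpow_natCast, ← Real.rpow_mul hY0]
        congr 1
        push_cast
        ring
      rw [← h3]
      refine mul_le_rpow_add_rpow hD0 (by positivity) ?_
      rw [Real.holderConjugate_iff]
      refine ⟨by rw [lt_div_iff₀ (by linarith)]; linarith, ?_⟩
      have : p ≠ 0 := by linarith
      have : p - 2 ≠ 0 := by linarith
      field_simp
      ring
    have h5 := h _ hx
    have h6 := mnorm_rpow_le_growthSize (p := p) q r l xi hth
    have h7 : Y ^ p ≤ C * (1 + N) := h5.trans (by gcongr)
    have k4 : 9 * B * ‖cofBil (xi.1 - xib.1) (unitMat i a)‖ ≤ 9 * B * (4 * Y) := by gcongr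
    have k5 : D * |1 / 2 * cofBil (xi.1 - xib.1) (xi.1 + xib.1) i a| ≤ D * (2 * (Y * Y)) := by
      gcongr
    have h8 : 0 ≤ C * (1 + N) := by positivity
    nlinarith

end Thermo

end

noncomputable section

namespace Thermo

/-! ### The relative entropy dominates the error terms -/

theorem exists_bound_slab {psi : Xi → ℝ → ℝ} (hpsi : SmoothEnergy psi) {a R : ℝ} (ha : 0 < a) :
    ∃ B, 0 ≤ B ∧ ∀ xi th, ‖xi‖ ≤ R → a ≤ th → th ≤ R → |psi xi th| ≤ B ∧ |eta psi xi th| ≤ B ∧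
      ‖dxi psi xi th‖ ≤ B ∧ ‖dpsi psi (xi, th)‖ ≤ B ∧ ‖fderiv ℝ (dpsi psi) (xi, th)‖ ≤ B := by
  have hK := isCompact_slab a R
  have hsub := slab_subset_dom (R := R) ha
  have hd : ContDiffOn ℝ 1 (fderiv ℝ (dpsi psi)) dom :=
    (contDiffOn_dpsi hpsi).fderiv_of_isOpen isOpen_dom (by norm_num)
  obtain ⟨B1, h1⟩ := hK.exists_bound_of_continuousOn (hpsi.continuousOn.mono hsub)
  obtain ⟨B2, h2⟩ := hK.exists_bound_of_continuousOn ((contDiffOn_eta hpsi).continuousOn.mono hsub)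
  obtain ⟨B3, h3⟩ := hK.exists_bound_of_continuousOn ((contDiffOn_dxi hpsi).continuousOn.mono hsub)
  obtain ⟨B4, h4⟩ := hK.exists_bound_of_continuousOn ((contDiffOn_dpsi hpsi).continuousOn.mono hsub)
  obtain ⟨B5, h5⟩ := hK.exists_bound_of_continuousOn (E := Xi × ℝ →L[ℝ] Xi × ℝ →L[ℝ] ℝ)
    (hd.continuousOn.mono hsub)
  refine ⟨max 0 (max B1 (max B2 (max B3 (max B4 B5)))), by simp, fun xi th k1 k2 k3 => ?_⟩
  have hz : (xi, th) ∈ slab a R := mem_slab.2 ⟨k1, k2, k3⟩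
  exact ⟨(h1 _ hz).trans (by simp), (h2 _ hz).trans (by simp), (h3 _ hz).trans (by simp),
    (h4 _ hz).trans (by simp), (h5 _ hz).trans (by simp)⟩

/-- Coercivity of the relative entropy for large arguments. -/
theorem exists_relI_ge_of_large {psi : Xi → ℝ → ℝ} (hpsi : SmoothEnergy psi) {p q r l : ℝ}
    (hp : 4 ≤ p) (hq : 1 < q) (hr : 1 < r) (hg : GrowthConditions psi p q r l)
    {M d : ℝ} (hM : 0 < M) (hd : 0 < d) :
    ∃ R c, 0 < c ∧ ∀ (xi : Xi) (th : ℝ), 0 < th → R ≤ growthSize p q r l xi th →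
      ∀ xib thb, ‖xib‖ ≤ M → d ≤ thb → thb ≤ M →
        c * growthSize p q r l xi th ≤ relI psi xi th xib thb := by
  obtain ⟨c, C0, hc, hC0, he⟩ := hg.energy
  obtain ⟨B, hB, hbd⟩ := exists_bound_slab hpsi (R := M) hd
  obtain ⟨R, hR⟩ := exists_abs_le_of_growth (f := fun z => |deriv (psi z.1) z.2|)
    hg.entropy (e := c / (4 * M)) (by positivity)
  obtain ⟨C1, hC1, hxi⟩ := exists_norm_xi_le (p := p) (q := q) (r := r) (l := l) (by linarith) hq hr
    (e := c / (4 * (B + 1))) (by positivity)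
  -- Of the lower bound cN for the energy, one quarter pays for θ̄ η̂, one for the linear term in ξ
  -- and one, by the choice of this threshold, for all constants. One quarter remains.
  refine ⟨max R (4 / c * (C0 + B + B * C1 + B * M)), c / 4, by positivity,
    fun xi th hth hle xib thb hb1 hb2 hb3 => ?_⟩
  have h1 := hR xi th hth ((le_max_left _ _).trans hle)
  have h2 := (le_max_right _ _).trans hle
  have h3 := (he xi th hth).1
  have h4 := hxi xi th hth
  obtain ⟨b1, -, b3, -, -⟩ := hbd xib thb hb1 hb2 hb3
  set N := growthSize p q r l xi th
  have hN : 0 ≤ N := growthSize_nonneg p q r l xi hth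
  rw [abs_abs] at h1
  have h5 : |eta psi xi th| ≤ c / (4 * M) * N := by rwa [eta, abs_neg]
  have h6 : thb * eta psi xi th ≤ c / 4 * N := by
    calc thb * eta psi xi th ≤ M * (c / (4 * M) * N) :=
          (le_abs_self _).trans (by
            rw [abs_mul, abs_of_pos (hd.trans_le hb2)]
            gcongr)
      _ = c / 4 * N := by field_simp
  have h7 : dxi psi xib thb (xi - xib) ≤ c / 4 * N + B * C1 + B * M := by
    calc dxi psi xib thb (xi - xib) ≤ ‖dxi psi xib thb‖ * ‖xi - xib‖ :=
          (le_abs_self _).trans ((dxi psi xib thb).le_opNorm _)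
      _ ≤ B * (c / (4 * (B + 1)) * N + C1 + M) := by
          gcongr
          exact (norm_sub_le _ _).trans (by linarith)
      _ = (B / (B + 1)) * (c / 4 * N) + B * C1 + B * M := by field_simp
      _ ≤ 1 * (c / 4 * N) + B * C1 + B * M := by
          gcongr
          exact (div_le_one (by linarith)).2 (by linarith)
      _ = _ := by ring
  have h8 : C0 + B + B * C1 + B * M ≤ c / 4 * N := by
    have := mul_le_mul_of_nonneg_left h2 (by positivity : 0 ≤ c / 4)
    calc C0 + B + B * C1 + B * M = c / 4 * (4 / c * (C0 + B + B * C1 + B * M)) := by field_simp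
      _ ≤ _ := this
  rw [relI_eq']
  have := (abs_le.1 b1).2
  linarith

/-- Away from zero lower bound of the relative entropy for small temperatures. -/
theorem exists_relI_ge_of_small {psi : Xi → ℝ → ℝ} (hpsi : SmoothEnergy psi) (hst : Stable psi)
    {M d R : ℝ} (hd : 0 < d) (hMR : M ≤ R) :
    ∃ c, 0 < c ∧ ∀ (xi : Xi) (th : ℝ), 0 < th → th ≤ d / 2 → ‖xi‖ ≤ R →
      ∀ xib thb, ‖xib‖ ≤ M → d ≤ thb → thb ≤ M → c ≤ relI psi xi th xib thb := by
  obtain ⟨c, hc, h⟩ := relI_quadratic hpsi hst (a := d / 2) (R := R) (by positivity)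
  refine ⟨c * (d / 2) ^ 2, by positivity, fun xi th hth hle hxi xib thb hb1 hb2 hb3 => ?_⟩
  have h1 := relI_antitone hpsi hst xi xib hth hle (by linarith : d / 2 ≤ thb)
  have h2 := h (xi, d / 2) (mem_slab.2 ⟨hxi, le_rfl, by linarith⟩) (xib, thb)
    (mem_slab.2 ⟨by linarith, by linarith, by linarith⟩)
  have h3 : d / 2 ≤ ‖(xi, d / 2) - (xib, thb)‖ := by
    refine le_trans ?_ (norm_snd_le _)
    rw [Prod.snd_sub, Real.norm_eq_abs, abs_sub_comm]
    exact (by linarith : d / 2 ≤ thb - d / 2).trans (le_abs_self _)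
  have h4 : c * (d / 2) ^ 2 ≤ c * ‖(xi, d / 2) - (xib, thb)‖ ^ 2 := by gcongr
  simp only at h2
  linarith

/-- For bounded deformations `D_ξ ψ̂` stays bounded as the temperature tends to zero. -/
theorem exists_dxi_le_of_small {psi : Xi → ℝ → ℝ} (hpsi : SmoothEnergy psi) (hst : Stable psi)
    {p q r l : ℝ} (hg : GrowthConditions psi p q r l) {d R : ℝ} (hd : 0 < d) (hdR : d ≤ R) :
    ∃ C, 0 ≤ C ∧ ∀ (xi : Xi) (th : ℝ), 0 < th → th ≤ d → ‖xi‖ ≤ R → ‖dxi psi xi th‖ ≤ C := by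
  obtain ⟨c, C0, hc, hC0, he⟩ := hg.energy
  obtain ⟨B, hB, hbd⟩ := exists_bound_slab hpsi (R := R + 1) hd
  -- Concavity in θ: ψ̂(ξ,·) lies below its tangent at the temperature d.
  have hup : ∀ (xi : Xi) (th : ℝ), 0 < th → th ≤ d → ‖xi‖ ≤ R + 1 → psi xi th ≤ B + B * d := by
    intro xi th hth hle hxi
    have h1 := psi_concave hpsi hst xi hd hth
    obtain ⟨b1, b2, -, -, -⟩ := hbd xi d hxi le_rfl (by linarith)
    have b1 := (abs_le.1 b1).2
    have h2 : eta psi xi d * (d - th) ≤ B * d :=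
      (le_abs_self _).trans (by
        rw [abs_mul, abs_of_nonneg (by linarith : 0 ≤ d - th)]
        exact mul_le_mul b2 (by linarith) (by linarith) hB)
    linarith
  -- Nothing is known about η̂ as θ tends to 0. The concavity inequality multiplied by θ contains it
  -- only as θη̂ = ê − ψ̂, and becomes dψ̂(ξ,θ) ≥ θψ̂(ξ,d) + (d − θ)ê, where ê is bounded below.
  have hlow : ∀ (xi : Xi) (th : ℝ), 0 < th → th ≤ d → ‖xi‖ ≤ R → -(B + C0) ≤ psi xi th := by
    intro xi th hth hle hxi
    have h1 := mul_nonneg hth.le (psi_concave hpsi hst xi hth hd)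
    obtain ⟨b1, -, -, -, -⟩ := hbd xi d (by linarith) le_rfl (by linarith)
    have b1 := (abs_le.1 b1).1
    have h3 := (he xi th hth).1
    have h4 : - C0 ≤ ener psi xi th := by
      have := mul_nonneg hc.le (growthSize_nonneg p q r l xi hth)
      linarith
    have h5 := ener_eq psi xi th
    have h6 : 0 ≤ d * psi xi th - th * psi xi d - ener psi xi th * (d - th) := by
      rw [h5]; linarith
    have h7 : th * psi xi d ≥ - (d * B) := by nlinarith
    have h8 : ener psi xi th * (d - th) ≥ - (d * C0) := by nlinarith
    by_contra hcon
    have := mul_lt_mul_of_pos_left (not_le.1 hcon) hd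
    linarith
  refine ⟨B + B * d + (B + C0), by positivity, fun xi th hth hle hxi => ?_⟩
  -- A convex function has slope at most its increment over a unit step; the step requires the upper
  -- bound on the ball of radius R + 1.
  have hone : ∀ v : Xi, ‖v‖ = 1 → dxi psi xi th v ≤ B + B * d + (B + C0) := fun v hv => by
    have h1 := psi_convex hpsi hst (xi + v) xi hth
    rw [add_sub_cancel_left] at h1
    have h2 := hup (xi + v) th hth hle ((norm_add_le _ _).trans (by linarith))
    have h3 := hlow xi th hth hle hxi
    linarith
  refine ContinuousLinearMap.opNorm_le_of_unit_norm (by positivity) fun v hv => ?_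
  rw [Real.norm_eq_abs, abs_le]
  refine ⟨?_, hone v hv⟩
  have := hone (-v) (by rwa [norm_neg])
  rw [map_neg] at this
  linarith

/-- The error terms in the relative entropy identity are dominated by the relative entropy. -/
structure ErrorBounds (psi : Xi → ℝ → ℝ) (C : ℝ) (xi : Xi) (th : ℝ) (xib : Xi) (thb : ℝ) :
    Prop where
  taylor : ‖dpsi psi (xi, th) - dpsi psi (xib, thb)
    - fderiv ℝ (dpsi psi) (xib, thb) ((xi, th) - (xib, thb))‖ ≤ C * relI psi xi th xib thb
  stress : ∀ i a, |(dxi psi xi th - dxi psi xib thb) (dPhi xi.1 i a - dPhi xib.1 i a)|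
    ≤ C * relI psi xi th xib thb
  kinematic : ∀ i a, ‖dPhi xi.1 i a - dPhi xib.1 i a‖ ^ 2 ≤ C * relI psi xi th xib thb
  energy : |ener psi xi th| ≤ C * (relI psi xi th xib thb + 1)

/-- Away from zero temperature and infinity the first three errors are at most quadratic in the
distance of the states, and the relative entropy is at least quadratic; the energy is simply
bounded. -/
theorem exists_errorBounds_slab {psi : Xi → ℝ → ℝ} (hpsi : SmoothEnergy psi) (hst : Stable psi)
    {a R : ℝ} (ha : 0 < a) : ∃ C, 0 ≤ C ∧ ∀ (xi : Xi) (th : ℝ), ‖xi‖ ≤ R → a ≤ th → th ≤ R →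
      ∀ xib thb, ‖xib‖ ≤ R → a ≤ thb → thb ≤ R → ErrorBounds psi C xi th xib thb := by
  obtain ⟨c, hc, hquad⟩ := relI_quadratic hpsi hst (R := R) ha
  obtain ⟨K, hK0, hK⟩ := taylor_upper isOpen_dom (contDiffOn_dpsi hpsi) (isCompact_slab a R)
    (convex_slab a R) (slab_subset_dom ha)
  obtain ⟨L, hL⟩ := (((contDiffOn_dxi hpsi).mono (slab_subset_dom ha)).of_le
    (by norm_num : (1 : WithTop ℕ∞) ≤ 2)).exists_lipschitzOnWith
    one_ne_zero (convex_slab a R) (isCompact_slab a R)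
  obtain ⟨B, hB⟩ := (isCompact_slab a R).exists_bound_of_continuousOn
    ((contDiffOn_ener hpsi).continuousOn.mono (slab_subset_dom ha))
  have hR' : 0 ≤ max R 0 := le_max_right _ _
  have hL0 : (0 : ℝ) ≤ L := L.2
  -- Taken from `norm_dPhi_sub_le` with ‖F + F̄‖ ≤ 2R; the maximum with 0 is there because R has no
  -- assumed sign.
  set P := 4 + 4 * max R 0
  have hP : 0 ≤ P := by positivity
  refine ⟨max (max (K / c) (L * P / c)) (max (P ^ 2 / c) (max B 0)),
    le_max_of_le_right (le_max_of_le_right (le_max_right _ _)), ?_⟩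
  intro xi th h1 h2 h3 xib thb hb1 hb2 hb3
  have hz := mem_slab.2 ⟨h1, h2, h3⟩
  have hzb := mem_slab.2 ⟨hb1, hb2, hb3⟩
  have hI := hquad _ hz _ hzb
  simp only at hI
  set I := relI psi xi th xib thb
  have hI0 : 0 ≤ I := relI_nonneg hpsi hst xi xib (ha.trans_le h2) (ha.trans_le hb2)
  set n := ‖(xi, th) - (xib, thb)‖
  have hn : 0 ≤ n := norm_nonneg _
  have hdiv : ∀ X : ℝ, 0 ≤ X → X * n ^ 2 ≤ X / c * I := fun X hX => by
    rw [div_mul_eq_mul_div, le_div_iff₀ hc]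
    nlinarith
  have hphi : ∀ i b, ‖dPhi xi.1 i b - dPhi xib.1 i b‖ ≤ P * n := fun i b => by
    refine (norm_dPhi_sub_le _ _ i b).trans ?_
    have e1 : ‖xi.1 - xib.1‖ ≤ n :=
      (norm_fst_le (xi - xib)).trans (norm_fst_le ((xi, th) - (xib, thb)))
    have e2 : ‖xi.1 + xib.1‖ ≤ 2 * max R 0 := by
      have := (norm_fst_le xi).trans h1
      have := (norm_fst_le xib).trans hb1
      have := le_max_left R 0
      exact (norm_add_le _ _).trans (by linarith)
    rw [mul_comm]
    have : 4 + 2 * ‖xi.1 + xib.1‖ ≤ P := by simp only [P]; linarith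
    gcongr
  refine ⟨?_, fun i b => ?_, fun i b => ?_, ?_⟩
  · refine (hK _ hz _ hzb).trans ((hdiv K hK0).trans ?_)
    gcongr
    exact (le_max_left _ _).trans (le_max_left _ _)
  · have e1 := hL.norm_sub_le hz hzb
    simp only at e1
    calc |(dxi psi xi th - dxi psi xib thb) (dPhi xi.1 i b - dPhi xib.1 i b)|
        ≤ (L * n) * (P * n) := ((dxi psi xi th - dxi psi xib thb).le_opNorm _).trans
          (mul_le_mul e1 (hphi i b) (norm_nonneg _) (by positivity))
      _ = L * P * n ^ 2 := by ring
      _ ≤ L * P / c * I := hdiv _ (by positivity)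
      _ ≤ _ := by
        gcongr
        exact (le_max_right _ _).trans (le_max_left _ _)
  · calc ‖dPhi xi.1 i b - dPhi xib.1 i b‖ ^ 2 ≤ (P * n) ^ 2 := by gcongr; exact hphi i b
      _ = P ^ 2 * n ^ 2 := by ring
      _ ≤ P ^ 2 / c * I := hdiv _ (by positivity)
      _ ≤ _ := by
        gcongr
        exact (le_max_left _ _).trans (le_max_right _ _)
  · set Q := max (max (K / c) (L * P / c)) (max (P ^ 2 / c) (max B 0))
    have hQB : B ≤ Q := (le_max_left B 0).trans ((le_max_right _ _).trans (le_max_right _ _))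
    have hQ0 : 0 ≤ Q := le_max_of_le_right (le_max_of_le_right (le_max_right _ _))
    have := hB _ hz
    simp only [Real.norm_eq_abs] at this
    nlinarith [mul_nonneg hQ0 hI0]

set_option maxHeartbeats 400000 in
/-- All error terms grow at most like the energy, where `D_ξ ψ̂` does. -/
theorem exists_errorBounds_of_coercive {psi : Xi → ℝ → ℝ} (hpsi : SmoothEnergy psi)
    {p q r l : ℝ} (hp : 4 ≤ p) (hq : 1 < q) (hr : 1 < r) (hl : 1 < l)
    (hg : GrowthConditions psi p q r l) {M d : ℝ} (hM : 0 < M) (hd : 0 < d) {c K : ℝ} (hc : 0 < c)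
    (hK : 0 ≤ K) :
    ∃ C, 0 ≤ C ∧ ∀ (xi : Xi) (th : ℝ), 0 < th → ∀ xib thb, ‖xib‖ ≤ M → d ≤ thb → thb ≤ M →
      c * (1 + growthSize p q r l xi th) ≤ relI psi xi th xib thb →
      ‖dxi psi xi th‖ ≤ K * (1 + growthSize p q r l xi th) →
      (∀ i a, |dxi psi xi th (dPhi xi.1 i a - dPhi xib.1 i a)|
        ≤ K * (1 + growthSize p q r l xi th)) →
      ErrorBounds psi C xi th xib thb := by
  obtain ⟨c0, C0, hc0, hC0, he⟩ := hg.energy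
  obtain ⟨B, hB, hbd⟩ := exists_bound_slab hpsi (R := M) hd
  obtain ⟨C1, hC1, hphi⟩ := norm_dPhi_sub_sq_le (p := p) (q := q) (r := r) (l := l) hp hM.le
  set S := K + B + B * (1 + M) + B * (1 + C1) + C1 + C0 with hS
  have hS0 : 0 ≤ S := by positivity
  -- The constant for which |η̂(ξ,θ)| ≤ e·I, derived in `heta` below.
  set e := ((C0 + B + B * (1 + M)) / c + 1) / d with hee
  have he0 : 0 ≤ e := by positivity
  refine ⟨S / c + e, by positivity, ?_⟩
  intro xi th hth xib thb hb1 hb2 hb3 hI hdx hdxP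
  have hx := norm_xi_le_growthSize (p := p) (q := q) (r := r) (l := l) (by linarith) hq.le hr.le
    xi hth
  have ht := th_le_growthSize (p := p) (q := q) (r := r) (l := l) hl.le xi hth
  obtain ⟨b1, -, b3, b4, b5⟩ := hbd xib thb hb1 hb2 hb3
  have hen := he xi th hth
  have hk := hphi xi xib th hth hb1
  have hNn := growthSize_nonneg p q r l xi hth
  set N := growthSize p q r l xi th
  set I := relI psi xi th xib thb with hIdef
  have hen' : |ener psi xi th| ≤ C0 * (1 + N) := by
    rw [abs_le]
    constructor <;> linarith [mul_nonneg hc0.le hNn, mul_nonneg hC0.le hNn, hen.1, hen.2]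
  have hX1 : 1 ≤ 1 + N := by linarith
  generalize 1 + N = X at *
  have hX0 : 0 ≤ X := zero_le_one.trans hX1
  have hI0 : 0 ≤ I := (mul_nonneg hc.le hX0).trans hI
  have hle : ∀ T : ℝ, 0 ≤ T → T ≤ S → T * X ≤ (S / c + e) * I := fun T h0 hT => by
    have h1 : T * X ≤ S * X := by gcongr
    have h2 : S * X ≤ S / c * I := by
      rw [div_mul_eq_mul_div, le_div_iff₀ hc]
      linarith [mul_le_mul_of_nonneg_left hI hS0]
    linarith [mul_nonneg he0 hI0, add_mul (S / c) e I]
  have hMX := le_mul_of_one_le_right hM.le hX1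
  have hBX := le_mul_of_one_le_right hB hX1
  have p1 : 0 ≤ B * (1 + M) := by positivity
  have p2 : 0 ≤ B * (1 + C1) := by positivity
  have hxi : ‖xi - xib‖ ≤ (1 + M) * X := (norm_sub_le _ _).trans (by linarith)
  -- The coercive case includes small θ, where the growth conditions do not bound η̂. It is
  -- recovered from θ̄η̂ = ê − I − ψ̂(ξ̄,θ̄) − ψ̂_ξ(ξ̄,θ̄)(ξ − ξ̄) with θ̄ ≥ d: the relative entropy
  -- controls the entropy.
  have heta : |eta psi xi th| ≤ e * I := by
    have h1 : |dxi psi xib thb (xi - xib)| ≤ B * ((1 + M) * X) :=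
      ((dxi psi xib thb).le_opNorm _).trans (mul_le_mul b3 hxi (norm_nonneg _) hB)
    have h2 : thb * eta psi xi th
        = ener psi xi th - I - psi xib thb - dxi psi xib thb (xi - xib) := by
      rw [hIdef, relI_eq']; ring
    have h3 : d * |eta psi xi th| ≤ |thb * eta psi xi th| := by
      rw [abs_mul, abs_of_pos (hd.trans_le hb2)]
      gcongr
    have h4 : |thb * eta psi xi th| ≤ (C0 + B + B * (1 + M)) * X + I := by
      rw [h2]
      have := abs_le.1 hen'
      have := abs_le.1 b1
      have := abs_le.1 h1
      rw [abs_le]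
      constructor <;> linarith
    have h5 : (C0 + B + B * (1 + M)) * X ≤ (C0 + B + B * (1 + M)) / c * I := by
      rw [div_mul_eq_mul_div, le_div_iff₀ hc]
      have : 0 ≤ C0 + B + B * (1 + M) := by positivity
      linarith [mul_le_mul_of_nonneg_left hI this]
    rw [hee, div_mul_eq_mul_div, le_div_iff₀ hd]
    linarith
  have hdp : ‖dpsi psi (xi, th)‖ ≤ K * X + e * I := by
    refine ContinuousLinearMap.opNorm_le_bound _ (by positivity) fun v => ?_
    have e1 : dpsi psi (xi, th) v = dxi psi xi th v.1 - v.2 * eta psi xi th :=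
      dpsi_apply hpsi hth v.1 v.2
    have e2 : |dxi psi xi th v.1| ≤ K * X * ‖v‖ :=
      ((dxi psi xi th).le_opNorm _).trans
        (mul_le_mul hdx (norm_fst_le v) (norm_nonneg _) (by positivity))
    have e3 : |v.2 * eta psi xi th| ≤ e * I * ‖v‖ := by
      rw [abs_mul, mul_comm]
      exact mul_le_mul heta (norm_snd_le v) (abs_nonneg _) (by positivity)
    rw [e1, Real.norm_eq_abs]
    exact (abs_sub _ _).trans (by linarith)
  refine ⟨?_, fun i a => ?_, fun i a => ?_, ?_⟩
  · have hz : ‖(xi, th) - (xib, thb)‖ ≤ (1 + M) * X := by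
      refine max_le hxi ?_
      rw [Prod.snd_sub, Real.norm_eq_abs, abs_le]
      constructor <;> linarith
    have h1 : ‖fderiv ℝ (dpsi psi) (xib, thb) ((xi, th) - (xib, thb))‖ ≤ B * ((1 + M) * X) :=
      (ContinuousLinearMap.le_opNorm _ _).trans (mul_le_mul b5 hz (norm_nonneg _) hB)
    have h2 : (K + B + B * (1 + M)) * X ≤ S / c * I := by
      rw [div_mul_eq_mul_div, le_div_iff₀ hc]
      have h3 : (K + B + B * (1 + M)) * X ≤ S * X := by
        gcongr
        linarith
      linarith [mul_le_mul_of_nonneg_left hI hS0, mul_le_mul_of_nonneg_right h3 hc.le]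
    have h3 := norm_sub_le (dpsi psi (xi, th) - dpsi psi (xib, thb))
      (fderiv ℝ (dpsi psi) (xib, thb) ((xi, th) - (xib, thb)))
    have h4 := norm_sub_le (dpsi psi (xi, th)) (dpsi psi (xib, thb))
    linarith [add_mul (S / c) e I]
  · rw [_root_.sub_apply]
    have h1 : |dxi psi xib thb (dPhi xi.1 i a - dPhi xib.1 i a)| ≤ B * (1 + C1) * X := by
      refine ((dxi psi xib thb).le_opNorm _).trans ?_
      rw [mul_assoc]
      refine mul_le_mul b3 ?_ (norm_nonneg _) hB
      -- Only the square of the difference is bounded, and x ≤ x² + 1/4 reduces the first power to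
      -- it.
      linarith [hk i a, sq_nonneg (‖dPhi xi.1 i a - dPhi xib.1 i a‖ - 1 / 2)]
    have h2 := abs_sub (dxi psi xi th (dPhi xi.1 i a - dPhi xib.1 i a))
      (dxi psi xib thb (dPhi xi.1 i a - dPhi xib.1 i a))
    have h3 := hle (K + B * (1 + C1)) (by positivity) (by linarith)
    have h4 := hdxP i a
    linarith
  · exact (hk i a).trans (hle C1 hC1 (by linarith))
  · have h1 := hle C0 hC0.le (by linarith)
    have : 0 ≤ S / c + e := by positivity
    linarith

/-- The relative entropy dominates all error terms, uniformly for `Ū` in a compact set. -/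
theorem exists_errorBounds {psi : Xi → ℝ → ℝ} (hpsi : SmoothEnergy psi) (hst : Stable psi)
    {p q r l : ℝ} (hp : 4 ≤ p) (hq : 1 < q) (hr : 1 < r) (hl : 1 < l)
    (hg : GrowthConditions psi p q r l) {M d : ℝ} (hM : 0 < M) (hd : 0 < d) :
    ∃ C, 0 ≤ C ∧ ∀ (xi : Xi) (th : ℝ), 0 < th → ∀ xib thb, ‖xib‖ ≤ M → d ≤ thb → thb ≤ M →
      ErrorBounds psi C xi th xib thb := by
  obtain ⟨R1, c1, hc1, hlarge⟩ := exists_relI_ge_of_large hpsi hp hq hr hg hM hd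
  obtain ⟨R2, K1, hK1, hdx⟩ := exists_dxi_le_of_large hp hg hM.le
  set R := max (max R1 R2) 1
  have hR1 : 1 ≤ R := le_max_right _ _
  -- If N ≤ R then ‖ξ‖ and θ are at most 1 + R; adding M and d makes the ball contain the states of
  -- Ū and the interval of small temperatures.
  set R' := 1 + R + M + d
  obtain ⟨c2, hc2, hsmall⟩ := exists_relI_ge_of_small hpsi hst (M := M) (R := R') hd
    (by simp only [R']; linarith)
  obtain ⟨K2, hK2, hdx2⟩ := exists_dxi_le_of_small hpsi hst hg (R := R') hd
    (by simp only [R']; linarith)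
  obtain ⟨C1, hC1, hphi⟩ := norm_dPhi_sub_sq_le (p := p) (q := q) (r := r) (l := l) hp hM.le
  -- The first entry is coercivity for large N, halved so that N dominates 1 + N when N ≥ 1. The
  -- second spreads the lower bound c2 for small θ over 1 + N ≤ 1 + R.
  set c := min (c1 / 2) (c2 / (1 + R))
  have hc : 0 < c := lt_min (by positivity) (by positivity)
  set K := max K1 (K2 * (1 + C1))
  have hKK : K2 ≤ K := le_trans (by nlinarith) (le_max_right K1 _)
  obtain ⟨A, hA, hcoer⟩ := exists_errorBounds_of_coercive hpsi hp hq hr hl hg hM hd (K := K) hc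
    (hK1.trans (le_max_left _ _))
  obtain ⟨A', hA', hslab⟩ := exists_errorBounds_slab hpsi hst (a := d / 2) (R := R') (by positivity)
  have hmono : ∀ {C C' : ℝ} (_ : C ≤ C') {xi : Xi} {th : ℝ} (_ : 0 < th) {xib : Xi} {thb : ℝ}
      (_ : 0 < thb), ErrorBounds psi C xi th xib thb → ErrorBounds psi C' xi th xib thb := by
    intro C C' h xi th hth xib thb hthb hE
    have hI := relI_nonneg hpsi hst xi xib hth hthb
    exact ⟨hE.1.trans (by gcongr), fun i a => (hE.2 i a).trans (by gcongr),
      fun i a => (hE.3 i a).trans (by gcongr), hE.4.trans (by gcongr)⟩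
  refine ⟨max A A', le_max_of_le_left hA, fun xi th hth xib thb hb1 hb2 hb3 => ?_⟩
  have hNn := growthSize_nonneg p q r l xi hth
  -- Three regimes: N large; N bounded with θ ≤ d/2; N bounded with θ ≥ d/2. The first two are
  -- coercive, the third is compact.
  rcases le_total R (growthSize p q r l xi th) with hN | hN
  · refine hmono (le_max_left _ _) hth (hd.trans_le hb2)
      (hcoer xi th hth xib thb hb1 hb2 hb3 ?_ ?_ fun i a => ?_)
    · refine le_trans ?_ (hlarge xi th hth
        (((le_max_left _ _).trans (le_max_left _ _)).trans hN) xib thb hb1 hb2 hb3)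
      have := min_le_left (c1 / 2) (c2 / (1 + R))
      calc c * (1 + growthSize p q r l xi th) ≤ c1 / 2 * (1 + growthSize p q r l xi th) := by gcongr
        _ ≤ _ := by nlinarith
    · refine (hdx xi th hth (((le_max_right _ _).trans (le_max_left _ _)).trans hN)).1.trans ?_
      gcongr
      exact le_max_left _ _
    · refine ((hdx xi th hth (((le_max_right _ _).trans (le_max_left _ _)).trans hN)).2 xib hb1
        i a).trans ?_
      gcongr
      exact le_max_left _ _
  · have hx := norm_xi_le_growthSize (p := p) (q := q) (r := r) (l := l) (by linarith) hq.le hr.le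
      xi hth
    have ht := th_le_growthSize (p := p) (q := q) (r := r) (l := l) hl.le xi hth
    have hxR : ‖xi‖ ≤ R' := by simp only [R']; linarith
    rcases le_total th (d / 2) with htd | htd
    · have h2 := hdx2 xi th hth (by linarith) hxR
      have hX1 : 1 ≤ 1 + growthSize p q r l xi th := by linarith
      refine hmono (le_max_left _ _) hth (hd.trans_le hb2)
        (hcoer xi th hth xib thb hb1 hb2 hb3 ?_ ?_ fun i a => ?_)
      · refine le_trans ?_ (hsmall xi th hth htd hxR xib thb hb1 hb2 hb3)
        calc c * (1 + growthSize p q r l xi th) ≤ c2 / (1 + R) * (1 + R) := by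
              gcongr
              exact min_le_right _ _
          _ = c2 := by field_simp
      · refine h2.trans (hKK.trans ?_)
        have : 0 ≤ K := hK2.trans hKK
        nlinarith
      · have h3 := hphi xi xib th hth hb1 i a
        calc |dxi psi xi th (dPhi xi.1 i a - dPhi xib.1 i a)|
            ≤ K2 * ((1 + C1) * (1 + growthSize p q r l xi th)) := by
              refine ((dxi psi xi th).le_opNorm _).trans ?_
              refine mul_le_mul h2 ?_ (norm_nonneg _) hK2
              linarith [sq_nonneg (‖dPhi xi.1 i a - dPhi xib.1 i a‖ - 1 / 2)]
          _ = K2 * (1 + C1) * (1 + growthSize p q r l xi th) := by ring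
          _ ≤ _ := by
            gcongr
            exact le_max_right _ _
    · refine hmono (le_max_right _ _) hth (hd.trans_le hb2)
        (hslab xi th hxR htd (by simp only [R']; linarith) xib thb (by simp only [R']; linarith)
          (by linarith) (by simp only [R']; linarith))

end Thermo

end

noncomputable section

namespace Thermo

/-! ### Lipschitz thermomechanical fields -/

namespace PerLip

variable {E : Type*} [NormedAddCommGroup E] [NormedSpace ℝ E]
  {E' : Type*} [NormedAddCommGroup E'] [NormedSpace ℝ E'] {T : ℝ}

theorem contDiff_comp {f : ℝ → Vec3 → E} (hf : PerLip T f) {G : E → E'} (hG : ContDiff ℝ 1 G) :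
    PerLip T (fun t x => G (f t x)) :=
  hf.comp (hG.contDiffOn (s := univ)) convex_univ fun _ _ _ => mem_univ _

theorem add {f g : ℝ → Vec3 → E} (hf : PerLip T f) (hg : PerLip T g) :
    PerLip T (fun t x => f t x + g t x) :=
  (hf.prodMk hg).contDiff_comp (G := fun p : E × E => p.1 + p.2) (by fun_prop)

theorem sub {f g : ℝ → Vec3 → E} (hf : PerLip T f) (hg : PerLip T g) :
    PerLip T (fun t x => f t x - g t x) :=
  (hf.prodMk hg).contDiff_comp (G := fun p : E × E => p.1 - p.2) (by fun_prop)

theorem mul {f g : ℝ → Vec3 → ℝ} (hf : PerLip T f) (hg : PerLip T g) :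
    PerLip T (fun t x => f t x * g t x) :=
  (hf.prodMk hg).contDiff_comp (G := fun p : ℝ × ℝ => p.1 * p.2) (by fun_prop)

theorem clm_apply {f : ℝ → Vec3 → E →L[ℝ] E'} {g : ℝ → Vec3 → E} (hf : PerLip T f)
    (hg : PerLip T g) : PerLip T (fun t x => f t x (g t x)) :=
  (hf.prodMk hg).contDiff_comp (G := fun p : (E →L[ℝ] E') × E => p.1 p.2) (by fun_prop)

theorem const (c : E) : PerLip T (fun _ _ => c) where
  per _ _ _ _ := rfl
  lip := ⟨0, (LipschitzWith.const c).lipschitzOnWith⟩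

theorem sum {ι : Type*} (s : Finset ι) {f : ι → ℝ → Vec3 → E} (hf : ∀ i, PerLip T (f i)) :
    PerLip T (fun t x => ∑ i ∈ s, f i t x) := by
  classical
  induction s using Finset.induction_on with
  | empty => simpa using const (0 : E)
  | insert i s hi ih =>
    simp only [Finset.sum_insert hi]
    exact (hf i).add ih

end PerLip

/-- Admissible fields that are Lipschitz on `[0, T] × ℝ³`. -/
structure LipField (T : ℝ) (U : ThermoField) : Prop where
  xi : PerLip T U.xi
  v : PerLip T U.v
  th : PerLip T U.th
  th_pos : ∀ t ∈ Icc 0 T, ∀ x, 0 < U.th t x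

theorem IsStrongSolution.lipField {psi : Xi → ℝ → ℝ} {mu k : Mat3 → ℝ → ℝ} {T : ℝ} {U : ThermoField}
    (h : IsStrongSolution psi mu k T U) : LipField T U where
  xi := ⟨h.adm.xi_per, h.lip_xi⟩
  v := ⟨h.adm.v_per, h.lip_v⟩
  th := ⟨h.adm.th_per, h.lip_th⟩
  th_pos := h.adm.th_pos

theorem IsAdiabaticSolution.lipField {psi : Xi → ℝ → ℝ} {T : ℝ} {U : ThermoField}
    (h : IsAdiabaticSolution psi T U) : LipField T U where
  xi := .of_contDiffOn h.adm.xi_per h.smooth_xi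
  v := .of_contDiffOn h.adm.v_per h.smooth_v
  th := .of_contDiffOn h.adm.th_per h.smooth_th
  th_pos := h.adm.th_pos

/-- Differentiability of all components in time and in space. -/
structure DiffPt (U : ThermoField) (t : ℝ) (x : Vec3) : Prop where
  xi_t : DifferentiableAt ℝ (fun s => U.xi s x) t
  v_t : DifferentiableAt ℝ (fun s => U.v s x) t
  th_t : DifferentiableAt ℝ (fun s => U.th s x) t
  xi_x : DifferentiableAt ℝ (U.xi t) x
  v_x : DifferentiableAt ℝ (U.v t) x
  th_x : DifferentiableAt ℝ (U.th t) x

section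

variable {E : Type*} [NormedAddCommGroup E] [NormedSpace ℝ E]

theorem differentiableAt_time {f : ℝ → Vec3 → E} {t : ℝ} {x : Vec3}
    (h : DifferentiableAt ℝ (fun z : ℝ × Vec3 => f z.1 z.2) (t, x)) :
    DifferentiableAt ℝ (fun s => f s x) t :=
  h.comp (f := fun s : ℝ => (s, x)) t (by fun_prop)

theorem differentiableAt_space {f : ℝ → Vec3 → E} {t : ℝ} {x : Vec3}
    (h : DifferentiableAt ℝ (fun z : ℝ × Vec3 => f z.1 z.2) (t, x)) :
    DifferentiableAt ℝ (f t) x :=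
  h.comp (f := fun y : Vec3 => (t, y)) x (by fun_prop)

end

theorem DiffPt.of_joint {U : ThermoField} {t : ℝ} {x : Vec3}
    (h1 : DifferentiableAt ℝ (fun z : ℝ × Vec3 => U.xi z.1 z.2) (t, x))
    (h2 : DifferentiableAt ℝ (fun z : ℝ × Vec3 => U.v z.1 z.2) (t, x))
    (h3 : DifferentiableAt ℝ (fun z : ℝ × Vec3 => U.th z.1 z.2) (t, x)) : DiffPt U t x :=
  ⟨differentiableAt_time h1, differentiableAt_time h2, differentiableAt_time h3,
    differentiableAt_space h1, differentiableAt_space h2, differentiableAt_space h3⟩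

theorem LipField.ae_diffPt {T : ℝ} {U : ThermoField} (h : LipField T U) :
    ∀ᵐ t, t ∈ Ioo 0 T → ∀ᵐ x, DiffPt U t x := by
  filter_upwards [h.xi.ae_differentiableAt, h.v.ae_differentiableAt, h.th.ae_differentiableAt]
    with t h1 h2 h3 ht
  filter_upwards [h1 ht, h2 ht, h3 ht] with x k1 k2 k3
  exact .of_joint k1 k2 k3

theorem IsAdiabaticSolution.diffPt {psi : Xi → ℝ → ℝ} {T : ℝ} {U : ThermoField}
    (h : IsAdiabaticSolution psi T U) {t : ℝ} (ht : t ∈ Ioo 0 T) (x : Vec3) : DiffPt U t x := by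
  have hn : Icc 0 T ×ˢ univ ∈ 𝓝 (t, x) := prod_mem_nhds (Icc_mem_nhds ht.1 ht.2) univ_mem
  exact .of_joint ((h.smooth_xi.contDiffAt hn).differentiableAt one_ne_zero)
    ((h.smooth_v.contDiffAt hn).differentiableAt one_ne_zero)
    ((h.smooth_th.contDiffAt hn).differentiableAt one_ne_zero)

section Fields

variable {psi : Xi → ℝ → ℝ} {T : ℝ} {U : ThermoField} {E : Type*} [NormedAddCommGroup E]
  [NormedSpace ℝ E]

theorem LipField.comp (h : LipField T U) {G : Xi × ℝ → E} (hG : ContDiffOn ℝ 2 G dom) :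
    PerLip T (fun t x => G (U.xi t x, U.th t x)) :=
  (h.xi.prodMk h.th).comp (hG.of_le (by norm_num)) convex_dom
    fun t ht x => mem_dom (h.th_pos t ht x)

theorem LipField.v_apply (h : LipField T U) (i : Fin 3) : PerLip T (fun t x => U.v t x i) :=
  h.v.contDiff_comp (G := fun w : Vec3 => w i) (by fun_prop)

theorem LipField.dPhi (h : LipField T U) (i a : Fin 3) :
    PerLip T (fun t x => dPhi (U.F t x) i a) :=
  h.xi.contDiff_comp (G := fun w : Xi => Thermo.dPhi w.1 i a)
    ((contDiff_dPhi i a).comp contDiff_fst)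

theorem DiffPt.comp_x {t : ℝ} {x : Vec3} (h : DiffPt U t x) (hpos : 0 < U.th t x)
    {G : Xi × ℝ → E} (hG : ContDiffOn ℝ 2 G dom) :
    DifferentiableAt ℝ (fun y => G (U.xi t y, U.th t y)) x :=
  ((hG.contDiffAt (isOpen_dom.mem_nhds (mem_dom hpos))).differentiableAt (by norm_num)).comp
    (f := fun y => (U.xi t y, U.th t y)) x (h.xi_x.prodMk h.th_x)

theorem DiffPt.comp_t {t : ℝ} {x : Vec3} (h : DiffPt U t x) (hpos : 0 < U.th t x)
    {G : Xi × ℝ → E} (hG : ContDiffOn ℝ 2 G dom) :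
    DifferentiableAt ℝ (fun s => G (U.xi s x, U.th s x)) t :=
  ((hG.contDiffAt (isOpen_dom.mem_nhds (mem_dom hpos))).differentiableAt (by norm_num)).comp
    (f := fun s => (U.xi s x, U.th s x)) t (h.xi_t.prodMk h.th_t)

end Fields

/-! ### Divergence identities -/

section Pd

variable {E : Type*} [NormedAddCommGroup E] [NormedSpace ℝ E]
  {E' : Type*} [NormedAddCommGroup E'] [NormedSpace ℝ E'] {x : Vec3} (a : Fin 3)

theorem pd_clm_apply {X : Vec3 → E →L[ℝ] E'} {P : Vec3 → E} (hX : DifferentiableAt ℝ X x)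
    (hP : DifferentiableAt ℝ P x) :
    pd a (fun y => X y (P y)) x = pd a X x (P x) + X x (pd a P x) := by
  simp [pd, fderiv_clm_apply hX hP, add_comm]

theorem pd_smul {c : Vec3 → ℝ} {P : Vec3 → E} (hc : DifferentiableAt ℝ c x)
    (hP : DifferentiableAt ℝ P x) :
    pd a (fun y => c y • P y) x = pd a c x • P x + c x • pd a P x := by
  simp [pd, fderiv_fun_smul hc hP, add_comm]

theorem pd_mul {c e : Vec3 → ℝ} (hc : DifferentiableAt ℝ c x) (he : DifferentiableAt ℝ e x) :
    pd a (fun y => c y * e y) x = pd a c x * e x + c x * pd a e x := by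
  simpa only [smul_eq_mul] using pd_smul a hc he

theorem pd_sub {f g : Vec3 → E} (hf : DifferentiableAt ℝ f x) (hg : DifferentiableAt ℝ g x) :
    pd a (fun y => f y - g y) x = pd a f x - pd a g x := by
  simp [pd, fderiv_fun_sub hf hg]

theorem pd_sum {ι : Type*} (s : Finset ι) {f : ι → Vec3 → E}
    (hf : ∀ i ∈ s, DifferentiableAt ℝ (f i) x) :
    pd a (fun y => ∑ i ∈ s, f i y) x = ∑ i ∈ s, pd a (f i) x := by
  simp [pd, fderiv_fun_sum hf]

end Pd

section Piola

variable {U : ThermoField} {t : ℝ} {x : Vec3}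

theorem DiffPt.F_x (h : DiffPt U t x) : DifferentiableAt ℝ (U.F t) x := h.xi_x.fst

theorem DiffPt.v_apply_x (h : DiffPt U t x) (i : Fin 3) :
    DifferentiableAt ℝ (fun y => U.v t y i) x := differentiableAt_pi.1 h.v_x i

theorem DiffPt.dPhi_x (h : DiffPt U t x) (i a : Fin 3) :
    DifferentiableAt ℝ (fun y => dPhi (U.F t y) i a) x :=
  ((contDiff_dPhi (n := 1) i a).differentiable one_ne_zero _).comp x h.F_x

/-- The Piola identities at a point: the chain rule reduces them to an algebraic identity for ∇F
with the symmetry that vanishing curl provides. Pointwise differentiability of F is enough. -/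
theorem sum_pd_dPhi_eq_zero (h : DiffPt U t x) (hc : CurlFree U t x) (i : Fin 3) :
    ∑ a, pd a (fun y => dPhi (U.F t y) i a) x = 0 := by
  have h1 : ∀ a, pd a (fun y => dPhi (U.F t y) i a) x
      = fderiv ℝ (fun F => dPhi F i a) (U.F t x) (pd a (U.F t) x) := fun a => by
    have := fderiv_comp x ((contDiff_dPhi (n := 1) i a).differentiable one_ne_zero (U.F t x)) h.F_x
    exact congrArg (fun L => L (Pi.single a 1)) this
  have h2 : ∀ a j b, pd a (fun y => U.F t y j b) x = pd a (U.F t) x j b := fun a j b => by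
    have h3 := ((ContinuousLinearMap.proj (R := ℝ) b).comp
      (ContinuousLinearMap.proj (R := ℝ) (φ := fun _ : Fin 3 => Fin 3 → ℝ) j)).hasFDerivAt.comp x
      h.F_x.hasFDerivAt
    exact congrArg (fun L => L (Pi.single a 1)) h3.fderiv
  simp only [h1]
  refine sum_fderiv_dPhi_eq_zero _ _ (fun j a b => ?_) i
  rw [← h2, ← h2]
  exact hc j a b

theorem kinematicDiv_eq (h : DiffPt U t x) (hc : CurlFree U t x) :
    kinematicDiv U t x = ∑ i, ∑ a, pd a (fun y => U.v t y i) x • dPhi (U.F t x) i a := by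
  have h1 : ∀ a, pd a (fun y => ∑ i, U.v t y i • dPhi (U.F t y) i a) x
      = ∑ i, (pd a (fun y => U.v t y i) x • dPhi (U.F t x) i a
        + U.v t x i • pd a (fun y => dPhi (U.F t y) i a) x) := fun a => by
    rw [pd_sum a _ fun i _ => (h.v_apply_x i).fun_smul (h.dPhi_x i a)]
    exact Finset.sum_congr rfl fun i _ => pd_smul a (h.v_apply_x i) (h.dPhi_x i a)
  unfold kinematicDiv
  simp only [h1]
  rw [Finset.sum_comm]
  refine Finset.sum_congr rfl fun i _ => ?_
  rw [Finset.sum_add_distrib, ← Finset.smul_sum, sum_pd_dPhi_eq_zero h hc, smul_zero, add_zero]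

theorem sum_pd_clm_dPhi (h : DiffPt U t x) (hc : CurlFree U t x) {Y : Vec3 → Xi →L[ℝ] ℝ}
    (hY : DifferentiableAt ℝ Y x) (i : Fin 3) :
    ∑ a, pd a (fun y => Y y (dPhi (U.F t y) i a)) x = ∑ a, pd a Y x (dPhi (U.F t x) i a) := by
  simp only [fun a => pd_clm_apply a hY (h.dPhi_x i a)]
  rw [Finset.sum_add_distrib, ← map_sum, sum_pd_dPhi_eq_zero h hc, map_zero, add_zero]

theorem sum_pd_flux (h : DiffPt U t x) (hc : CurlFree U t x) {Y : Vec3 → Xi →L[ℝ] ℝ}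
    (hY : DifferentiableAt ℝ Y x) {u : Vec3 → Vec3}
    (hu : ∀ i, DifferentiableAt ℝ (fun y => u y i) x) :
    ∑ a, pd a (fun y => ∑ i, Y y (dPhi (U.F t y) i a) * u y i) x
      = ∑ i, ∑ a, (pd a Y x (dPhi (U.F t x) i a) * u x i
        + Y x (dPhi (U.F t x) i a) * pd a (fun y => u y i) x) := by
  have hYP : ∀ i a, DifferentiableAt ℝ (fun y => Y y (dPhi (U.F t y) i a)) x := fun i a =>
    hY.clm_apply (h.dPhi_x i a)
  have h1 : ∀ a, pd a (fun y => ∑ i, Y y (dPhi (U.F t y) i a) * u y i) x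
      = ∑ i, (pd a (fun y => Y y (dPhi (U.F t y) i a)) x * u x i
        + Y x (dPhi (U.F t x) i a) * pd a (fun y => u y i) x) := fun a => by
    rw [pd_sum a _ fun i _ => (hYP i a).fun_mul (hu i)]
    exact Finset.sum_congr rfl fun i _ => pd_mul a (hYP i a) (hu i)
  simp only [h1]
  rw [Finset.sum_comm]
  refine Finset.sum_congr rfl fun i _ => ?_
  rw [Finset.sum_add_distrib, Finset.sum_add_distrib, ← Finset.sum_mul, ← Finset.sum_mul,
    sum_pd_clm_dPhi h hc hY]

end Piola

end Thermo

end

noncomputable section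

namespace Thermo

/-! ### The relative entropy identity -/

theorem vnorm_sq (v : Vec3) : vnorm v ^ 2 = ∑ i, v i ^ 2 :=
  Real.sq_sqrt (Finset.sum_nonneg fun _ _ => sq_nonneg _)

theorem relEntropy_eq_relI (psi : Xi → ℝ → ℝ) (xi : Xi) (v : Vec3) (th : ℝ) (xib : Xi) (vb : Vec3)
    (thb : ℝ) : relEntropy psi xi v th xib vb thb
      = relI psi xi th xib thb + 1 / 2 * ∑ i, (v i - vb i) ^ 2 := by
  unfold relEntropy relI
  rw [vnorm_sq]
  simp only [Pi.sub_apply]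
  ring

/-- Each quantity of U here (energy, entropy, ξ, v) obeys a balance law and enters linearly, so the
derivative in time of the relative entropy needs no derivative of θ or ∇v beyond those laws. -/
theorem relEntropy_eq (psi : Xi → ℝ → ℝ) (U Ub : ThermoField) (t : ℝ) (x : Vec3) :
    relEntropy psi (U.xi t x) (U.v t x) (U.th t x) (Ub.xi t x) (Ub.v t x) (Ub.th t x)
      = totalEnergy psi U t x - Ub.th t x * eta psi (U.xi t x) (U.th t x)
        - psi (Ub.xi t x) (Ub.th t x) - dxi psi (Ub.xi t x) (Ub.th t x) (U.xi t x - Ub.xi t x)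
        + ∑ i, (1 / 2 * Ub.v t x i ^ 2 - U.v t x i * Ub.v t x i) := by
  rw [relEntropy_eq_relI, relI_eq', totalEnergy, vnorm_sq]
  simp only [Fin.sum_univ_three]
  ring

theorem dpsi_symm {psi : Xi → ℝ → ℝ} (hpsi : SmoothEnergy psi) {z : Xi × ℝ} (hz : z ∈ dom)
    (u w : Xi × ℝ) : fderiv ℝ (dpsi psi) z u w = fderiv ℝ (dpsi psi) z w u := by
  have h : ContDiffAt ℝ 3 (fun z : Xi × ℝ => psi z.1 z.2) z :=
    hpsi.contDiffAt (isOpen_dom.mem_nhds hz)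
  exact (h.isSymmSndFDerivAt (by simp; norm_num)) u w

section Pointwise

variable {psi : Xi → ℝ → ℝ} {U Ub : ThermoField} {t : ℝ} {x : Vec3}

theorem DiffPt.hasDerivAt_pair (h : DiffPt U t x) :
    HasDerivAt (fun s => (U.xi s x, U.th s x))
      (deriv (fun s => U.xi s x) t, deriv (fun s => U.th s x) t) t :=
  h.xi_t.hasDerivAt.prodMk h.th_t.hasDerivAt

theorem DiffPt.hasDerivAt_comp {E : Type*} [NormedAddCommGroup E] [NormedSpace ℝ E]
    {G : Xi × ℝ → E} {G' : Xi × ℝ →L[ℝ] E} (h : DiffPt U t x)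
    (hG : HasFDerivAt G G' (U.xi t x, U.th t x)) :
    HasDerivAt (fun s => G (U.xi s x, U.th s x))
      (G' (deriv (fun s => U.xi s x) t, deriv (fun s => U.th s x) t)) t :=
  hG.comp_hasDerivAt t h.hasDerivAt_pair

theorem DiffPt.hasDerivAt_dpsi_apply (hpsi : SmoothEnergy psi) (h : DiffPt U t x)
    (hpos : 0 < U.th t x) {w : ℝ → Xi × ℝ} {w' : Xi × ℝ} (hw : HasDerivAt w w' t) :
    HasDerivAt (fun s => dpsi psi (U.xi s x, U.th s x) (w s))
      (fderiv ℝ (dpsi psi) (U.xi t x, U.th t x)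
        (deriv (fun s => U.xi s x) t, deriv (fun s => U.th s x) t) (w t)
        + dpsi psi (U.xi t x, U.th t x) w') t :=
  (h.hasDerivAt_comp (hasFDerivAt_dpsi hpsi hpos)).clm_apply hw

theorem DiffPt.v_apply_t (h : DiffPt U t x) (i : Fin 3) :
    DifferentiableAt ℝ (fun s => U.v s x i) t := differentiableAt_pi.1 h.v_t i

theorem DiffPt.eta_t (hpsi : SmoothEnergy psi) (h : DiffPt U t x) (hpos : 0 < U.th t x) :
    DifferentiableAt ℝ (fun s => eta psi (U.xi s x) (U.th s x)) t :=
  h.comp_t hpos (G := fun z => eta psi z.1 z.2) (contDiffOn_eta hpsi)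

theorem DiffPt.totalEnergy_t (hpsi : SmoothEnergy psi) (h : DiffPt U t x) (hpos : 0 < U.th t x) :
    DifferentiableAt ℝ (fun s => totalEnergy psi U s x) t := by
  have h1 : DifferentiableAt ℝ (fun s => ener psi (U.xi s x) (U.th s x)) t :=
    h.comp_t hpos (G := fun z => ener psi z.1 z.2) (contDiffOn_ener hpsi)
  unfold totalEnergy
  simp only [vnorm_sq]
  exact ((DifferentiableAt.fun_sum fun i _ => (h.v_apply_t i).fun_pow 2).const_mul _).add h1

theorem DiffPt.eta_deriv (hpsi : SmoothEnergy psi) (h : DiffPt U t x) (hpos : 0 < U.th t x) :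
    deriv (fun s => eta psi (U.xi s x) (U.th s x)) t
      = - fderiv ℝ (dpsi psi) (U.xi t x, U.th t x)
        (deriv (fun s => U.xi s x) t, deriv (fun s => U.th s x) t) (0, 1) := by
  have h1 := h.hasDerivAt_dpsi_apply hpsi hpos (hasDerivAt_const t ((0 : Xi), (1 : ℝ)))
  rw [map_zero, add_zero] at h1
  refine (h1.neg.congr_of_eventuallyEq ?_).deriv
  filter_upwards [h.th_t.continuousAt.eventually (lt_mem_nhds hpos)] with s hs
  exact eta_eq hpsi hs

/-- Groups the terms with derivatives of Ū so that the Taylor remainder of `dpsi` at the smooth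
state appears. Conservation of the entropy of Ū is what makes this grouping possible. -/
theorem hasDerivAt_relEntropy (hpsi : SmoothEnergy psi) (h : DiffPt U t x) (hb : DiffPt Ub t x)
    (hpos : 0 < U.th t x) (hposb : 0 < Ub.th t x)
    (hent : deriv (fun s => eta psi (Ub.xi s x) (Ub.th s x)) t = 0) :
    HasDerivAt (fun s => relEntropy psi (U.xi s x) (U.v s x) (U.th s x)
        (Ub.xi s x) (Ub.v s x) (Ub.th s x))
      (deriv (fun s => totalEnergy psi U s x) t
        - Ub.th t x * deriv (fun s => eta psi (U.xi s x) (U.th s x)) t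
        - dxi psi (Ub.xi t x) (Ub.th t x) (deriv (fun s => U.xi s x) t)
        + ((dpsi psi (U.xi t x, U.th t x) - dpsi psi (Ub.xi t x, Ub.th t x)
            - fderiv ℝ (dpsi psi) (Ub.xi t x, Ub.th t x)
              ((U.xi t x, U.th t x) - (Ub.xi t x, Ub.th t x)))
            (deriv (fun s => Ub.xi s x) t, deriv (fun s => Ub.th s x) t)
          - (dxi psi (U.xi t x) (U.th t x) - dxi psi (Ub.xi t x) (Ub.th t x))
            (deriv (fun s => Ub.xi s x) t))
        - ∑ i, ((U.v t x i - Ub.v t x i) * deriv (fun s => Ub.v s x i) t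
          + Ub.v t x i * deriv (fun s => U.v s x i) t)) t := by
  have hE := (h.totalEnergy_t hpsi hpos).hasDerivAt
  have hη := hb.th_t.hasDerivAt.mul (h.eta_t hpsi hpos).hasDerivAt
  have hψ : HasDerivAt (fun s => psi (Ub.xi s x) (Ub.th s x)) (dpsi psi (Ub.xi t x, Ub.th t x)
      (deriv (fun s => Ub.xi s x) t, deriv (fun s => Ub.th s x) t)) t :=
    hb.hasDerivAt_comp (G := fun z => psi z.1 z.2) (hasFDerivAt_psi hpsi hposb)
  have hΔ : HasDerivAt (fun s => (U.xi s x - Ub.xi s x, (0 : ℝ)))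
      (deriv (fun s => U.xi s x) t - deriv (fun s => Ub.xi s x) t, (0 : ℝ)) t :=
    (h.xi_t.hasDerivAt.sub hb.xi_t.hasDerivAt).prodMk (hasDerivAt_const t 0)
  have hd0 := hb.hasDerivAt_dpsi_apply hpsi hposb hΔ
  have hev : (fun s => dxi psi (Ub.xi s x) (Ub.th s x) (U.xi s x - Ub.xi s x)) =ᶠ[𝓝 t]
      fun s => dpsi psi (Ub.xi s x, Ub.th s x) (U.xi s x - Ub.xi s x, 0) := by
    filter_upwards [hb.th_t.continuousAt.eventually (lt_mem_nhds hposb)] with s hs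
    exact dxi_apply hpsi hs _
  have hd := hd0.congr_of_eventuallyEq hev
  have hv : HasDerivAt (fun s => ∑ i, (1 / 2 * Ub.v s x i ^ 2 - U.v s x i * Ub.v s x i))
      (∑ i, (Ub.v t x i * deriv (fun s => Ub.v s x i) t
        - (deriv (fun s => U.v s x i) t * Ub.v t x i
          + U.v t x i * deriv (fun s => Ub.v s x i) t))) t := by
    refine HasDerivAt.fun_sum fun i _ => ?_
    have h1 := (((hb.v_apply_t i).hasDerivAt.pow 2).const_mul (1 / 2 : ℝ)).sub
      ((h.v_apply_t i).hasDerivAt.mul (hb.v_apply_t i).hasDerivAt)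
    convert! h1 using 1
    simp
    ring
  have key := (((hE.sub hη).sub hψ).sub hd).add hv
  have hfun : (fun s => relEntropy psi (U.xi s x) (U.v s x) (U.th s x)
      (Ub.xi s x) (Ub.v s x) (Ub.th s x)) = _ := funext fun s => relEntropy_eq psi U Ub s x
  rw [hfun]
  refine HasDerivAt.congr_deriv key ?_
  set ξ' := deriv (fun s => Ub.xi s x) t
  set θ' := deriv (fun s => Ub.th s x) t
  have e0 := hb.eta_deriv hpsi hposb
  rw [hent] at e0
  have e1 := dpsi_apply hpsi hposb (xi := Ub.xi t x) ξ' θ'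
  have e2 := dpsi_apply hpsi hpos (xi := U.xi t x) ξ' θ'
  have e3 := dpsi_symm hpsi (mem_dom (xi := Ub.xi t x) hposb) (ξ', θ')
    ((U.xi t x, U.th t x) - (Ub.xi t x, Ub.th t x))
  have e4 : ((U.xi t x, U.th t x) - (Ub.xi t x, Ub.th t x) : Xi × ℝ)
      = (U.xi t x - Ub.xi t x, 0) + (U.th t x - Ub.th t x) • ((0 : Xi), (1 : ℝ)) := by simp
  -- The derivative of ψ̂_ξ along Ū is tested with (ξ − ξ̄, 0), the Taylor remainder with the full
  -- difference. The missing component (0, θ − θ̄) contributes a multiple of ∂_t η̂(Ū) = 0, and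
  -- symmetry of the second derivative exchanges the arguments.
  have e5 : fderiv ℝ (dpsi psi) (Ub.xi t x, Ub.th t x) (ξ', θ') (U.xi t x - Ub.xi t x, 0)
      = fderiv ℝ (dpsi psi) (Ub.xi t x, Ub.th t x)
        ((U.xi t x, U.th t x) - (Ub.xi t x, Ub.th t x)) (ξ', θ') := by
    rw [← e3, e4, map_add, map_smul, smul_eq_mul]
    linear_combination (Ub.th t x - U.th t x) * e0
  have e6 := dxi_apply hpsi hposb (xi := Ub.xi t x) (deriv (fun s => U.xi s x) t - ξ')
  rw [map_sub] at e6
  simp only [_root_.sub_apply]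
  rw [e5, e1, e2, ← e6]
  simp only [Fin.sum_univ_three]
  ring

/-- The quadratic error terms in the relative entropy identity. -/
def relError (psi : Xi → ℝ → ℝ) (U Ub : ThermoField) (t : ℝ) (x : Vec3) : ℝ :=
  (∑ i, ∑ a, pd a (fun y => Ub.v t y i) x
      * (dxi psi (U.xi t x) (U.th t x) - dxi psi (Ub.xi t x) (Ub.th t x))
        (dPhi (U.F t x) i a - dPhi (Ub.F t x) i a))
    + (∑ i, ∑ a, (U.v t x i - Ub.v t x i)
      * pd a (fun y => dxi psi (Ub.xi t y) (Ub.th t y)) x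
        (dPhi (U.F t x) i a - dPhi (Ub.F t x) i a))
    + (dpsi psi (U.xi t x, U.th t x) - dpsi psi (Ub.xi t x, Ub.th t x)
        - fderiv ℝ (dpsi psi) (Ub.xi t x, Ub.th t x)
          ((U.xi t x, U.th t x) - (Ub.xi t x, Ub.th t x)))
      (deriv (fun s => Ub.xi s x) t, deriv (fun s => Ub.th s x) t)

/-- The flux of the relative entropy. -/
def relFlux (psi : Xi → ℝ → ℝ) (U Ub : ThermoField) (a : Fin 3) (t : ℝ) (x : Vec3) : ℝ :=
  ∑ i, (dxi psi (U.xi t x) (U.th t x) - dxi psi (Ub.xi t x) (Ub.th t x)) (dPhi (U.F t x) i a)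
    * (U.v t x i - Ub.v t x i)

/-- The energy and momentum residuals and the entropy rate of U are kept unevaluated: they are
diffusive terms known only weakly and are replaced after integration. The rest is exact, because the
first-order terms in U − Ū cancel by the equations of Ū. -/
theorem deriv_relEntropy_eq (hpsi : SmoothEnergy psi) (h : DiffPt U t x) (hb : DiffPt Ub t x)
    (hpos : 0 < U.th t x) (hposb : 0 < Ub.th t x) (hc : CurlFree U t x) (hcb : CurlFree Ub t x)
    (hkin : deriv (fun s => U.xi s x) t = kinematicDiv U t x)
    (hkinb : deriv (fun s => Ub.xi s x) t = kinematicDiv Ub t x)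
    (hmomb : ∀ i, deriv (fun s => Ub.v s x i) t = stressDiv psi Ub t x i)
    (hent : deriv (fun s => eta psi (Ub.xi s x) (Ub.th s x)) t = 0) :
    deriv (fun s => relEntropy psi (U.xi s x) (U.v s x) (U.th s x)
        (Ub.xi s x) (Ub.v s x) (Ub.th s x)) t
      = (deriv (fun s => totalEnergy psi U s x) t - powerDiv psi U t x)
        - Ub.th t x * deriv (fun s => eta psi (U.xi s x) (U.th s x)) t
        - (∑ i, Ub.v t x i * (deriv (fun s => U.v s x i) t - stressDiv psi U t x i))
        + (∑ a, pd a (relFlux psi U Ub a t) x) + relError psi U Ub t x := by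
  have hX := h.comp_x hpos (contDiffOn_dxi hpsi)
  have hXb := hb.comp_x hposb (contDiffOn_dxi hpsi)
  simp only at hX hXb
  rw [(hasDerivAt_relEntropy hpsi h hb hpos hposb hent).deriv]
  have hpow := sum_pd_flux h hc hX h.v_apply_x
  have hflux := sum_pd_flux h hc (hX.fun_sub hXb) (u := fun y => U.v t y - Ub.v t y)
    fun i => (h.v_apply_x i).fun_sub (hb.v_apply_x i)
  have hst := sum_pd_clm_dPhi h hc hX
  have hstb := sum_pd_clm_dPhi hb hcb hXb
  have hvsub : ∀ i a, pd a (fun y => U.v t y i - Ub.v t y i) x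
      = pd a (fun y => U.v t y i) x - pd a (fun y => Ub.v t y i) x := fun i a =>
    pd_sub a (h.v_apply_x i) (hb.v_apply_x i)
  have hXsub := fun a => pd_sub a hX hXb
  simp only [Pi.sub_apply, hvsub, hXsub, _root_.sub_apply] at hflux
  have hflux' : ∑ a, pd a (relFlux psi U Ub a t) x = _ := hflux
  have hpow' : powerDiv psi U t x = _ := hpow
  have hst' : ∀ i, stressDiv psi U t x i = _ := hst
  have hstb' : ∀ i, stressDiv psi Ub t x i = _ := hstb
  rw [hflux', hpow']
  simp only [hmomb, hst', hstb', hkin, hkinb, kinematicDiv_eq h hc, kinematicDiv_eq hb hcb,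
    map_sum, map_smul, smul_eq_mul, relError, _root_.sub_apply, map_sub]
  simp only [Fin.sum_univ_three]
  ring

end Pointwise

end Thermo

end

noncomputable section

namespace Thermo

/-! ### The relative entropy inequality -/

/-- The nine entries of the first sum give 9C, those of the second 9C/2 plus (3/2)|v − v̄|², and the
Taylor remainder gives C. Since I contains ½|v − v̄|², the factor 15C + 3 suffices. -/
theorem relError_le {psi : Xi → ℝ → ℝ} {U Ub : ThermoField} {t : ℝ} {x : Vec3} {C L : ℝ}
    (hE : ErrorBounds psi C (U.xi t x) (U.th t x) (Ub.xi t x) (Ub.th t x)) (hC : 0 ≤ C)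
    (hL : 0 ≤ L) (hI : 0 ≤ relI psi (U.xi t x) (U.th t x) (Ub.xi t x) (Ub.th t x))
    (h1 : ∀ i a, |pd a (fun y => Ub.v t y i) x| ≤ L)
    (h2 : ∀ a, ‖pd a (fun y => dxi psi (Ub.xi t y) (Ub.th t y)) x‖ ≤ L)
    (h3 : ‖(deriv (fun s => Ub.xi s x) t, deriv (fun s => Ub.th s x) t)‖ ≤ L) :
    relError psi U Ub t x ≤ L * (15 * C + 3) * relEntropy psi (U.xi t x) (U.v t x) (U.th t x)
      (Ub.xi t x) (Ub.v t x) (Ub.th t x) := by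
  rw [relEntropy_eq_relI]
  set I := relI psi (U.xi t x) (U.th t x) (Ub.xi t x) (Ub.th t x)
  have k1 : ∀ i a, pd a (fun y => Ub.v t y i) x
      * (dxi psi (U.xi t x) (U.th t x) - dxi psi (Ub.xi t x) (Ub.th t x))
        (dPhi (U.F t x) i a - dPhi (Ub.F t x) i a) ≤ L * (C * I) := fun i a => by
    refine (le_abs_self _).trans ?_
    rw [abs_mul]
    exact mul_le_mul (h1 i a) (hE.stress i a) (abs_nonneg _) hL
  have k2 : ∀ i a, (U.v t x i - Ub.v t x i)
      * pd a (fun y => dxi psi (Ub.xi t y) (Ub.th t y)) x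
        (dPhi (U.F t x) i a - dPhi (Ub.F t x) i a)
        ≤ L * (1 / 2 * (U.v t x i - Ub.v t x i) ^ 2 + 1 / 2 * (C * I)) := fun i a => by
    have hk := hE.kinematic i a
    change ‖dPhi (U.F t x) i a - dPhi (Ub.F t x) i a‖ ^ 2 ≤ C * I at hk
    set n := ‖dPhi (U.F t x) i a - dPhi (Ub.F t x) i a‖
    have e1 : |pd a (fun y => dxi psi (Ub.xi t y) (Ub.th t y)) x
        (dPhi (U.F t x) i a - dPhi (Ub.F t x) i a)| ≤ L * n :=
      (ContinuousLinearMap.le_opNorm _ _).trans (mul_le_mul_of_nonneg_right (h2 a) (norm_nonneg _))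
    calc _ ≤ |U.v t x i - Ub.v t x i| * (L * n) := by
          refine (le_abs_self _).trans ?_
          rw [abs_mul]
          gcongr
      _ = L * (|U.v t x i - Ub.v t x i| * n) := by ring
      _ ≤ L * (1 / 2 * (U.v t x i - Ub.v t x i) ^ 2 + 1 / 2 * (C * I)) := by
          gcongr
          rw [← sq_abs]
          linarith [sq_nonneg (|U.v t x i - Ub.v t x i| - n)]
  have k3 : (dpsi psi (U.xi t x, U.th t x) - dpsi psi (Ub.xi t x, Ub.th t x)
        - fderiv ℝ (dpsi psi) (Ub.xi t x, Ub.th t x)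
          ((U.xi t x, U.th t x) - (Ub.xi t x, Ub.th t x)))
      (deriv (fun s => Ub.xi s x) t, deriv (fun s => Ub.th s x) t) ≤ C * I * L :=
    (le_abs_self _).trans ((ContinuousLinearMap.le_opNorm _ _).trans
      (mul_le_mul hE.taylor h3 (norm_nonneg _) (by positivity)))
  have hs : 0 ≤ ∑ i, (U.v t x i - Ub.v t x i) ^ 2 := Finset.sum_nonneg fun _ _ => sq_nonneg _
  have s1 := Finset.sum_le_sum fun i (_ : i ∈ Finset.univ) =>
    Finset.sum_le_sum fun a (_ : a ∈ (Finset.univ : Finset (Fin 3))) => k1 i a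
  have s2 := Finset.sum_le_sum fun i (_ : i ∈ Finset.univ) =>
    Finset.sum_le_sum fun a (_ : a ∈ (Finset.univ : Finset (Fin 3))) => k2 i a
  have r1 : ∑ _i : Fin 3, ∑ _a : Fin 3, L * (C * I) = 9 * (L * (C * I)) := by
    simp only [Fin.sum_univ_three]; ring
  have r2 : ∑ i : Fin 3, ∑ _a : Fin 3,
      L * (1 / 2 * (U.v t x i - Ub.v t x i) ^ 2 + 1 / 2 * (C * I))
      = 3 / 2 * (L * ∑ i, (U.v t x i - Ub.v t x i) ^ 2) + 9 / 2 * (L * (C * I)) := by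
    simp only [Fin.sum_univ_three]; ring
  rw [r1] at s1
  rw [r2] at s2
  unfold relError
  set Q := ∑ i, (U.v t x i - Ub.v t x i) ^ 2
  have p1 : 0 ≤ L * (C * I) := by positivity
  have p2 : 0 ≤ L * (C * Q) := by positivity
  have p3 : 0 ≤ L * I := by positivity
  linarith

theorem mul_le_sq_add_sq_div {a b A : ℝ} (hA : 0 < A) : a * b ≤ A * a ^ 2 + b ^ 2 / A := by
  have h : A * (a * b) ≤ A * (A * a ^ 2 + b ^ 2 / A) := by
    rw [mul_add, mul_div_cancel₀ _ hA.ne']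
    nlinarith [sq_nonneg (A * a - b), sq_nonneg (A * a), sq_nonneg b]
  exact le_of_mul_le_mul_left h hA

/-- The density of the error caused by the diffusion. -/
def diffusionDensity (mu k : Mat3 → ℝ → ℝ) (U Ub : ThermoField) (s : ℝ) (x : Vec3) : ℝ :=
  mu (U.F s x) (U.th s x) * U.th s x * (Ub.gradVSq s x / Ub.th s x)
    + k (U.F s x) (U.th s x) * (Ub.gradThSq s x / Ub.th s x)

/-- Young's inequality is applied with weight θ̄ to (∇θ/θ)·∇θ̄ and with weight θ̄/θ to ∇v·∇v̄. With
these weights the squares of ∇θ and ∇v cancel exactly against θ̄ times the entropy production. -/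
theorem diffusion_le {mu k : Mat3 → ℝ → ℝ} {U Ub : ThermoField} {t : ℝ} {x : Vec3}
    (hmu : 0 < mu (U.F t x) (U.th t x)) (hk : 0 < k (U.F t x) (U.th t x))
    (hpos : 0 < U.th t x) (hposb : 0 < Ub.th t x) :
    (- k (U.F t x) (U.th t x) * U.gradThSq t x / U.th t x ^ 2
        - mu (U.F t x) (U.th t x) * U.gradVSq t x / U.th t x) * Ub.th t x
      + (∑ a, k (U.F t x) (U.th t x) * pd a (U.th t) x / U.th t x * pd a (Ub.th t) x)
      + (∑ i, ∑ a, mu (U.F t x) (U.th t x) * pd a (fun y => U.v t y i) x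
        * pd a (fun y => Ub.v t y i) x) ≤ diffusionDensity mu k U Ub t x := by
  set m := mu (U.F t x) (U.th t x)
  set n := k (U.F t x) (U.th t x)
  set θ := U.th t x
  set θb := Ub.th t x
  have h1 : ∀ a, n * pd a (U.th t) x / θ * pd a (Ub.th t) x
      ≤ n * θb / θ ^ 2 * pd a (U.th t) x ^ 2 + n / θb * pd a (Ub.th t) x ^ 2 := fun a => by
    have := mul_le_mul_of_nonneg_left
      (mul_le_sq_add_sq_div (a := pd a (U.th t) x / θ) (b := pd a (Ub.th t) x) hposb) hk.le
    calc _ = n * (pd a (U.th t) x / θ * pd a (Ub.th t) x) := by ring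
      _ ≤ _ := this
      _ = _ := by ring
  have h2 : ∀ i a, m * pd a (fun y => U.v t y i) x * pd a (fun y => Ub.v t y i) x
      ≤ m * θb / θ * pd a (fun y => U.v t y i) x ^ 2
        + m * θ / θb * pd a (fun y => Ub.v t y i) x ^ 2 := fun i a => by
    have := mul_le_mul_of_nonneg_left (mul_le_sq_add_sq_div (a := pd a (fun y => U.v t y i) x)
      (b := pd a (fun y => Ub.v t y i) x) (div_pos hposb hpos)) hmu.le
    calc _ = m * (pd a (fun y => U.v t y i) x * pd a (fun y => Ub.v t y i) x) := by ring
      _ ≤ _ := this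
      _ = _ := by field_simp
  have s1 := Finset.sum_le_sum fun a (_ : a ∈ Finset.univ) => h1 a
  have s2 := Finset.sum_le_sum fun i (_ : i ∈ Finset.univ) =>
    Finset.sum_le_sum fun a (_ : a ∈ (Finset.univ : Finset (Fin 3))) => h2 i a
  simp only [Finset.sum_add_distrib, ← Finset.mul_sum] at s1 s2
  refine (add_le_add (add_le_add le_rfl s1) s2).trans (le_of_eq ?_)
  change _ = m * θ * (Ub.gradVSq t x / θb) + n * (Ub.gradThSq t x / θb)
  unfold ThermoField.gradVSq ThermoField.gradThSq
  ring

/-! ### Boundedness and regularity of the terms on time slices, for testing the weak equations. -/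

section Slice

variable {psi : Xi → ℝ → ℝ} (mu k : Mat3 → ℝ → ℝ) {T : ℝ} {U Ub : ThermoField}

theorem IsWeakDiv.integral_eq_zero {q : Vec3 → Fin 3 → ℝ} {g : Vec3 → ℝ} (h : IsWeakDiv q g)
    (hg : BddMeas g) (hq : ∀ a, BddMeas (fun x => q x a)) {phi : Vec3 → ℝ} (hphi : ContDiff ℝ 1 phi)
    (hper : Periodic3 phi) (hpd : ∀ a, BddMeas (pd a phi)) :
    BddMeas (fun x => g x * phi x + ∑ a, q x a * pd a phi x) ∧
      ∫ x in cube, (g x * phi x + ∑ a, q x a * pd a phi x) = 0 := by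
  have h1 := hg.mul (.of_continuous hphi.continuous)
  have h2 : BddMeas (fun x => ∑ a, q x a * pd a phi x) := .sum _ fun a _ => (hq a).mul (hpd a)
  refine ⟨h1.add h2, ?_⟩
  rw [integral_add h1.integrable h2.integrable, h phi hphi hper, neg_add_cancel]

theorem Coefficient.bddMeas {m : Mat3 → ℝ → ℝ} (hm : Coefficient m) (hU : LipField T U) {t : ℝ}
    (ht : t ∈ Icc 0 T) : BddMeas (fun x => m (U.F t x) (U.th t x)) := by
  refine .of_continuous (hm.cont.comp_continuous (f := fun x => (U.F t x, U.th t x)) ?_ fun x =>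
    ⟨mem_univ _, hU.th_pos t ht x⟩)
  exact (continuous_fst.comp (hU.xi.continuous_slice ht)).prodMk (hU.th.continuous_slice ht)

theorem LipField.bddMeas_inv (hU : LipField T U) {t : ℝ} (ht : t ∈ Icc 0 T) :
    BddMeas (fun x => (U.th t x)⁻¹) :=
  .of_continuous ((hU.th.continuous_slice ht).inv₀ fun x => (hU.th_pos t ht x).ne')

theorem LipField.bddMeas_gradVSq (hU : LipField T U) {t : ℝ} (ht : t ∈ Icc 0 T) :
    BddMeas (U.gradVSq t) :=
  .sum _ fun i _ => .sum _ fun a _ => ((hU.v_apply i).bddMeas_pd ht a).pow 2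

theorem LipField.bddMeas_gradThSq (hU : LipField T U) {t : ℝ} (ht : t ∈ Icc 0 T) :
    BddMeas (U.gradThSq t) :=
  .sum _ fun a _ => (hU.th.bddMeas_pd ht a).pow 2

theorem bddMeas_diffusionDensity {mu k : Mat3 → ℝ → ℝ} (hmu : Coefficient mu) (hk : Coefficient k)
    (hU : LipField T U) (hUb : LipField T Ub) {t : ℝ} (ht : t ∈ Icc 0 T) :
    BddMeas (diffusionDensity mu k U Ub t) := by
  have h1 := (hmu.bddMeas hU ht).mul (hU.th.bddMeas ht)
  have h2 := (hUb.bddMeas_gradVSq ht).mul (hUb.bddMeas_inv ht)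
  have h3 := (hk.bddMeas hU ht).mul ((hUb.bddMeas_gradThSq ht).mul (hUb.bddMeas_inv ht))
  unfold diffusionDensity
  simpa only [div_eq_mul_inv, ThermoField.F] using! (h1.mul h2).add h3

theorem LipField.dxi (hpsi : SmoothEnergy psi) (hU : LipField T U) :
    PerLip T (fun t x => dxi psi (U.xi t x) (U.th t x)) := hU.comp (contDiffOn_dxi hpsi)

theorem LipField.eta (hpsi : SmoothEnergy psi) (hU : LipField T U) :
    PerLip T (fun t x => eta psi (U.xi t x) (U.th t x)) :=
  hU.comp (G := fun z => Thermo.eta psi z.1 z.2) (contDiffOn_eta hpsi)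

theorem LipField.ener (hpsi : SmoothEnergy psi) (hU : LipField T U) :
    PerLip T (fun t x => ener psi (U.xi t x) (U.th t x)) :=
  hU.comp (G := fun z => Thermo.ener psi z.1 z.2) (contDiffOn_ener hpsi)

theorem LipField.totalEnergy (hpsi : SmoothEnergy psi) (hU : LipField T U) :
    PerLip T (totalEnergy psi U) := by
  have h : PerLip T (fun t x => (1 / 2 : ℝ) * (∑ i, U.v t x i ^ 2)) :=
    hU.v.contDiff_comp (G := fun w : Vec3 => (1 / 2 : ℝ) * ∑ i, w i ^ 2) (by fun_prop)
  unfold Thermo.totalEnergy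
  simpa only [vnorm_sq] using h.add (hU.ener hpsi)

theorem LipField.stress (hpsi : SmoothEnergy psi) (hU : LipField T U) (i a : Fin 3) :
    PerLip T (fun t x => stress psi (U.xi t x) (U.th t x) i a) :=
  (hU.dxi hpsi).clm_apply (hU.dPhi i a)

theorem LipField.relFlux (hpsi : SmoothEnergy psi) (hU : LipField T U) (hUb : LipField T Ub)
    (a : Fin 3) : PerLip T (relFlux psi U Ub a) :=
  .sum _ fun i => (((hU.dxi hpsi).sub (hUb.dxi hpsi)).clm_apply (hU.dPhi i a)).mul
    ((hU.v_apply i).sub (hUb.v_apply i))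

theorem LipField.relEntropy (hpsi : SmoothEnergy psi) (hU : LipField T U) (hUb : LipField T Ub) :
    PerLip T (fun t x => relEntropy psi (U.xi t x) (U.v t x) (U.th t x)
      (Ub.xi t x) (Ub.v t x) (Ub.th t x)) := by
  simp only [relEntropy_eq]
  have h1 : PerLip T (fun t x => psi (Ub.xi t x) (Ub.th t x)) :=
    hUb.comp (G := fun z => psi z.1 z.2) (hpsi.of_le (by norm_num))
  have h2 : PerLip T (fun t x => ∑ i, (1 / 2 * Ub.v t x i ^ 2 - U.v t x i * Ub.v t x i)) :=
    (hU.v.prodMk hUb.v).contDiff_comp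
      (G := fun w : Vec3 × Vec3 => ∑ i, (1 / 2 * w.2 i ^ 2 - w.1 i * w.2 i)) (by fun_prop)
  exact ((((hU.totalEnergy hpsi).sub (hUb.th.mul (hU.eta hpsi))).sub h1).sub
    ((hUb.dxi hpsi).clm_apply (hU.xi.sub hUb.xi))).add h2

theorem LipField.bddMeas_stressDiv (hpsi : SmoothEnergy psi) (hU : LipField T U) {t : ℝ}
    (ht : t ∈ Icc 0 T) (i : Fin 3) : BddMeas (fun x => stressDiv psi U t x i) :=
  .sum _ fun a _ => (hU.stress hpsi i a).bddMeas_pd ht a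

theorem LipField.power (hpsi : SmoothEnergy psi) (hU : LipField T U) (a : Fin 3) :
    PerLip T (fun t x => ∑ i, Thermo.stress psi (U.xi t x) (U.th t x) i a * U.v t x i) :=
  .sum _ fun i => (hU.stress hpsi i a).mul (hU.v_apply i)

theorem periodic_comp_apply {f : Vec3 → Vec3} (hf : Periodic3 f) (i : Fin 3) :
    Periodic3 (fun x => f x i) := fun x a => by simp only [hf x a]

theorem contDiff_slice {E : Type*} [NormedAddCommGroup E] [NormedSpace ℝ E] {f : ℝ → Vec3 → E}
    (hf : ContDiffOn ℝ 1 (fun z : ℝ × Vec3 => f z.1 z.2) (Icc 0 T ×ˢ univ)) {t : ℝ}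
    (ht : t ∈ Icc 0 T) : ContDiff ℝ 1 (f t) := by
  rw [← contDiffOn_univ]
  exact hf.comp (f := fun x : Vec3 => (t, x)) (by fun_prop) fun x _ => ⟨ht, mem_univ _⟩

end Slice

/-- Uniform bounds for the derivatives of the smooth solution. -/
theorem exists_deriv_bound {psi : Xi → ℝ → ℝ} (hpsi : SmoothEnergy psi) {T : ℝ} {Ub : ThermoField}
    (hUb : LipField T Ub) : ∃ L, 0 ≤ L ∧ ∀ t ∈ Ioo 0 T, ∀ x,
      (∀ i a, |pd a (fun y => Ub.v t y i) x| ≤ L) ∧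
      (∀ a, ‖pd a (fun y => dxi psi (Ub.xi t y) (Ub.th t y)) x‖ ≤ L) ∧
      ‖(deriv (fun s => Ub.xi s x) t, deriv (fun s => Ub.th s x) t)‖ ≤ L := by
  obtain ⟨L1, h1⟩ := (hUb.v_apply 0).lip_space
  obtain ⟨L2, h2⟩ := (hUb.v_apply 1).lip_space
  obtain ⟨L3, h3⟩ := (hUb.v_apply 2).lip_space
  obtain ⟨L4, h4⟩ := (hUb.dxi hpsi).lip_space
  obtain ⟨L5, h5⟩ := hUb.xi.lip_time
  obtain ⟨L6, h6⟩ := hUb.th.lip_time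
  have p1 : (0 : ℝ) ≤ L1 := L1.2
  have p2 : (0 : ℝ) ≤ L2 := L2.2
  have p3 : (0 : ℝ) ≤ L3 := L3.2
  have p4 : (0 : ℝ) ≤ L4 := L4.2
  have p5 : (0 : ℝ) ≤ L5 := L5.2
  have p6 : (0 : ℝ) ≤ L6 := L6.2
  refine ⟨L1 + L2 + L3 + L4 + L5 + L6, by positivity,
    fun t ht x => ⟨fun i a => ?_, fun a => ?_, ?_⟩⟩
  · have ht' := Ioo_subset_Icc_self ht
    fin_cases i
    · exact (pd_norm_le (h1 t ht') a x).trans (by linarith)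
    · exact (pd_norm_le (h2 t ht') a x).trans (by linarith)
    · exact (pd_norm_le (h3 t ht') a x).trans (by linarith)
  · exact (pd_norm_le (h4 t (Ioo_subset_Icc_self ht)) a x).trans (by linarith)
  · exact max_le ((PerLip.norm_deriv_le h5 ht x).trans (by linarith))
      ((PerLip.norm_deriv_le h6 ht x).trans (by linarith))

/-- The differential inequality for the total relative entropy. -/
theorem ae_deriv_totalRelEntropy_le {psi : Xi → ℝ → ℝ} (hpsi : SmoothEnergy psi) (hst : Stable psi)
    {T : ℝ} {Ub : ThermoField} (hUb : IsAdiabaticSolution psi T Ub) {C : ℝ} (hC : 0 ≤ C)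
    (hEB : ∀ (xi : Xi) (th : ℝ), 0 < th → ∀ t ∈ Icc 0 T, ∀ x,
      ErrorBounds psi C xi th (Ub.xi t x) (Ub.th t x)) :
    ∃ K, 0 ≤ K ∧ ∀ mu k : Mat3 → ℝ → ℝ, Coefficient mu → Coefficient k →
      ∀ U : ThermoField, IsStrongSolution psi mu k T U →
      ∀ᵐ t, t ∈ Ioo 0 T → ∃ φ', HasDerivAt (totalRelEntropy psi U Ub) φ' t ∧
        φ' ≤ K * totalRelEntropy psi U Ub t + ∫ x in cube, diffusionDensity mu k U Ub t x := by
  have hLb := hUb.lipField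
  obtain ⟨L, hL, hbd⟩ := exists_deriv_bound hpsi hLb
  refine ⟨L * (15 * C + 3), by positivity, fun mu k hmu hk U hU => ?_⟩
  have hLU := hU.lipField
  filter_upwards [hLU.ae_diffPt, hU.curl_free, hU.kinematic, hU.momentum, hU.energy, hU.entropy]
    with t hdiff hcurl hkin hmom hen hent ht
  have hdiff := hdiff ht
  have hcurl := hcurl ht
  have hkin := hkin ht
  have hmom := hmom ht
  have hen := hen ht
  have hent := hent ht
  have htc : t ∈ Icc 0 T := Ioo_subset_Icc_self ht
  have hpos := hLU.th_pos t htc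
  have hposb := hLb.th_pos t htc
  have hPL := hLU.relEntropy hpsi hLb
  have hDI : ∀ᵐ x, DifferentiableAt ℝ (fun s => relEntropy psi (U.xi s x) (U.v s x) (U.th s x)
      (Ub.xi s x) (Ub.v s x) (Ub.th s x)) t := by
    filter_upwards [hdiff] with x hx
    exact (hasDerivAt_relEntropy hpsi hx (hUb.diffPt ht x) (hpos x) (hposb x)
      (hUb.entropy t ht x)).differentiableAt
  refine ⟨_, hPL.hasDerivAt_integral ht hDI, ?_⟩
  have bmu := hmu.bddMeas hLU htc
  have bk := hk.bddMeas hLU htc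
  have binv := hLU.bddMeas_inv htc
  have bpdv := fun i a => (hLU.v_apply i).bddMeas_pd htc a
  have bpdth := fun a => hLU.th.bddMeas_pd htc a
  -- the energy equation
  have bE' : BddMeas (fun x => deriv (fun s => totalEnergy psi U s x) t) :=
    (hLU.totalEnergy hpsi).bddMeas_deriv ht
      (hdiff.mono fun x hx => hx.totalEnergy_t hpsi (hpos x))
  have bpow : BddMeas (fun x => powerDiv psi U t x) :=
    .sum _ fun a _ => (hLU.power hpsi a).bddMeas_pd htc a
  have hconst : ∀ a, pd a (fun _ : Vec3 => (1 : ℝ)) = fun _ => 0 := fun a => by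
    funext x; simp [pd]
  -- The test functions 1, θ̄ and v̄ are the coefficients of the three balance laws in
  -- `deriv_relEntropy_eq`. The constant 1 removes the energy fluxes altogether.
  obtain ⟨b1, i1⟩ := hen.integral_eq_zero (bE'.sub bpow)
    (fun a => (bmu.mul (.sum _ fun i _ => ((hLU.v_apply i).bddMeas htc).mul (bpdv i a))).add
      (bk.mul (bpdth a)))
    (phi := fun _ => 1) contDiff_const (fun _ _ => rfl)
    (fun a => by rw [hconst]; exact .of_continuous continuous_const)
  simp only [hconst, mul_zero, Finset.sum_const_zero, add_zero, mul_one] at b1 i1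
  -- the entropy equation
  have bη' : BddMeas (fun x => deriv (fun s => eta psi (U.xi s x) (U.th s x)) t) :=
    (hLU.eta hpsi).bddMeas_deriv ht (hdiff.mono fun x hx => hx.eta_t hpsi (hpos x))
  obtain ⟨b2, i2⟩ := hent.integral_eq_zero
    (by
      simpa only [div_eq_mul_inv, inv_pow] using!
        (bη'.sub ((bk.mul (hLU.bddMeas_gradThSq htc)).mul (binv.pow 2))).sub
          ((bmu.mul (hLU.bddMeas_gradVSq htc)).mul binv))
    (fun a => by simpa only [div_eq_mul_inv] using (bk.mul (bpdth a)).mul binv)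
    (phi := Ub.th t) (contDiff_slice hUb.smooth_th htc) (hLb.th.per t htc)
    (fun a => hLb.th.bddMeas_pd htc a)
  -- the momentum equation
  have b3i := fun i => (hmom i).integral_eq_zero
    (((hLU.v_apply i).bddMeas_deriv ht (hdiff.mono fun x hx => hx.v_apply_t i)).sub
      (hLU.bddMeas_stressDiv hpsi htc i))
    (fun a => bmu.mul (bpdv i a))
    (phi := fun x => Ub.v t x i)
    (contDiff_pi.1 (contDiff_slice hUb.smooth_v htc) i) (periodic_comp_apply (hLb.v.per t htc) i)
    (fun a => (hLb.v_apply i).bddMeas_pd htc a)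
  have b3 := BddMeas.sum Finset.univ fun i _ => (b3i i).1
  have i3 := integral_finsetSum (μ := volume.restrict cube) Finset.univ
    fun i _ => (b3i i).1.integrable
  simp only [fun i => (b3i i).2, Finset.sum_const_zero] at i3
  -- the flux of the relative entropy
  have b4i := fun a => (hLU.relFlux hpsi hLb a).bddMeas_pd htc a
  have b4 := BddMeas.sum Finset.univ fun a _ => b4i a
  have i4 := integral_finsetSum (μ := volume.restrict cube) Finset.univ
    fun a _ => (b4i a).integrable
  simp only [fun a => (hLU.relFlux hpsi hLb a).integral_pd htc a, Finset.sum_const_zero] at i4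
  have b5 := hPL.bddMeas htc
  have b6 := bddMeas_diffusionDensity hmu hk hLU hLb htc
  have b7 := hPL.bddMeas_deriv ht hDI
  have b5' := (BddMeas.of_continuous (continuous_const (y := L * (15 * C + 3)))).mul b5
  -- The integrand on the right is the sum of the three tested weak forms (with signs), the relative
  -- flux, the Grönwall term and the diffusion density. The first four integrate to zero.
  have hle := integral_mono_ae b7.integrable
    (((((b1.sub b2).sub b3).add b4).add b5').add b6).integrable ?_
  · rw [integral_add (((((b1.sub b2).sub b3).add b4).add b5')).integrable b6.integrable,
      integral_add ((((b1.sub b2).sub b3).add b4)).integrable b5'.integrable,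
      integral_add (((b1.sub b2).sub b3)).integrable b4.integrable,
      integral_sub ((b1.sub b2)).integrable b3.integrable,
      integral_sub b1.integrable b2.integrable, i1, i2, i3, i4, integral_const_mul] at hle
    simpa [totalRelEntropy] using hle
  · filter_upwards [ae_restrict_of_ae hdiff, ae_restrict_of_ae hcurl, ae_restrict_of_ae hkin]
      with x hx hcx hkx
    have hid := deriv_relEntropy_eq hpsi hx (hUb.diffPt ht x) (hpos x) (hposb x) hcx
      (hUb.curl_free t ht x) (sub_eq_zero.1 hkx) (sub_eq_zero.1 (hUb.kinematic t ht x))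
      (fun i => sub_eq_zero.1 (hUb.momentum t ht x i)) (hUb.entropy t ht x)
    obtain ⟨k1, k2, k3⟩ := hbd t ht x
    have herr := relError_le (hEB (U.xi t x) (U.th t x) (hpos x) t htc x) hC hL
      (relI_nonneg hpsi hst _ _ (hpos x) (hposb x)) k1 k2 k3
    have hdf := diffusion_le (hmu.pos (U.F t x) _ (hpos x)) (hk.pos (U.F t x) _ (hpos x))
      (hpos x) (hposb x)
    change deriv _ t ≤ _
    rw [hid]
    simp only [Finset.sum_add_distrib]
    have e1 : ∑ i, Ub.v t x i * (deriv (fun s => U.v s x i) t - stressDiv psi U t x i)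
        = ∑ i, (deriv (fun s => U.v s x i) t - stressDiv psi U t x i) * Ub.v t x i :=
      Finset.sum_congr rfl fun i _ => mul_comm _ _
    rw [e1]
    simp only [neg_mul, neg_div] at hdf
    linarith

end Thermo

end

noncomputable section

namespace Thermo

/-! ### Integration in time of the relative entropy inequality -/

/-- Spatial derivatives at t = 0 and t = T are components of the derivative within the slab, which
is unique because T > 0; hence they are continuous up to the ends of the time interval. -/
theorem continuousOn_pd {E : Type*} [NormedAddCommGroup E] [NormedSpace ℝ E] {f : ℝ → Vec3 → E}
    {T : ℝ} (hT : 0 < T)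
    (hf : ContDiffOn ℝ 1 (fun z : ℝ × Vec3 => f z.1 z.2) (Icc 0 T ×ˢ univ)) (a : Fin 3) :
    ContinuousOn (fun z : ℝ × Vec3 => pd a (f z.1) z.2) (Icc 0 T ×ˢ univ) := by
  have hc := hf.continuousOn_fderivWithin ((uniqueDiffOn_Icc hT).prod uniqueDiffOn_univ) le_rfl
  refine (hc.clm_apply (continuousOn_const (c := ((0 : ℝ), (Pi.single a 1 : Vec3))))).congr ?_
  rintro ⟨t, x⟩ hz
  have h1 := ((hf.differentiableOn one_ne_zero) (t, x) hz).hasFDerivWithinAt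
  have h2 := (h1.comp (f := fun y : Vec3 => (t, y)) (s := univ) x
    (hasFDerivAt_prodMk_right t x).hasFDerivWithinAt fun y _ => ⟨hz.1, mem_univ _⟩)
  rw [hasFDerivWithinAt_univ] at h2
  change fderiv ℝ (f t) x (Pi.single a 1) = _
  have h3 : HasFDerivAt (f t) _ x := h2
  rw [h3.fderiv]
  rfl

section

variable {psi : Xi → ℝ → ℝ} {mu k : Mat3 → ℝ → ℝ} {T : ℝ} {U Ub : ThermoField}

theorem IsAdiabaticSolution.continuousOn_gradVSq_div (hT : 0 < T)
    (hUb : IsAdiabaticSolution psi T Ub) :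
    ContinuousOn (fun z : ℝ × Vec3 => Ub.gradVSq z.1 z.2 / Ub.th z.1 z.2) (Icc 0 T ×ˢ univ) := by
  refine ContinuousOn.div ?_ hUb.smooth_th.continuousOn fun z hz =>
    (hUb.adm.th_pos z.1 hz.1 z.2).ne'
  exact continuousOn_finsetSum _ fun i _ => continuousOn_finsetSum _ fun a _ =>
    (continuousOn_pd (f := fun t x => Ub.v t x i) hT (contDiffOn_pi.1 hUb.smooth_v i) a).pow 2

theorem IsAdiabaticSolution.continuousOn_gradThSq_div (hT : 0 < T)
    (hUb : IsAdiabaticSolution psi T Ub) :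
    ContinuousOn (fun z : ℝ × Vec3 => Ub.gradThSq z.1 z.2 / Ub.th z.1 z.2) (Icc 0 T ×ˢ univ) := by
  refine ContinuousOn.div ?_ hUb.smooth_th.continuousOn fun z hz =>
    (hUb.adm.th_pos z.1 hz.1 z.2).ne'
  exact continuousOn_finsetSum _ fun a _ => (continuousOn_pd hT hUb.smooth_th a).pow 2

theorem Coefficient.continuousOn {m : Mat3 → ℝ → ℝ} (hm : Coefficient m) (hU : LipField T U) :
    ContinuousOn (fun z : ℝ × Vec3 => m (U.F z.1 z.2) (U.th z.1 z.2)) (Icc 0 T ×ˢ univ) :=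
  hm.cont.comp (hU.xi.continuousOn.fst.prodMk hU.th.continuousOn) fun z hz =>
    ⟨mem_univ _, hU.th_pos z.1 hz.1 z.2⟩

theorem continuousOn_diffusionDensity (hT : 0 < T) (hmu : Coefficient mu) (hk : Coefficient k)
    (hU : LipField T U) (hUb : IsAdiabaticSolution psi T Ub) :
    ContinuousOn (fun z : ℝ × Vec3 => diffusionDensity mu k U Ub z.1 z.2) (Icc 0 T ×ˢ univ) :=
  (((hmu.continuousOn hU).mul hU.th.continuousOn).mul (hUb.continuousOn_gradVSq_div hT)).add
    ((hk.continuousOn hU).mul (hUb.continuousOn_gradThSq_div hT))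

theorem continuousOn_integral_cube {f : ℝ → Vec3 → ℝ}
    (hf : ContinuousOn (fun z : ℝ × Vec3 => f z.1 z.2) (Icc 0 T ×ˢ univ)) :
    ContinuousOn (fun t => ∫ x in cube, f t x) (Icc 0 T) := by
  obtain ⟨B, hB⟩ := (isCompact_Icc.prod isCompact_cube).exists_bound_of_continuousOn
    (hf.mono (prod_mono_right (subset_univ _)))
  refine continuousOn_of_dominated (bound := fun _ => B) (fun t ht => ?_) (fun t ht => ?_)
    (integrable_const _) (.of_forall fun x => ?_)
  · refine (continuousOn_univ.1 ?_ : Continuous (f t)).aestronglyMeasurable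
    exact hf.comp (f := fun x : Vec3 => (t, x)) (by fun_prop) fun x _ => ⟨ht, mem_univ _⟩
  · exact (ae_restrict_iff' measurableSet_cube).2 (.of_forall fun x hx => hB (t, x) ⟨ht, hx⟩)
  · exact hf.comp (f := fun t : ℝ => (t, x)) (by fun_prop) fun t ht => ⟨ht, mem_univ _⟩

theorem diffusionDensity_nonneg (hmu : Coefficient mu) (hk : Coefficient k)
    (hU : LipField T U) (hUb : LipField T Ub) {t : ℝ} (ht : t ∈ Icc 0 T) (x : Vec3) :
    0 ≤ diffusionDensity mu k U Ub t x := by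
  have h1 := hU.th_pos t ht x
  have h2 := hUb.th_pos t ht x
  have h3 := hmu.pos (U.F t x) _ h1
  have h4 := hk.pos (U.F t x) _ h1
  have h5 : 0 ≤ Ub.gradVSq t x :=
    Finset.sum_nonneg fun _ _ => Finset.sum_nonneg fun _ _ => sq_nonneg _
  have h6 : 0 ≤ Ub.gradThSq t x := Finset.sum_nonneg fun _ _ => sq_nonneg _
  unfold diffusionDensity
  positivity

theorem relI_le_relEntropy (psi : Xi → ℝ → ℝ) (xi : Xi) (v : Vec3) (th : ℝ) (xib : Xi) (vb : Vec3)
    (thb : ℝ) : relI psi xi th xib thb ≤ relEntropy psi xi v th xib vb thb := by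
  rw [relEntropy_eq_relI]
  have : 0 ≤ ∑ i, (v i - vb i) ^ 2 := Finset.sum_nonneg fun _ _ => sq_nonneg _
  linarith

theorem totalRelEntropy_nonneg (hpsi : SmoothEnergy psi) (hst : Stable psi) (hU : LipField T U)
    (hUb : LipField T Ub) {t : ℝ} (ht : t ∈ Icc 0 T) : 0 ≤ totalRelEntropy psi U Ub t :=
  integral_nonneg fun x => (relI_nonneg hpsi hst _ _ (hU.th_pos t ht x) (hUb.th_pos t ht x)).trans
    (relI_le_relEntropy ..)

theorem InGamma.norm_xi_le {M d : ℝ} (h : InGamma M d T Ub) {t : ℝ} (ht : t ∈ Icc 0 T) (x : Vec3) :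
    ‖Ub.xi t x‖ ≤ M := by
  obtain ⟨h1, h2, h3, -⟩ := h t ht x
  exact max_le ((norm_le_mnorm _).trans h1) (max_le ((norm_le_mnorm _).trans h2) h3)

/-- The stability estimate for the relative entropy. -/
theorem totalRelEntropy_le (hpsi : SmoothEnergy psi) (hst : Stable psi) (hT : 0 < T)
    (hUb : IsAdiabaticSolution psi T Ub) {C : ℝ} (hC : 0 ≤ C)
    (hEB : ∀ (xi : Xi) (th : ℝ), 0 < th → ∀ t ∈ Icc 0 T, ∀ x,
      ErrorBounds psi C xi th (Ub.xi t x) (Ub.th t x)) :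
    ∃ K, 0 < K ∧ ∀ mu k : Mat3 → ℝ → ℝ, Coefficient mu → Coefficient k →
      ∀ U : ThermoField, IsStrongSolution psi mu k T U → ∀ t ∈ Icc 0 T,
        totalRelEntropy psi U Ub t
          ≤ K * (totalRelEntropy psi U Ub 0 + diffusionError mu k T U Ub) := by
  obtain ⟨K, hK, h⟩ := ae_deriv_totalRelEntropy_le hpsi hst hUb hC hEB
  refine ⟨Real.exp (K * T), Real.exp_pos _, fun mu k hmu hk U hU t ht => ?_⟩
  have hLU := hU.lipField
  have hLb := hUb.lipField
  obtain ⟨L, hL⟩ := (hLU.relEntropy hpsi hLb).lipschitzOn_integral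
  have hD := continuousOn_integral_cube (continuousOn_diffusionDensity hT hmu hk hLU hUb)
  rw [← uIcc_of_le hT.le] at hD
  exact gronwall_of_lipschitzOn hK hL hD.intervalIntegrable
    (fun s hs => integral_nonneg (diffusionDensity_nonneg hmu hk hLU hLb hs)) (h mu k hmu hk U hU)
    ht (totalRelEntropy_nonneg hpsi hst hLU hLb ⟨le_rfl, hT.le⟩)

/-- Control of the diffusive error by the relative entropy, for coefficients dominated by the
internal energy. -/
theorem integral_diffusionDensity_le (hpsi : SmoothEnergy psi) (hT : 0 < T)
    (hUb : IsAdiabaticSolution psi T Ub) {C : ℝ} (hC : 0 ≤ C)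
    (hEB : ∀ (xi : Xi) (th : ℝ), 0 < th → ∀ t ∈ Icc 0 T, ∀ x,
      ErrorBounds psi C xi th (Ub.xi t x) (Ub.th t x)) :
    ∃ G, 0 ≤ G ∧ ∀ mu k : Mat3 → ℝ → ℝ, Coefficient mu → Coefficient k →
      ∀ U : ThermoField, LipField T U → ∀ m n : ℝ, 0 ≤ m → 0 ≤ n →
      (∀ (xi : Xi) (th : ℝ), 0 < th → |mu xi.1 th * th| ≤ m * |ener psi xi th| ∧
        |k xi.1 th| ≤ n * |ener psi xi th|) → ∀ t ∈ Icc 0 T,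
      ∫ x in cube, diffusionDensity mu k U Ub t x
        ≤ G * (m + n) * (totalRelEntropy psi U Ub t + 1) := by
  have hLb := hUb.lipField
  have hc := isCompact_Icc (a := (0 : ℝ)) (b := T) |>.prod isCompact_cube
  have hsub : Icc 0 T ×ˢ cube ⊆ Icc (0 : ℝ) T ×ˢ (univ : Set Vec3) :=
    prod_mono_right (subset_univ _)
  obtain ⟨G1, h1⟩ := hc.exists_bound_of_continuousOn
    ((hUb.continuousOn_gradVSq_div hT).mono hsub)
  obtain ⟨G2, h2⟩ := hc.exists_bound_of_continuousOn
    ((hUb.continuousOn_gradThSq_div hT).mono hsub)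
  have hmem : ((0 : ℝ), (0 : Vec3)) ∈ Icc (0 : ℝ) T ×ˢ cube :=
    ⟨⟨le_rfl, hT.le⟩, ⟨le_rfl, zero_le_one⟩⟩
  have g1 : 0 ≤ G1 := (norm_nonneg _).trans (h1 _ hmem)
  have g2 : 0 ≤ G2 := (norm_nonneg _).trans (h2 _ hmem)
  -- G1 and G2 bound |∇v̄|²/θ̄ and |∇θ̄|²/θ̄, and C comes from |ê| ≤ C(I + 1).
  refine ⟨(G1 + G2) * C, by positivity, fun mu k hmu hk U hU m n hm hn hle t ht => ?_⟩
  have bI := (hU.relEntropy hpsi hLb).bddMeas ht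
  have b1 := BddMeas.of_continuous (continuous_const (y := (1 : ℝ)) (X := Vec3))
  have hcst := BddMeas.of_continuous (continuous_const (y := (G1 + G2) * C * (m + n)) (X := Vec3))
  have key : ∫ x in cube, diffusionDensity mu k U Ub t x
      ≤ ∫ x in cube, (G1 + G2) * C * (m + n) * (relEntropy psi (U.xi t x) (U.v t x) (U.th t x)
        (Ub.xi t x) (Ub.v t x) (Ub.th t x) + 1) := by
    refine setIntegral_mono_on (bddMeas_diffusionDensity hmu hk hU hLb ht).integrable
      (hcst.mul (bI.add b1)).integrable measurableSet_cube fun x hx => ?_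
    have hpos := hU.th_pos t ht x
    have k1 := (hle (U.xi t x) (U.th t x) hpos).1
    have k2 := (hle (U.xi t x) (U.th t x) hpos).2
    have k3 := (hEB (U.xi t x) (U.th t x) hpos t ht x).energy
    have k4 := relI_le_relEntropy psi (U.xi t x) (U.v t x) (U.th t x) (Ub.xi t x) (Ub.v t x)
      (Ub.th t x)
    have k5 := h1 (t, x) ⟨ht, hx⟩
    have k6 := h2 (t, x) ⟨ht, hx⟩
    simp only [Real.norm_eq_abs] at k5 k6
    set e := |ener psi (U.xi t x) (U.th t x)|
    have he : 0 ≤ e := abs_nonneg _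
    calc diffusionDensity mu k U Ub t x
        ≤ |mu (U.F t x) (U.th t x) * U.th t x| * |Ub.gradVSq t x / Ub.th t x|
          + |k (U.F t x) (U.th t x)| * |Ub.gradThSq t x / Ub.th t x| := by
          rw [← abs_mul, ← abs_mul]
          exact add_le_add (le_abs_self _) (le_abs_self _)
      _ ≤ m * e * G1 + n * e * G2 :=
          add_le_add (mul_le_mul k1 k5 (abs_nonneg _) (by positivity))
            (mul_le_mul k2 k6 (abs_nonneg _) (by positivity))
      _ ≤ (G1 + G2) * (m + n) * e := by
          have e1 : 0 ≤ m * e * G2 := by positivity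
          have e2 : 0 ≤ n * e * G1 := by positivity
          linarith
      _ ≤ (G1 + G2) * (m + n)
            * (C * (relI psi (U.xi t x) (U.th t x) (Ub.xi t x) (Ub.th t x) + 1)) := by
          gcongr
      _ ≤ (G1 + G2) * (m + n) * (C * (relEntropy psi (U.xi t x) (U.v t x) (U.th t x)
            (Ub.xi t x) (Ub.v t x) (Ub.th t x) + 1)) := by gcongr
      _ = _ := by ring
  refine key.trans (le_of_eq ?_)
  rw [integral_const_mul, integral_add bI.integrable b1.integrable]
  simp [totalRelEntropy]

end

/-- Absorption of a small error term. -/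
theorem le_of_le_integral_add {T K e : ℝ} (hT : 0 < T) (hK : 0 ≤ K) (he : 0 ≤ e) {φ D : ℝ → ℝ}
    (hφ : ContinuousOn φ (Icc 0 T)) (hφ0 : ∀ t ∈ Icc 0 T, 0 ≤ φ t)
    (hD : IntervalIntegrable D volume 0 T)
    (hφD : ∀ t ∈ Icc 0 T, φ t ≤ K * (φ 0 + ∫ s in (0 : ℝ)..T, D s))
    (hDφ : ∀ t ∈ Icc 0 T, D t ≤ e * (φ t + 1)) (hsmall : K * T * e ≤ 1 / 2) :
    ∀ t ∈ Icc 0 T, φ t ≤ 2 * K * φ 0 + 2 * K * T * e := by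
  -- At a maximum point t0 the stability bound reads φ(t0) ≤ Kφ(0) + KTe(φ(t0) + 1). Since KTe ≤
  -- 1/2, half of φ(t0) is absorbed on the left, whence the factors 2.
  obtain ⟨t0, ht0, hmax⟩ := isCompact_Icc.exists_isMaxOn (nonempty_Icc.2 hT.le) hφ
  have h1 : ∫ s in (0 : ℝ)..T, D s ≤ T * (e * (φ t0 + 1)) := by
    have := intervalIntegral.integral_mono_on hT.le hD
      (intervalIntegrable_const (c := e * (φ t0 + 1))) fun s hs => (hDφ s hs).trans
        (mul_le_mul_of_nonneg_left (by have : φ s ≤ φ t0 := hmax hs; linarith) he)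
    rwa [intervalIntegral.integral_const, smul_eq_mul, sub_zero] at this
  have h2 := (hφD t0 ht0).trans (mul_le_mul_of_nonneg_left (add_le_add_right h1 _) hK)
  intro t ht
  have h3 : φ t ≤ φ t0 := hmax ht
  nlinarith [mul_le_mul_of_nonneg_right hsmall (hφ0 t0 ht0)]

end Thermo

end

/-! ### Proof of the stability estimate and of the convergence. -/

open Thermo
theorem theorem4p1
    -- the extended free energy, of class `C³` on `ℝ¹⁹ × (0, ∞)`
    (psi : Xi → ℝ → ℝ)
    (hpsi : ContDiffOn ℝ 3 (fun z : Xi × ℝ => psi z.1 z.2) (univ ×ˢ Ioi 0))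
    (hstable : Stable psi)
    (p q r l : ℝ) (hp : 4 ≤ p) (hq : 1 < q) (hr : 1 < r) (hl : 1 < l)
    (hgrowth : GrowthConditions psi p q r l)
    -- the smooth adiabatic solution, with values in `Γ_{M,δ}`
    (T : ℝ) (hT : 0 < T) (Ub : ThermoField) (hUb : IsAdiabaticSolution psi T Ub)
    (M d : ℝ) (hM : 0 < M) (hd : 0 < d) (hGamma : InGamma M d T Ub) :
    -- stability estimate; the constant does not depend on the coefficients or on `U`
    (∃ C : ℝ, 0 < C ∧
      ∀ mu k : Mat3 → ℝ → ℝ, Coefficient mu → Coefficient k →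
      ∀ U : ThermoField, IsStrongSolution psi mu k T U →
      ∀ t ∈ Icc 0 T,
        totalRelEntropy psi U Ub t
          ≤ C * (totalRelEntropy psi U Ub 0 + diffusionError mu k T U Ub)) ∧
    -- convergence, for coefficients with amplitudes `m` and `n` and solutions `U m n`
    (∀ (a : ℝ) (mu k : ℝ → Mat3 → ℝ → ℝ) (U : ℝ → ℝ → ThermoField), 0 < a →
      (∀ m ∈ Ioo 0 a, Coefficient (mu m)) →
      (∀ n ∈ Ioo 0 a, Coefficient (k n)) →
      (∀ m ∈ Ioo 0 a, ∀ n ∈ Ioo 0 a, IsStrongSolution psi (mu m) (k n) T (U m n)) →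
      (∃ C : ℝ, 0 < C ∧ ∀ (xi : Xi) (th : ℝ), 0 < th →
        (∀ m ∈ Ioo 0 a, |mu m xi.1 th * th| ≤ C * m * |ener psi xi th|) ∧
        (∀ n ∈ Ioo 0 a, |k n xi.1 th| ≤ C * n * |ener psi xi th|)) →
      Tendsto (fun z : ℝ × ℝ => totalRelEntropy psi (U z.1 z.2) Ub 0)
        (𝓝[>] 0 ×ˢ 𝓝[>] 0) (𝓝 0) →
      (∀ m ∈ Ioo 0 a, ∀ n ∈ Ioo 0 a,
        BddAbove ((fun t => totalRelEntropy psi (U m n) Ub t) '' Ico 0 T)) ∧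
      Tendsto (fun z : ℝ × ℝ =>
          sSup ((fun t => totalRelEntropy psi (U z.1 z.2) Ub t) '' Ico 0 T))
        (𝓝[>] 0 ×ˢ 𝓝[>] 0) (𝓝 0)) := by
  obtain ⟨C, hC, hE⟩ := exists_errorBounds hpsi hstable hp hq hr hl hgrowth hM hd
  have hEB : ∀ (xi : Xi) (th : ℝ), 0 < th → ∀ t ∈ Icc 0 T, ∀ x,
      ErrorBounds psi C xi th (Ub.xi t x) (Ub.th t x) := fun xi th hth t ht x =>
    hE xi th hth _ _ (hGamma.norm_xi_le ht x) (hGamma t ht x).2.2.2.2.1 (hGamma t ht x).2.2.2.2.2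
  obtain ⟨K, hK, hstab⟩ := totalRelEntropy_le hpsi hstable hT hUb hC hEB
  refine ⟨⟨K, hK, hstab⟩, ?_⟩
  rintro a mu k U ha hmu hk hU ⟨C', hC', hbd⟩ hU0
  have hLb := hUb.lipField
  have hcont : ∀ m ∈ Ioo 0 a, ∀ n ∈ Ioo 0 a,
      ContinuousOn (totalRelEntropy psi (U m n) Ub) (Icc 0 T) := fun m hm n hn =>
    (((hU m hm n hn).lipField.relEntropy hpsi hLb).lipschitzOn_integral).choose_spec.continuousOn
  -- Finiteness of the supremum is independent of the limit: ∫I is Lipschitz in time on the closed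
  -- interval [0, T].
  refine ⟨fun m hm n hn => (isCompact_Icc.bddAbove_image (hcont m hm n hn)).mono
    (image_mono Ico_subset_Icc_self), ?_⟩
  obtain ⟨G, hG, hdiff⟩ := integral_diffusionDensity_le hpsi hT hUb hC hEB
  have hfst : Tendsto (fun z : ℝ × ℝ => z.1) (𝓝[>] 0 ×ˢ 𝓝[>] 0) (𝓝 0) :=
    tendsto_fst.mono_right nhdsWithin_le_nhds
  have hsnd : Tendsto (fun z : ℝ × ℝ => z.2) (𝓝[>] 0 ×ˢ 𝓝[>] 0) (𝓝 0) :=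
    tendsto_snd.mono_right nhdsWithin_le_nhds
  have herr : Tendsto (fun z : ℝ × ℝ => G * (C' * z.1 + C' * z.2)) (𝓝[>] 0 ×ˢ 𝓝[>] 0) (𝓝 0) := by
    simpa using ((hfst.const_mul C').add (hsnd.const_mul C')).const_mul G
  -- The diffusion error must be small enough for absorption; K, T, G and C' do not depend on the
  -- amplitudes, so this holds for all small ones.
  have hsmall : ∀ᶠ z : ℝ × ℝ in 𝓝[>] 0 ×ˢ 𝓝[>] 0,
      K * T * (G * (C' * z.1 + C' * z.2)) < 1 / 2 := by
    have := herr.const_mul (K * T)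
    rw [mul_zero] at this
    exact this.eventually_lt_const (by norm_num)
  have hmem : ∀ᶠ z : ℝ × ℝ in 𝓝[>] 0 ×ˢ 𝓝[>] 0, z.1 ∈ Ioo 0 a ∧ z.2 ∈ Ioo 0 a :=
    (tendsto_fst.eventually (Ioo_mem_nhdsGT ha)).and (tendsto_snd.eventually (Ioo_mem_nhdsGT ha))
  have hlim : Tendsto (fun z : ℝ × ℝ => 2 * K * totalRelEntropy psi (U z.1 z.2) Ub 0
      + 2 * K * T * (G * (C' * z.1 + C' * z.2))) (𝓝[>] 0 ×ˢ 𝓝[>] 0) (𝓝 0) := by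
    simpa using (hU0.const_mul (2 * K)).add (herr.const_mul (2 * K * T))
  refine tendsto_of_tendsto_of_tendsto_of_le_of_le' tendsto_const_nhds hlim ?_ ?_
  · filter_upwards [hmem] with z ⟨hm, hn⟩
    refine Real.sSup_nonneg ?_
    rintro _ ⟨t, ht, rfl⟩
    exact totalRelEntropy_nonneg hpsi hstable (hU _ hm _ hn).lipField hLb (Ico_subset_Icc_self ht)
  · filter_upwards [hmem, hsmall] with z ⟨hm, hn⟩ hz
    have hLU := (hU _ hm _ hn).lipField
    have h1 : 0 ≤ C' * z.1 := mul_nonneg hC'.le hm.1.le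
    have h2 : 0 ≤ C' * z.2 := mul_nonneg hC'.le hn.1.le
    have hD := continuousOn_integral_cube
      (continuousOn_diffusionDensity hT (hmu _ hm) (hk _ hn) hLU hUb)
    rw [← uIcc_of_le hT.le] at hD
    -- The resulting bound is uniform in t and consists of the initial relative entropy and the
    -- amplitudes only, which is the majorant of `hlim`.
    have key := le_of_le_integral_add hT hK.le (mul_nonneg hG (add_nonneg h1 h2))
      (hcont _ hm _ hn) (fun t ht => totalRelEntropy_nonneg hpsi hstable hLU hLb ht)
      hD.intervalIntegrable
      (hstab _ _ (hmu _ hm) (hk _ hn) _ (hU _ hm _ hn))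
      (hdiff _ _ (hmu _ hm) (hk _ hn) _ hLU _ _ h1 h2
        fun xi th hth => ⟨(hbd xi th hth).1 _ hm, (hbd xi th hth).2 _ hn⟩) hz.le
    refine csSup_le ((nonempty_Ico.2 hT).image _) ?_
    rintro _ ⟨t, ht, rfl⟩
    exact key t (Ico_subset_Icc_self ht)
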